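/- Let $\kappa>0$, $\gamma\in[0,\pi)$, let $\gamma_\kappa$ be a real number with $\Gamma(1+i\kappa)=\big(\tfrac{\pi\kappa}{\sinh(\pi\kappa)}\big)^{1/2}e^{i\gamma_\kappa}$, let $\alpha$ be a real function that is $C^\infty$ in a neighbourhood of $0$, and let $\zeta$ be a smooth real cut-off function with $\zeta(r)=1$ for $r<1/3$ and $\zeta(r)=0$ for $r>2/3$. For $\delta>0$ and $\tau>0$ consider on $(0,\delta)$ the problem $$\mathcal M h:=-\frac1r(rh')'-\frac{\kappa^2}{r^2}h=-\tau^2h,\qquad h\in\widehat D_\gamma(\tau),$$ where $\widehat D_\gamma(\tau)$ consists of all complex-valued functions $h=C\,\zeta(\tau r)\sin(\kappa\log\frac r2+\gamma)+v$ with $C\in\mathbb C$, $\int_0^\delta\big(|v''|^2+r^{-2}|v'|^2+r^{-4}|v|^2\big)\,r\,dr<\infty$ (weak derivatives) and $v'(\delta)+(\tau-\alpha(\tau^{-1}))v(\delta)=0$. (For $\tau\delta>2/3$ the last condition is the Robin condition $h'(\delta)+(\tau-\alpha(\tau^{-1}))h(\delta)=0$.) A number $\tau$ is an eigenvalue if this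 problem has a non-trivial solution (an eigenfunction). An eigenvalue $\tau$ is simple if the space of solutions is one-dimensional and no eigenfunction $h$ has an associated function, i.e. there is no $g=C\zeta(\tau r)\sin(\kappa\log\frac r2+\gamma)+v$, with $C$ constant and $v$ as above except for the boundary condition, such that $\mathcal M g+\tau^2g+2\tau h=0$ on $(0,\delta)$ and $v'(\delta)+(\tau-\alpha(\tau^{-1}))v(\delta)+\frac{d}{d\tau}\big(\tau-\alpha(\tau^{-1})\big)h(\delta)=0$. Let $I_{\nu}$, $K_\nu$ be the modified Bessel functions and put $L_{i\kappa}=\frac12(I_{i\kappa}+I_{-i\kappa})$, the real part of $I_{i\kappa}$ on $(0,\infty)$. With $R_\tau[h]=h'(\delta)+(\tau-\alpha(\tau^{-1}))h(\delta)$ let $$Q(\tau)=-\frac{R_\tau[K_{i\kappa}(\tau\,\cdot)]}{R_\tau[L_{i\kappa}(\tau\,\cdot)]}.$$ Then there is a constant $c>0$, independent of $\delta$, such that for every $\delta>0$ there exist an integer $k_\delta$ and positive numbers $\widehat\tau_{k_\delta}<\widehat\tau_{k_\delta+1}<\cdots$ with the following properties. (i) The eigenvalues $\tau\ge\widehat\tau_{k_\delta}$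 are exactly the numbers $\widehat\tau_k$, $k\ge k_\delta$, and each of them is simple. (ii) For all $k\ge k_\delta$, $\widehat\tau_k=e^{(\gamma_\kappa+\gamma+k\pi)/\kappa}(1+\varepsilon_k)$, where $|\varepsilon_k|\le c\,e^{-2\delta\widehat\tau_k}$ and also $|\varepsilon_k|\le c\exp\!\big(-2\delta e^{(\gamma_\kappa+\gamma+k\pi)/\kappa}\big)$. (iii) For all $k\ge k_\delta$, the function $\Phi_k(r)=K_{i\kappa}(\widehat\tau_kr)+Q(\widehat\tau_k)L_{i\kappa}(\widehat\tau_kr)$ is an eigenfunction at $\widehat\tau_k$. (iv) There is a constant $C_\delta$ such that for all $\tau\ge\widehat\tau_{k_\delta}$ the denominator in the definition of $Q(\tau)$ does not vanish and $|Q(\tau)|\le C_\delta\,\tau^{-1}e^{-2\delta\tau}$. -/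

import Mathlib

open Set MeasureTheory Filter Topology
open scoped ContDiff

namespace BesselRobin

noncomputable section

/-- The modified Bessel function of the first kind `I_ν(x)`, of complex order `ν`, for `x > 0`. -/
def besselI (ν : ℂ) (x : ℝ) : ℂ :=
  ∑' m : ℕ, ((x / 2 : ℝ) : ℂ) ^ (2 * (m : ℂ) + ν) /
    ((m.factorial : ℂ) * Complex.Gamma ((m : ℂ) + ν + 1))

/-- The modified Bessel function of the second kind (Macdonald function) `K_ν(x)`, of non-integer
complex order `ν`, for `x > 0`. -/
def besselK (ν : ℂ) (x : ℝ) : ℂ :=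
  (Real.pi / 2 : ℂ) * (besselI (-ν) x - besselI ν x) / Complex.sin (ν * Real.pi)

/-- `K_{iκ}(x)`. -/
def Kim (κ x : ℝ) : ℂ := besselK (κ * Complex.I) x

/-- The real solution of imaginary order `iκ` of the first kind, `(I_{iκ}(x) + I_{-iκ}(x)) / 2`,
i.e. the real part of `I_{iκ}(x)`. It is the one that behaves like
`(sinh (πκ) / (πκ)) ^ (1/2) * cos (κ log (x/2) - γ_κ)` as `x → 0`. -/
def Iim (κ x : ℝ) : ℂ := (besselI (κ * Complex.I) x + besselI (-(κ * Complex.I)) x) / 2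

/-- `f` is locally absolutely continuous on `(0, δ]` with weak derivative `g`, and `f`
is given there by its continuous representative. -/
def HasWeakDerivOn (δ : ℝ) (f g : ℝ → ℂ) : Prop :=
  ∀ a ∈ Ioc 0 δ, IntervalIntegrable g volume a δ ∧ f a = f δ - ∫ r in a..δ, g r

/-- `v` belongs to the weighted Sobolev space on `(0, δ)` with the norm
`(∫₀^δ (|v''|² + r⁻² |v'|² + r⁻⁴ |v|²) r dr) ^ (1/2)`, and `v₁`, `v₂` are its first and second
weak derivatives. The functions `v` and `v₁` are continuous on `(0, δ]`, so `v δ` and `v₁ δ` are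
the boundary values of `v` and `v'`. -/
structure MemV2 (δ : ℝ) (v v₁ v₂ : ℝ → ℂ) : Prop where
  deriv_one : HasWeakDerivOn δ v v₁
  deriv_two : HasWeakDerivOn δ v₁ v₂
  finite_norm : IntegrableOn
    (fun r : ℝ => (‖v₂ r‖ ^ 2 + ‖v₁ r‖ ^ 2 / r ^ 2 + ‖v r‖ ^ 2 / r ^ 4) * r) (Ioo 0 δ) volume

/-- `h = C ζ(τ r) sin (κ log (r/2) + γ) + v` on `(0, δ]` with a constant `C` and `v` in the weighted
Sobolev space, where `v` satisfies the inhomogeneous Robin condition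
`v'(δ) + (τ - α(τ⁻¹)) v(δ) = b`. -/
def MemDomainInhom (κ γ δ : ℝ) (α ζ : ℝ → ℝ) (τ : ℝ) (b : ℂ) (h : ℝ → ℂ) : Prop :=
  ∃ (C : ℂ) (v v₁ v₂ : ℝ → ℂ), MemV2 δ v v₁ v₂ ∧
    v₁ δ + ((τ - α τ⁻¹ : ℝ) : ℂ) * v δ = b ∧
    ∀ r ∈ Ioc 0 δ,
      h r = C * ((ζ (τ * r) * Real.sin (κ * Real.log (r / 2) + γ) : ℝ) : ℂ) + v r

/-- The domain of the operator with parameter `τ`: the Robin condition is homogeneous. -/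
def MemDomain (κ γ δ : ℝ) (α ζ : ℝ → ℝ) (τ : ℝ) (h : ℝ → ℂ) : Prop :=
  MemDomainInhom κ γ δ α ζ τ 0 h

/-- The differential expression `- r⁻¹ (r h')' - κ² r⁻² h`. On the functions of the domain the
derivatives exist almost everywhere on `(0, δ)` and are the weak ones. -/
def besselOp (κ : ℝ) (h : ℝ → ℂ) (r : ℝ) : ℂ :=
  -((r : ℂ)⁻¹ * deriv (fun s : ℝ => (s : ℂ) * deriv h s) r) - (κ : ℂ) ^ 2 / (r : ℂ) ^ 2 * h r

/-- `h` is an eigenfunction at the parameter `τ`: a non-trivial function of the domain with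
`- r⁻¹ (r h')' - κ² r⁻² h = - τ² h` on `(0, δ)`. -/
def IsEigenfunction (κ γ δ : ℝ) (α ζ : ℝ → ℝ) (τ : ℝ) (h : ℝ → ℂ) : Prop :=
  MemDomain κ γ δ α ζ τ h ∧ (∃ r ∈ Ioo 0 δ, h r ≠ 0) ∧
    ∀ᵐ r ∂(volume.restrict (Ioo 0 δ)), besselOp κ h r = -(τ : ℂ) ^ 2 * h r

/-- `τ` is an eigenvalue of the boundary value problem with parameter. -/
def IsEigenvalue (κ γ δ : ℝ) (α ζ : ℝ → ℝ) (τ : ℝ) : Prop :=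
  ∃ h, IsEigenfunction κ γ δ α ζ τ h

/-- `g` is an associated function of the eigenfunction `h` at `τ`: it solves the problem obtained by
formally differentiating the equation and the Robin condition with respect to `τ`. -/
def IsAssociated (κ γ δ : ℝ) (α ζ : ℝ → ℝ) (τ : ℝ) (h g : ℝ → ℂ) : Prop :=
  MemDomainInhom κ γ δ α ζ τ (-((deriv (fun t : ℝ => t - α t⁻¹) τ : ℝ) : ℂ) * h δ) g ∧
    ∀ᵐ r ∂(volume.restrict (Ioo 0 δ)),
      besselOp κ g r + (τ : ℂ) ^ 2 * g r + 2 * (τ : ℂ) * h r = 0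

/-- `τ` is a simple eigenvalue: the eigenspace is one-dimensional (functions are compared on
`(0, δ]`) and no eigenfunction has an associated function. -/
def IsSimpleEigenvalue (κ γ δ : ℝ) (α ζ : ℝ → ℝ) (τ : ℝ) : Prop :=
  (∃ φ, IsEigenfunction κ γ δ α ζ τ φ ∧
    ∀ h, IsEigenfunction κ γ δ α ζ τ h → ∃ c : ℂ, ∀ r ∈ Ioc 0 δ, h r = c * φ r) ∧
  ∀ h, IsEigenfunction κ γ δ α ζ τ h → ¬ ∃ g, IsAssociated κ γ δ α ζ τ h g

/-- The Robin expression `h'(δ) + (τ - α(τ⁻¹)) h(δ)` of a function differentiable at `δ`. -/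
def robin (δ : ℝ) (α : ℝ → ℝ) (τ : ℝ) (h : ℝ → ℂ) : ℂ :=
  deriv h δ + ((τ - α τ⁻¹ : ℝ) : ℂ) * h δ

/-- The coefficient `Q(τ)` for which `r ↦ K_{iκ}(τ r) + Q(τ) I_{iκ}(τ r)` satisfies the Robin
condition at `δ`. -/
def Q (κ δ : ℝ) (α : ℝ → ℝ) (τ : ℝ) : ℂ :=
  -robin δ α τ (fun r => Kim κ (τ * r)) / robin δ α τ (fun r => Iim κ (τ * r))

/-- The function `K_{iκ}(τ r) + Q(τ) I_{iκ}(τ r)`. -/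
def Phi (κ δ : ℝ) (α : ℝ → ℝ) (τ r : ℝ) : ℂ :=
  Kim κ (τ * r) + Q κ δ α τ * Iim κ (τ * r)

/-- The leading term `e^{(γ_κ + γ + kπ)/κ}` of the `k`-th eigenvalue. -/
def tauLead (κ γ γκ : ℝ) (k : ℤ) : ℝ := Real.exp ((γκ + γ + k * Real.pi) / κ)

end

end BesselRobin

/-! For fixed `τ` the equation has the two real solutions Re and Im of `I_{iκ}(τ r)`. Near zero
`I_{iκ}(x)` is `(x/2)^{iκ} / Γ(1+iκ)` up to `O(x²)`, so the behaviour required at zero leaves, up to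
a factor, the single solution `Im (w I_{iκ}(τ r))` with `w = exp (-i s(τ))`, `s(τ) = κ log τ - γ_κ -
γ`. That nothing else survives follows from the bracket `r (h' y - h y')` of two solutions: it is
constant, and it tends to zero along a sequence when both have the prescribed behaviour
(`IsEigenfunction.eq_mul_osc`).

With `R(τ)` the Robin expression of `I_{iκ}(τ r)`, the eigenvalue condition becomes `Im (w R(τ)) =
0`. Once `Re R > 0` this says that `s(τ) - arctan q(τ)` lies in `πℤ`, where `q = Im R / Re R`
(`isEigenvalue_iff`). For `q = 0` the roots are exactly the leading terms, so everything rests on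
`q` being small. It tends to zero because `I_{iκ}(x)` and its derivative are both asymptotic to the
real function `I_0(x)`. Its derivative is a Wronskian term divided by `(Re R)²`, hence `O(t⁻¹
e^{-2δt})` (`exists_deriv_robinQuot_le`), and integrating from infinity gives the same bound for
`q`. The derivative `κ/t` of `s` then dominates, so the phase is strictly increasing and takes each
large multiple of `π` once. Since `Q` is a constant multiple of `q`, the bound on `Q` comes from the
same estimate.

The comparison with `I_0` is probabilistic: the series of `I_{iκ}(2y)`, divided by `I_0(2y)`, is an
average of `y^{iκ} m!/Γ(m+1+iκ)` over the weights `(y^m/m!)²`, which concentrate at `m ≈ y`. Euler's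
limit formula shows that the averaged quantity tends to one there.

An associated function `g` is excluded by a sign: its bracket with the eigenfunction, suitably
normalised, starts at zero, is increasing with derivative `2 τ r y²`, and is nonpositive at `δ`
(`not_isAssociated`). -/

namespace BesselRobin

/-! ### Power series of the Bessel functions of the first kind -/

/-- The coefficients of the entire function `z ↦ z ^ (-ν / 2) * I_ν (2 * √z)`. -/
noncomputable def entireCoeff (ν : ℂ) (m : ℕ) : ℂ :=
  ((m.factorial : ℂ) * Complex.Gamma ((m : ℂ) + ν + 1))⁻¹

/-- The entire factor of the Bessel function `I_ν`, on the real line: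
`I_ν(x) = (x/2)^ν * entireI ν (x²/4)`. -/
noncomputable def entireI (ν : ℂ) (z : ℝ) : ℂ := ∑' m : ℕ, (z : ℂ) ^ m * entireCoeff ν m

lemma add_one_ne_zero_of_re {ν : ℂ} (hν : 0 ≤ ν.re) (m : ℕ) : (m : ℂ) + ν + 1 ≠ 0 := by
  intro h
  have := congrArg Complex.re h
  simp at this
  have : (0 : ℝ) ≤ m := m.cast_nonneg
  linarith

lemma Gamma_ne_zero_of_re {ν : ℂ} (hν : 0 ≤ ν.re) (m : ℕ) :
    Complex.Gamma ((m : ℂ) + ν + 1) ≠ 0 := by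
  apply Complex.Gamma_ne_zero_of_re_pos
  simp
  have : (0 : ℝ) ≤ m := m.cast_nonneg
  linarith

lemma entireCoeff_ne_zero {ν : ℂ} (hν : 0 ≤ ν.re) (m : ℕ) : entireCoeff ν m ≠ 0 :=
  inv_ne_zero (mul_ne_zero (by exact_mod_cast m.factorial_ne_zero) (Gamma_ne_zero_of_re hν m))

/-- Both sides contain the same Gamma value; only the factorials differ. This is why differentiating
the series raises the order by one. -/
lemma entireCoeff_add_one (ν : ℂ) (m : ℕ) :
    entireCoeff (ν + 1) m = (m + 1) * entireCoeff ν (m + 1) := by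
  have h : ((m : ℂ) + 1) ≠ 0 := by exact_mod_cast m.succ_ne_zero
  simp only [entireCoeff, Nat.factorial_succ, Nat.cast_mul, Nat.cast_add, Nat.cast_one]
  rw [show (m : ℂ) + (ν + 1) + 1 = m + 1 + ν + 1 by ring]
  rw [mul_inv, mul_inv, mul_inv]
  field_simp

lemma entireCoeff_eq {ν : ℂ} (hν : 0 ≤ ν.re) (m : ℕ) :
    entireCoeff ν m = (m + ν + 1) * entireCoeff (ν + 1) m := by
  have h := add_one_ne_zero_of_re hν m
  simp only [entireCoeff]
  rw [show (m : ℂ) + (ν + 1) + 1 = (m + ν + 1) + 1 by ring, Complex.Gamma_add_one _ h]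
  rw [mul_inv, mul_inv, mul_inv]
  field_simp

lemma entireCoeff_succ {ν : ℂ} (hν : 0 ≤ ν.re) (m : ℕ) :
    entireCoeff ν m = (m + ν + 1) * ((m + 1) * entireCoeff ν (m + 1)) := by
  rw [entireCoeff_eq hν, entireCoeff_add_one]

lemma summable_norm_entireCoeff {ν : ℂ} (hν : 0 ≤ ν.re) (R : ℝ) :
    Summable (fun m : ℕ => R ^ m * ‖entireCoeff ν m‖) := by
  rcases eq_or_ne R 0 with rfl | hR
  · refine summable_of_ne_finset_zero (s := {0}) fun m hm => ?_
    simp at hm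
    simp [hm]
  refine summable_of_ratio_test_tendsto_lt_one (l := 0) zero_lt_one
    (Eventually.of_forall fun m => mul_ne_zero (pow_ne_zero _ hR)
      (norm_ne_zero_iff.2 (entireCoeff_ne_zero hν m))) ?_
  have hlim : Tendsto (fun m : ℕ => |R| / ((m : ℝ) + 1)) atTop (𝓝 0) :=
    tendsto_const_nhds.div_atTop (tendsto_atTop_add_const_right _ _ tendsto_natCast_atTop_atTop)
  refine squeeze_zero (fun m => by positivity) (fun m => ?_) hlim
  have h1 : ‖entireCoeff ν m‖ = ‖(m : ℂ) + ν + 1‖ * ((m + 1) * ‖entireCoeff ν (m + 1)‖) := by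
    conv_lhs => rw [entireCoeff_succ hν m]
    rw [norm_mul, norm_mul]
    congr 2
    exact_mod_cast Complex.norm_natCast (m + 1)
  -- This crude bound suffices: the other factor `m + 1` already drives the ratio of consecutive
  -- terms to zero.
  have h2 : 1 ≤ ‖(m : ℂ) + ν + 1‖ := by
    refine le_trans ?_ (Complex.re_le_norm _)
    simp
    positivity
  have h3 : 0 < ‖entireCoeff ν (m + 1)‖ := norm_pos_iff.2 (entireCoeff_ne_zero hν _)
  have h4 : 0 < |R| ^ m := by positivity
  simp only [norm_mul, norm_pow, Real.norm_eq_abs, abs_norm]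
  rw [h1, pow_succ, div_le_div_iff₀ (by positivity) (by positivity)]
  have : |R| ^ m * |R| * ‖entireCoeff ν (m + 1)‖ * ((m : ℝ) + 1) * 1
      ≤ |R| ^ m * |R| * ‖entireCoeff ν (m + 1)‖ * ((m : ℝ) + 1) * ‖(m : ℂ) + ν + 1‖ := by gcongr
  linarith

lemma summable_entireI {ν : ℂ} (hν : 0 ≤ ν.re) (z : ℝ) :
    Summable (fun m : ℕ => (z : ℂ) ^ m * entireCoeff ν m) := by
  refine Summable.of_norm ((summable_norm_entireCoeff hν |z|).congr fun m => ?_)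
  simp

/-- Termwise differentiation on the ball of radius `|z| + 1`; after an index shift the majorant is
the absolutely convergent series of order `ν + 1`. -/
lemma hasDerivAt_entireI {ν : ℂ} (hν : 0 ≤ ν.re) (z : ℝ) :
    HasDerivAt (entireI ν) (entireI (ν + 1) z) z := by
  have hν1 : 0 ≤ (ν + 1).re := by simp; linarith
  set R : ℝ := |z| + 1 with hR
  have hR0 : 0 < R := by positivity
  let g : ℕ → ℝ → ℂ := fun m w => (w : ℂ) ^ m * entireCoeff ν m
  let g' : ℕ → ℝ → ℂ := fun m w => (m : ℂ) * (w : ℂ) ^ (m - 1) * entireCoeff ν m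
  let u : ℕ → ℝ := fun m => m * R ^ (m - 1) * ‖entireCoeff ν m‖
  have hu : Summable u := by
    rw [← summable_nat_add_iff 1]
    refine (summable_norm_entireCoeff hν1 R).congr fun m => ?_
    have : ‖(m : ℂ) + 1‖ = (m : ℝ) + 1 := by exact_mod_cast Complex.norm_natCast (m + 1)
    simp only [u, entireCoeff_add_one, norm_mul, this]
    push_cast
    ring
  have hz : z ∈ Metric.ball (0 : ℝ) R := by simp [hR]
  have key := hasDerivAt_tsum_of_isPreconnected (𝕜 := ℝ) (g := g) (g' := g') hu
    (Metric.isOpen_ball (x := (0 : ℝ)) (ε := R)) (convex_ball (0 : ℝ) R).isPreconnected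
    (fun m w _ => by
      have h := ((hasDerivAt_id (w : ℂ)).pow m).comp_ofReal
      have h2 := h.mul_const (entireCoeff ν m)
      simpa [g, g'] using h2)
    (fun m w hw => by
      have hw' : |w| ≤ R := by simpa using (mem_ball_zero_iff.1 hw).le
      simp only [g', u, norm_mul, norm_pow, Complex.norm_natCast, Complex.norm_real,
        Real.norm_eq_abs]
      gcongr)
    hz (summable_entireI hν z) hz
  refine HasDerivAt.congr_deriv (f := entireI ν) key ?_
  rw [entireI, (Summable.of_norm_bounded hu (fun m => ?_)).tsum_eq_zero_add]
  · simp only [g', Nat.cast_zero, zero_mul, zero_add]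
    refine tsum_congr fun m => ?_
    rw [entireCoeff_add_one]
    push_cast
    ring
  · simp only [g', u, norm_mul, norm_pow, Complex.norm_natCast, Complex.norm_real,
        Real.norm_eq_abs]
    have : |z| ≤ R := by linarith
    gcongr

lemma continuous_entireI {ν : ℂ} (hν : 0 ≤ ν.re) : Continuous (entireI ν) :=
  continuous_iff_continuousAt.2 fun z => (hasDerivAt_entireI hν z).continuousAt

/-- The factor `m + ν + 1` in `entireCoeff_eq` splits into `m`, which shifts the index and raises
the order again, and the constant `ν + 1`. -/
lemma entireI_recurrence {ν : ℂ} (hν : 0 ≤ ν.re) (z : ℝ) :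
    (z : ℂ) * entireI (ν + 2) z + (ν + 1) * entireI (ν + 1) z = entireI ν z := by
  have h1 : 0 ≤ (ν + 1).re := by simp; linarith
  have h2 : 0 ≤ (ν + 2).re := by simp; linarith
  have s : Summable (fun m : ℕ => (m : ℂ) * ((z : ℂ) ^ m * entireCoeff (ν + 1) m)) := by
    rw [← summable_nat_add_iff 1]
    refine ((summable_entireI h2 z).mul_left (z : ℂ)).congr fun m => ?_
    rw [show ν + 2 = ν + 1 + 1 by ring, entireCoeff_add_one]
    push_cast
    ring
  have e : (z : ℂ) * entireI (ν + 2) z =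
      ∑' m : ℕ, (m : ℂ) * ((z : ℂ) ^ m * entireCoeff (ν + 1) m) := by
    rw [s.tsum_eq_zero_add, entireI, ← tsum_mul_left]
    simp only [Nat.cast_zero, zero_mul, zero_add]
    refine tsum_congr fun m => ?_
    rw [show ν + 2 = ν + 1 + 1 by ring, entireCoeff_add_one (ν + 1)]
    push_cast
    ring
  rw [e, entireI, ← tsum_mul_left, ← s.tsum_add ((summable_entireI h1 z).mul_left _), entireI]
  refine tsum_congr fun m => ?_
  rw [entireCoeff_eq hν]
  ring

lemma entireI_zero (ν : ℂ) : entireI ν 0 = (Complex.Gamma (ν + 1))⁻¹ := by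
  rw [entireI, tsum_eq_single 0 (fun m hm => by simp [hm])]
  simp [entireCoeff]

lemma besselI_eq (ν : ℂ) {x : ℝ} (hx : 0 < x) :
    besselI ν x = ((x / 2 : ℝ) : ℂ) ^ ν * entireI ν (x ^ 2 / 4) := by
  have h : ((x / 2 : ℝ) : ℂ) ≠ 0 := by exact_mod_cast (half_pos hx).ne'
  rw [besselI, entireI, ← tsum_mul_left]
  refine tsum_congr fun m => ?_
  rw [Complex.cpow_add _ _ h, entireCoeff, div_eq_mul_inv]
  have : ((x / 2 : ℝ) : ℂ) ^ (2 * (m : ℂ)) = ((x ^ 2 / 4 : ℝ) : ℂ) ^ m := by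
    rw [show (2 * (m : ℂ)) = ((2 * m : ℕ) : ℂ) by push_cast; ring, Complex.cpow_natCast, pow_mul]
    push_cast
    ring
  rw [this]
  ring

lemma hasDerivAt_cpow_half (ν : ℂ) {x : ℝ} (hx : 0 < x) :
    HasDerivAt (fun r : ℝ => ((r / 2 : ℝ) : ℂ) ^ ν) (ν / x * ((x / 2 : ℝ) : ℂ) ^ ν) x := by
  have hx' : (x : ℂ) ≠ 0 := by exact_mod_cast hx.ne'
  have h : ((x / 2 : ℝ) : ℂ) ≠ 0 := by exact_mod_cast (half_pos hx).ne'
  have h1 : HasDerivAt (fun z : ℂ => (z / 2) ^ ν) (ν * ((x : ℂ) / 2) ^ (ν - 1) * (1 / 2)) x :=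
    ((hasDerivAt_id (x : ℂ)).div_const 2).cpow_const
      (Or.inl (by simpa using half_pos hx))
  have h2 := h1.comp_ofReal
  push_cast at h ⊢
  refine h2.congr_deriv ?_
  rw [Complex.cpow_sub _ _ h, Complex.cpow_one]
  field_simp

lemma cpow_half_add_one (ν : ℂ) {x : ℝ} (hx : 0 < x) :
    ((x / 2 : ℝ) : ℂ) ^ (ν + 1) = ((x / 2 : ℝ) : ℂ) ^ ν * (x / 2) := by
  have h : ((x / 2 : ℝ) : ℂ) ≠ 0 := by exact_mod_cast (half_pos hx).ne'
  rw [Complex.cpow_add _ _ h, Complex.cpow_one]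
  push_cast
  ring

lemma hasDerivAt_besselI {ν : ℂ} (hν : 0 ≤ ν.re) {x : ℝ} (hx : 0 < x) :
    HasDerivAt (besselI ν) (ν / x * besselI ν x + besselI (ν + 1) x) x := by
  have h1 : HasDerivAt (fun r : ℝ => r ^ 2 / 4) (x / 2) x := by
    refine ((hasDerivAt_pow 2 x).div_const 4).congr_deriv ?_
    push_cast
    ring
  have h2 := (hasDerivAt_entireI hν (x ^ 2 / 4)).scomp x h1
  have h3 := (hasDerivAt_cpow_half ν hx).mul h2
  have h4 : besselI ν =ᶠ[𝓝 x]
      ((fun r : ℝ => ((r / 2 : ℝ) : ℂ) ^ ν) * (entireI ν ∘ fun r : ℝ => r ^ 2 / 4)) := by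
    filter_upwards [lt_mem_nhds hx] with r hr
    exact besselI_eq ν hr
  refine (h3.congr_of_eventuallyEq h4).congr_deriv ?_
  rw [besselI_eq ν hx, besselI_eq (ν + 1) hx, cpow_half_add_one ν hx, Complex.real_smul,
    Function.comp_apply]
  push_cast
  ring

/-- The recurrence eliminates the order `ν + 2`. Together with `hasDerivAt_besselI` this closes a
first-order system for the orders `ν` and `ν + 1`, which replaces the Bessel equation below. -/
lemma hasDerivAt_besselI_add_one {ν : ℂ} (hν : 0 ≤ ν.re) {x : ℝ} (hx : 0 < x) :
    HasDerivAt (besselI (ν + 1)) (besselI ν x - (ν + 1) / x * besselI (ν + 1) x) x := by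
  have hx' : (x : ℂ) ≠ 0 := by exact_mod_cast hx.ne'
  refine (hasDerivAt_besselI (ν := ν + 1) (by simp; linarith) hx).congr_deriv ?_
  rw [besselI_eq ν hx, besselI_eq (ν + 1) hx, besselI_eq (ν + 1 + 1) hx,
    cpow_half_add_one (ν + 1) hx, cpow_half_add_one ν hx, ← entireI_recurrence hν,
    show ν + 1 + 1 = ν + 2 by ring]
  push_cast
  field_simp
  ring

/-! ### Imaginary order: real and imaginary parts of `I_{iκ}` -/

open scoped ComplexConjugate

lemma re_mul_I_nonneg (κ : ℝ) : 0 ≤ ((κ : ℂ) * Complex.I).re := by simp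

/-- `I_{iκ}(x)`. -/
noncomputable def imI (κ x : ℝ) : ℂ := besselI (κ * Complex.I) x

/-- The derivative of `I_{iκ}` at `x > 0`. -/
noncomputable def imIDeriv (κ x : ℝ) : ℂ :=
  κ * Complex.I / x * imI κ x + besselI (κ * Complex.I + 1) x

lemma hasDerivAt_imI (κ : ℝ) {x : ℝ} (hx : 0 < x) : HasDerivAt (imI κ) (imIDeriv κ x) x :=
  hasDerivAt_besselI (re_mul_I_nonneg κ) hx

lemma hasDerivAt_const_div {c : ℂ} {x : ℝ} (hx : 0 < x) :
    HasDerivAt (fun r : ℝ => c / (r : ℂ)) (-c / (x : ℂ) ^ 2) x := by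
  have hx' : (x : ℂ) ≠ 0 := by exact_mod_cast hx.ne'
  simpa [div_eq_mul_inv, neg_mul, mul_comm] using
    (((hasDerivAt_inv hx').comp_ofReal).const_mul c)

lemma hasDerivAt_imIDeriv (κ : ℝ) {x : ℝ} (hx : 0 < x) :
    HasDerivAt (imIDeriv κ)
      ((1 - (κ : ℂ) ^ 2 / (x : ℂ) ^ 2) * imI κ x - imIDeriv κ x / x) x := by
  have hx' : (x : ℂ) ≠ 0 := by exact_mod_cast hx.ne'
  have h := ((hasDerivAt_const_div (c := κ * Complex.I) hx).mul (hasDerivAt_imI κ hx)).add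
    (hasDerivAt_besselI_add_one (re_mul_I_nonneg κ) hx)
  refine h.congr_deriv ?_
  simp only [imIDeriv, imI]
  field_simp
  ring_nf
  simp only [Complex.I_sq]
  ring

lemma cpow_half_mul_I (κ : ℝ) {x : ℝ} (hx : 0 < x) :
    ((x / 2 : ℝ) : ℂ) ^ ((κ : ℂ) * Complex.I) =
      Complex.exp ((κ * Real.log (x / 2) : ℝ) * Complex.I) := by
  have h : ((x / 2 : ℝ) : ℂ) ≠ 0 := by exact_mod_cast (half_pos hx).ne'
  rw [Complex.cpow_def_of_ne_zero h, ← Complex.ofReal_log (half_pos hx).le]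
  congr 1
  push_cast
  ring

lemma norm_cpow_half_mul_I (κ : ℝ) {x : ℝ} (hx : 0 < x) :
    ‖((x / 2 : ℝ) : ℂ) ^ ((κ : ℂ) * Complex.I)‖ = 1 := by
  rw [cpow_half_mul_I κ hx, Complex.norm_exp_ofReal_mul_I]

lemma entireI_conj (ν : ℂ) (z : ℝ) : entireI (conj ν) z = conj (entireI ν z) := by
  rw [entireI, entireI, Complex.conj_tsum]
  refine tsum_congr fun m => ?_
  simp [entireCoeff, ← Complex.Gamma_conj]

/-- The coefficients and the power of a positive base commute with conjugation. Hence both standard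
solutions are real: one is the real part of `I_{iκ}`, the other a multiple of its imaginary part. -/
lemma besselI_neg_mul_I (κ : ℝ) {x : ℝ} (hx : 0 < x) :
    besselI (-(κ * Complex.I)) x = conj (imI κ x) := by
  have h1 : (-(κ * Complex.I) : ℂ) = conj ((κ : ℂ) * Complex.I) := by simp
  have h2 : (((x / 2 : ℝ) : ℂ)).arg ≠ Real.pi := by
    rw [Complex.arg_ofReal_of_nonneg (half_pos hx).le]
    exact Real.pi_pos.ne
  rw [imI, besselI_eq _ hx, besselI_eq _ hx, h1, entireI_conj, Complex.cpow_conj _ _ h2,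
    Complex.conj_ofReal, map_mul]

lemma Iim_eq (κ : ℝ) {x : ℝ} (hx : 0 < x) : Iim κ x = ((imI κ x).re : ℂ) := by
  rw [Iim, besselI_neg_mul_I κ hx, ← imI, Complex.add_conj]
  push_cast
  ring

lemma Kim_eq (κ : ℝ) {x : ℝ} (hx : 0 < x) :
    Kim κ x = ((-(Real.pi / Real.sinh (Real.pi * κ)) * (imI κ x).im : ℝ) : ℂ) := by
  have h : Complex.sin ((κ : ℂ) * Complex.I * Real.pi)
      = (Real.sinh (Real.pi * κ) : ℂ) * Complex.I := by
    rw [show (κ : ℂ) * Complex.I * Real.pi = ((Real.pi * κ : ℝ) : ℂ) * Complex.I by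
      push_cast; ring, Complex.sin_mul_I, Complex.ofReal_sinh]
  have h2 : conj (imI κ x) - imI κ x = -(2 * (imI κ x).im * Complex.I) := by
    rw [← neg_sub, Complex.sub_conj]
    push_cast
    ring
  rw [Kim, besselK, besselI_neg_mul_I κ hx, ← imI, h, h2]
  rcases eq_or_ne (Real.sinh (Real.pi * κ)) 0 with h0 | h0
  · simp [h0]
  have h0' : (Real.sinh (Real.pi * κ) : ℂ) ≠ 0 := by exact_mod_cast h0
  push_cast at h0' ⊢
  field_simp

/-! ### Behaviour at zero -/

/-- The difference of `I_{iκ}` and its leading term at zero. -/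
noncomputable def imIRem (κ x : ℝ) : ℂ :=
  imI κ x - (Complex.Gamma (1 + κ * Complex.I))⁻¹ *
    Complex.exp ((κ * Real.log (x / 2) : ℝ) * Complex.I)

/-- The derivative of `imIRem`. -/
noncomputable def imIRemDeriv (κ x : ℝ) : ℂ :=
  κ * Complex.I / x * imIRem κ x + besselI (κ * Complex.I + 1) x

/-- The second derivative of `imIRem`. -/
noncomputable def imIRemDeriv2 (κ x : ℝ) : ℂ :=
  -(κ * Complex.I) / (x : ℂ) ^ 2 * imIRem κ x + κ * Complex.I / x * imIRemDeriv κ x +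
    (imI κ x - (κ * Complex.I + 1) / x * besselI (κ * Complex.I + 1) x)

lemma hasDerivAt_imIRem (κ : ℝ) {x : ℝ} (hx : 0 < x) :
    HasDerivAt (imIRem κ) (imIRemDeriv κ x) x := by
  have h1 := (hasDerivAt_cpow_half (κ * Complex.I) hx).const_mul
    (Complex.Gamma (1 + κ * Complex.I))⁻¹
  have h2 : (fun r : ℝ => (Complex.Gamma (1 + κ * Complex.I))⁻¹ *
      Complex.exp ((κ * Real.log (r / 2) : ℝ) * Complex.I)) =ᶠ[𝓝 x]
      (fun r : ℝ => (Complex.Gamma (1 + κ * Complex.I))⁻¹ *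
        ((r / 2 : ℝ) : ℂ) ^ ((κ : ℂ) * Complex.I)) := by
    filter_upwards [lt_mem_nhds hx] with r hr
    rw [cpow_half_mul_I κ hr]
  refine ((hasDerivAt_imI κ hx).sub (h1.congr_of_eventuallyEq h2)).congr_deriv ?_
  rw [cpow_half_mul_I κ hx, imIRemDeriv, imIRem, imIDeriv]
  ring

lemma hasDerivAt_imIRemDeriv (κ : ℝ) {x : ℝ} (hx : 0 < x) :
    HasDerivAt (imIRemDeriv κ) (imIRemDeriv2 κ x) x :=
  ((hasDerivAt_const_div (c := κ * Complex.I) hx).mul (hasDerivAt_imIRem κ hx)).add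
    (hasDerivAt_besselI_add_one (re_mul_I_nonneg κ) hx)

/-- The oscillating factor `(x/2)^{iκ}` has modulus one, so the remainder has the modulus of an
increment of a differentiable function of `x²/4`. -/
lemma imIRem_isBigO (κ : ℝ) : imIRem κ =O[𝓝[>] 0] (fun x : ℝ => x ^ 2) := by
  have h1 : (fun z : ℝ => entireI (κ * Complex.I) z - entireI (κ * Complex.I) 0)
      =O[𝓝 0] (fun z : ℝ => z) := by
    simpa using (hasDerivAt_entireI (re_mul_I_nonneg κ) 0).isBigO_sub
  have ht : Tendsto (fun x : ℝ => x ^ 2 / 4) (𝓝[>] 0) (𝓝 0) := by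
    have : Tendsto (fun x : ℝ => x ^ 2 / 4) (𝓝 0) (𝓝 (0 ^ 2 / 4)) :=
      (Continuous.tendsto (by fun_prop) 0)
    simpa using this.mono_left nhdsWithin_le_nhds
  have h2 := (h1.comp_tendsto ht).norm_left
  have h3 : (fun x => ‖imIRem κ x‖) =ᶠ[𝓝[>] 0] (fun x : ℝ =>
      ‖entireI (κ * Complex.I) (x ^ 2 / 4) - entireI (κ * Complex.I) 0‖) := by
    filter_upwards [self_mem_nhdsWithin] with x hx
    have hx : 0 < x := hx
    rw [imIRem, imI, besselI_eq _ hx, ← cpow_half_mul_I κ hx, entireI_zero,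
      add_comm ((κ : ℂ) * Complex.I) 1, mul_comm (Complex.Gamma _)⁻¹, ← mul_sub, norm_mul,
      norm_cpow_half_mul_I κ hx, one_mul]
  refine Asymptotics.IsBigO.of_norm_left ?_
  refine (h2.congr' h3.symm EventuallyEq.rfl).trans ?_
  refine Asymptotics.IsBigO.of_bound 1 (Eventually.of_forall fun x => ?_)
  simp only [Function.comp, norm_div, norm_pow, Real.norm_eq_abs]
  norm_num
  nlinarith [sq_nonneg x]

lemma imI_isBigO_one (κ : ℝ) : imI κ =O[𝓝[>] 0] (fun _ : ℝ => (1 : ℝ)) := by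
  have h1 : (fun x : ℝ => entireI (κ * Complex.I) (x ^ 2 / 4)) =O[𝓝[>] 0]
      (fun _ : ℝ => (1 : ℝ)) := by
    refine Asymptotics.IsBigO.mono (Tendsto.isBigO_one ℝ (Continuous.tendsto ?_ 0))
      nhdsWithin_le_nhds
    exact (continuous_entireI (re_mul_I_nonneg κ)).comp (by fun_prop)
  refine Asymptotics.IsBigO.trans (Asymptotics.IsBigO.of_bound 1 ?_) h1
  filter_upwards [self_mem_nhdsWithin] with x hx
  rw [imI, besselI_eq _ hx, norm_mul, norm_cpow_half_mul_I κ hx]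

lemma besselI_add_one_isBigO (κ : ℝ) :
    besselI (κ * Complex.I + 1) =O[𝓝[>] 0] (fun x : ℝ => x) := by
  have h1 : (fun x : ℝ => entireI (κ * Complex.I + 1) (x ^ 2 / 4)) =O[𝓝[>] 0]
      (fun _ : ℝ => (1 : ℝ)) := by
    refine Asymptotics.IsBigO.mono (Tendsto.isBigO_one ℝ (Continuous.tendsto ?_ 0))
      nhdsWithin_le_nhds
    exact (continuous_entireI (by simp)).comp (by fun_prop)
  have h2 := (Asymptotics.isBigO_refl (fun x : ℝ => x) (𝓝[>] 0)).smul h1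
  simp only [smul_eq_mul, mul_one] at h2
  refine Asymptotics.IsBigO.trans (Asymptotics.IsBigO.of_bound 1 ?_) h2
  filter_upwards [self_mem_nhdsWithin] with x hx
  have hx : 0 < x := hx
  rw [besselI_eq _ hx, cpow_half_add_one _ hx, norm_mul, norm_mul, norm_cpow_half_mul_I κ hx,
    norm_smul]
  have : ‖(x : ℂ) / 2‖ = x / 2 := by
    rw [norm_div]; simp [abs_of_pos hx]
  rw [this, Real.norm_of_nonneg hx.le]
  nlinarith [norm_nonneg (entireI (κ * Complex.I + 1) (x ^ 2 / 4)),
    mul_nonneg hx.le (norm_nonneg (entireI (κ * Complex.I + 1) (x ^ 2 / 4)))]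

lemma const_div_mul_isBigO {c : ℂ} {f : ℝ → ℂ} {n m : ℕ}
    (hf : f =O[𝓝[>] 0] (fun x : ℝ => x ^ (n + m))) :
    (fun x : ℝ => c / (x : ℂ) ^ n * f x) =O[𝓝[>] 0] (fun x : ℝ => x ^ m) := by
  have h1 : (fun x : ℝ => c / (x : ℂ) ^ n) =O[𝓝[>] 0] (fun x : ℝ => (x ^ n)⁻¹) := by
    refine Asymptotics.IsBigO.of_bound ‖c‖ (Eventually.of_forall fun x => ?_)
    simp [div_eq_mul_inv]
  refine (h1.mul hf).congr' EventuallyEq.rfl ?_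
  filter_upwards [self_mem_nhdsWithin] with x hx
  have hx : 0 < x := hx
  rw [pow_add]
  field_simp

lemma imIRemDeriv_isBigO (κ : ℝ) : imIRemDeriv κ =O[𝓝[>] 0] (fun x : ℝ => x) := by
  have h1 := const_div_mul_isBigO (c := κ * Complex.I) (n := 1) (m := 1) (imIRem_isBigO κ)
  simp only [pow_one] at h1
  exact h1.add (besselI_add_one_isBigO κ)

lemma imIRemDeriv2_isBigO (κ : ℝ) : imIRemDeriv2 κ =O[𝓝[>] 0] (fun _ : ℝ => (1 : ℝ)) := by
  have h1 := const_div_mul_isBigO (c := -(κ * Complex.I)) (n := 2) (m := 0) (imIRem_isBigO κ)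
  have h2 := const_div_mul_isBigO (c := κ * Complex.I) (n := 1) (m := 0)
    (by simpa using imIRemDeriv_isBigO κ)
  have h3 := const_div_mul_isBigO (c := κ * Complex.I + 1) (n := 1) (m := 0)
    (by simpa using besselI_add_one_isBigO κ)
  simp only [pow_one, pow_zero] at h1 h2 h3
  exact (h1.add h2).add ((imI_isBigO_one κ).sub h3)

/-! ### The Wronskian -/

/-- The Wronskian of the real and the imaginary part of `I_{iκ}`, times `x`. -/
lemma wronskian_imI (κ : ℝ) {x : ℝ} (hx : 0 < x) :
    x * (conj (imI κ x) * imIDeriv κ x).im = κ / ‖Complex.Gamma (1 + κ * Complex.I)‖ ^ 2 := by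
  let W : ℝ → ℝ := fun x => x * ((imI κ x).re * (imIDeriv κ x).im
    - (imI κ x).im * (imIDeriv κ x).re)
  have hWd : ∀ x ∈ Ioi (0 : ℝ), HasDerivAt W 0 x := by
    intro x hx
    have hx : 0 < x := hx
    have a1 := Complex.reCLM.hasFDerivAt.comp_hasDerivAt x (hasDerivAt_imI κ hx)
    have a2 := Complex.imCLM.hasFDerivAt.comp_hasDerivAt x (hasDerivAt_imI κ hx)
    have b1 := Complex.reCLM.hasFDerivAt.comp_hasDerivAt x (hasDerivAt_imIDeriv κ hx)
    have b2 := Complex.imCLM.hasFDerivAt.comp_hasDerivAt x (hasDerivAt_imIDeriv κ hx)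
    have h := (hasDerivAt_id x).mul ((a1.mul b2).sub (a2.mul b1))
    refine h.congr_deriv ?_
    have e : ((1 - (κ : ℂ) ^ 2 / (x : ℂ) ^ 2) * imI κ x - imIDeriv κ x / x)
        = ((1 - κ ^ 2 / x ^ 2 : ℝ) : ℂ) * imI κ x - ((x⁻¹ : ℝ) : ℂ) * imIDeriv κ x := by
      push_cast
      ring
    rw [e]
    simp only [Function.comp, Complex.reCLM_apply, Complex.imCLM_apply, Pi.sub_apply, Pi.mul_apply,
      Complex.sub_re, Complex.sub_im, Complex.re_ofReal_mul, Complex.im_ofReal_mul, id]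
    field_simp
    ring
  have hconst : ∀ y ∈ Ioi (0 : ℝ), W y = W x := fun y hy =>
    (convex_Ioi (0 : ℝ)).is_const_of_fderivWithin_eq_zero (𝕜 := ℝ)
      (fun z hz => (hWd z hz).differentiableAt.differentiableWithinAt)
      (fun z hz => by
        rw [fderivWithin_of_isOpen isOpen_Ioi hz]
        ext
        simp [(hWd z hz).deriv]) hy hx
  -- The constant is read off at zero: the term `iκ/x` of the derivative contributes `κ |I_{iκ}|²`,
  -- and the rest is `O(x²)`.
  have hlim : Tendsto W (𝓝[>] 0) (𝓝 (κ / ‖Complex.Gamma (1 + κ * Complex.I)‖ ^ 2)) := by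
    have h1 : Tendsto (fun x : ℝ => entireI (κ * Complex.I) (x ^ 2 / 4)) (𝓝[>] 0)
        (𝓝 (entireI (κ * Complex.I) 0)) := by
      have : Continuous (fun x : ℝ => entireI (κ * Complex.I) (x ^ 2 / 4)) :=
        (continuous_entireI (re_mul_I_nonneg κ)).comp (by fun_prop)
      simpa using (this.tendsto 0).mono_left nhdsWithin_le_nhds
    have h2 : Tendsto (fun x : ℝ => κ * ‖entireI (κ * Complex.I) (x ^ 2 / 4)‖ ^ 2) (𝓝[>] 0)
        (𝓝 (κ * ‖entireI (κ * Complex.I) 0‖ ^ 2)) := (h1.norm.pow 2).const_mul κ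
    have hx0 : (fun x : ℝ => x * x) =O[𝓝[>] 0] (fun x : ℝ => x) := by
      refine Asymptotics.IsBigO.of_bound 1 ?_
      filter_upwards [Ioo_mem_nhdsGT zero_lt_one] with x hx
      rw [norm_mul, Real.norm_of_nonneg hx.1.le]
      nlinarith [hx.1, hx.2]
    have h3 : Tendsto (fun x : ℝ => conj (imI κ x) * ((x : ℂ) * besselI (κ * Complex.I + 1) x))
        (𝓝[>] 0) (𝓝 0) := by
      have a : (fun x : ℝ => conj (imI κ x)) =O[𝓝[>] 0] (fun _ : ℝ => (1 : ℝ)) :=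
        (Asymptotics.IsBigO.of_bound 1 (Eventually.of_forall fun x => by simp)).trans
          (imI_isBigO_one κ)
      have b : (fun x : ℝ => (x : ℂ)) =O[𝓝[>] 0] (fun x : ℝ => x) :=
        Asymptotics.IsBigO.of_bound 1 (Eventually.of_forall fun x => by simp)
      have c := a.mul (b.mul (besselI_add_one_isBigO κ))
      refine c.trans_tendsto ?_
      have : Continuous (fun x : ℝ => (1 : ℝ) * (x * x)) := by fun_prop
      simpa using (this.tendsto 0).mono_left nhdsWithin_le_nhds
    have h4 := h2.add ((Complex.continuous_im.tendsto 0).comp h3)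
    have e0 : κ * ‖entireI (κ * Complex.I) 0‖ ^ 2 + Complex.im 0 =
        κ / ‖Complex.Gamma (1 + κ * Complex.I)‖ ^ 2 := by
      rw [entireI_zero, add_comm ((κ : ℂ) * Complex.I) 1, norm_inv]
      simp [div_eq_mul_inv]
    rw [e0] at h4
    refine h4.congr' ?_
    filter_upwards [self_mem_nhdsWithin] with x hx
    have hx : 0 < x := hx
    have hn : ‖entireI (κ * Complex.I) (x ^ 2 / 4)‖ = ‖imI κ x‖ := by
      rw [imI, besselI_eq _ hx, norm_mul, norm_cpow_half_mul_I κ hx, one_mul]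
    have e1 : imIDeriv κ x = ((κ / x : ℝ) : ℂ) * (Complex.I * imI κ x)
        + besselI (κ * Complex.I + 1) x := by
      rw [imIDeriv]
      push_cast
      ring
    simp only [Function.comp, hn, W, e1, ← Complex.normSq_eq_norm_sq, Complex.normSq_apply]
    simp only [Complex.add_re, Complex.add_im, Complex.mul_im, Complex.mul_re, Complex.I_re, Complex.I_im, Complex.conj_re, Complex.conj_im,
      Complex.ofReal_re, Complex.ofReal_im]
    field_simp
    ring
  have hW : W x = κ / ‖Complex.Gamma (1 + κ * Complex.I)‖ ^ 2 := by
    refine tendsto_nhds_unique (tendsto_const_nhds.congr' ?_) hlim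
    filter_upwards [self_mem_nhdsWithin] with y hy
    exact (hconst y hy).symm
  rw [← hW]
  simp only [W, Complex.mul_im, Complex.conj_re, Complex.conj_im]
  ring

/-! ### The series of `I_0` as a family of weights -/

/-- The terms of the series of `I_0(2y)`. -/
noncomputable def weight (y : ℝ) (m : ℕ) : ℝ := (y ^ m / m.factorial) ^ 2

/-- `I_0(x)`. -/
noncomputable def besselZero (x : ℝ) : ℝ := ∑' m : ℕ, weight (x / 2) m

lemma weight_nonneg (y : ℝ) (m : ℕ) : 0 ≤ weight y m := sq_nonneg _

lemma weight_succ (y : ℝ) (m : ℕ) : weight y (m + 1) * ((m : ℝ) + 1) ^ 2 = y ^ 2 * weight y m := by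
  have : (m.factorial : ℝ) ≠ 0 := by exact_mod_cast m.factorial_ne_zero
  have h : (m : ℝ) + 1 ≠ 0 := by positivity
  simp only [weight, Nat.factorial_succ]
  push_cast
  field_simp
  ring

lemma summable_weight (y : ℝ) : Summable (weight y) := by
  refine Summable.of_nonneg_of_le (weight_nonneg y) (fun m => ?_)
    (Real.summable_pow_div_factorial (y ^ 2))
  have : (1 : ℝ) ≤ m.factorial := by exact_mod_cast m.factorial_pos
  rw [weight, div_pow, ← pow_mul, ← pow_mul, mul_comm m 2]
  have h2 : 0 ≤ y ^ (2 * m) := by rw [pow_mul]; positivity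
  gcongr
  nlinarith

/-- By `weight_succ` a factor `m²` can be traded for an index shift. This gives the second moment
exactly and the fourth in terms of the lower ones. -/
lemma hasSum_weight_mul_sq {y : ℝ} {g : ℕ → ℝ} {s : ℝ}
    (h : HasSum (fun m => weight y m * g (m + 1)) s) :
    HasSum (fun m : ℕ => weight y m * ((m : ℝ) ^ 2 * g m)) (y ^ 2 * s) := by
  rw [← hasSum_nat_add_iff' 1]
  simp only [Finset.range_one, Finset.sum_singleton, Nat.cast_zero, ne_eq, OfNat.ofNat_ne_zero,
    not_false_eq_true, zero_pow, zero_mul, mul_zero, sub_zero]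
  refine (h.mul_left (y ^ 2)).congr_fun ?_
  intro m
  rw [← mul_assoc, ← mul_assoc, ← weight_succ]
  push_cast
  ring

lemma hasSum_weight (y : ℝ) : HasSum (weight y) (∑' m, weight y m) := (summable_weight y).hasSum

lemma hasSum_weight_sq (y : ℝ) :
    HasSum (fun m : ℕ => weight y m * (m : ℝ) ^ 2) (y ^ 2 * ∑' m, weight y m) := by
  have := hasSum_weight_mul_sq (y := y) (g := fun _ => 1) (by simpa using hasSum_weight y)
  simpa using this

lemma summable_weight_mul (y : ℝ) : Summable (fun m : ℕ => weight y m * (m : ℝ)) := by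
  refine Summable.of_nonneg_of_le (fun m => mul_nonneg (weight_nonneg y m) m.cast_nonneg)
    (fun m => ?_) (hasSum_weight_sq y).summable
  refine mul_le_mul_of_nonneg_left ?_ (weight_nonneg y m)
  exact_mod_cast Nat.le_self_pow two_ne_zero m

/-- The first moment has no such closed form; `m ≤ m²/(2y) + y/2` bounds it by the second and the
zeroth. -/
lemma tsum_weight_mul_le {y : ℝ} (hy : 0 < y) :
    ∑' m : ℕ, weight y m * (m : ℝ) ≤ y * ∑' m, weight y m := by
  have h := ((hasSum_weight_sq y).mul_left (1 / (2 * y))).add ((hasSum_weight y).mul_left (y / 2))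
  have h2 : 1 / (2 * y) * (y ^ 2 * ∑' m, weight y m) + y / 2 * ∑' m, weight y m
      = y * ∑' m, weight y m := by
    field_simp
    ring
  rw [h2] at h
  refine hasSum_le (fun m => ?_) (summable_weight_mul y).hasSum h
  have : (m : ℝ) ≤ 1 / (2 * y) * m ^ 2 + y / 2 := by
    have : 1 / (2 * y) * (m : ℝ) ^ 2 + y / 2 - m = (m - y) ^ 2 / (2 * y) := by
      field_simp
      ring
    have : 0 ≤ ((m : ℝ) - y) ^ 2 / (2 * y) := by positivity
    linarith
  nlinarith [weight_nonneg y m]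

/-- The weights concentrate at indices `m` close to `y`. -/
lemma hasSum_weight_deviation {y : ℝ} (hy : 0 < y) :
    HasSum (fun m : ℕ => weight y m * ((m : ℝ) ^ 2 / y ^ 2 - 1) ^ 2)
      ((2 * ∑' m : ℕ, weight y m * (m : ℝ) + ∑' m, weight y m) / y ^ 2) := by
  -- The fourth moment: the shift turns `m² · m²` into `y² (m + 1)²`, whose expansion brings in the
  -- first moment.
  have h4 := hasSum_weight_mul_sq (y := y) (g := fun m => (m : ℝ) ^ 2)
    (s := y ^ 2 * ∑' m, weight y m + 2 * ∑' m : ℕ, weight y m * (m : ℝ) + ∑' m, weight y m)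
    (by
      refine (((hasSum_weight_sq y).add ((summable_weight_mul y).hasSum.mul_left 2)).add
        (hasSum_weight y)).congr_fun fun m => ?_
      push_cast
      ring)
  have h := ((h4.mul_left (1 / y ^ 4)).add ((hasSum_weight_sq y).mul_left (-2 / y ^ 2))).add
    (hasSum_weight y)
  have e : (2 * ∑' m : ℕ, weight y m * (m : ℝ) + ∑' m, weight y m) / y ^ 2 =
      1 / y ^ 4 * (y ^ 2 * (y ^ 2 * ∑' m, weight y m + 2 * ∑' m : ℕ, weight y m * (m : ℝ)
        + ∑' m, weight y m)) + -2 / y ^ 2 * (y ^ 2 * ∑' m, weight y m) + ∑' m, weight y m := by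
    field_simp
    ring
  rw [e]
  refine h.congr_fun fun m => ?_
  field_simp
  ring

lemma tsum_weight_deviation_le {y : ℝ} (hy : 1 ≤ y) :
    ∑' m : ℕ, weight y m * ((m : ℝ) ^ 2 / y ^ 2 - 1) ^ 2 ≤ 3 / y * ∑' m, weight y m := by
  have hy0 : 0 < y := by linarith
  have hS : 0 ≤ ∑' m, weight y m := tsum_nonneg (weight_nonneg y)
  rw [(hasSum_weight_deviation hy0).tsum_eq, div_le_iff₀ (by positivity)]
  have h := tsum_weight_mul_le hy0
  have e : 3 / y * (∑' m, weight y m) * y ^ 2 = 3 * y * ∑' m, weight y m := by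
    field_simp
  rw [e]
  nlinarith

lemma tsum_weight_pos (y : ℝ) : 0 < ∑' m, weight y m := by
  refine (summable_weight y).tsum_pos (weight_nonneg y) 0 ?_
  simp [weight]

/-- Averages over the weights of functions that are close to `1` at `m = y` tend to `1`. -/
lemma tendsto_weighted_average {φ : ℝ → ℕ → ℂ}
    (h : ∀ ε > 0, ∃ C ≥ 0, ∀ᶠ y in atTop, ∀ m : ℕ,
      ‖φ y m - 1‖ ≤ ε + C * ((m : ℝ) ^ 2 / y ^ 2 - 1) ^ 2) :
    Tendsto (fun y => (∑' m, (weight y m : ℂ) * φ y m) / ((∑' m, weight y m : ℝ) : ℂ))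
      atTop (𝓝 1) := by
  rw [Metric.tendsto_nhds]
  intro ε hε
  obtain ⟨C, hC, hy⟩ := h (ε / 2) (by positivity)
  have hlim : Tendsto (fun y : ℝ => C * (3 / y)) atTop (𝓝 (C * 0)) :=
    (tendsto_const_nhds.div_atTop tendsto_id).const_mul C
  rw [mul_zero] at hlim
  filter_upwards [hy, eventually_ge_atTop 1, hlim.eventually_lt_const (half_pos hε)]
    with y hφ hy1 hsmall
  have hy0 : 0 < y := by linarith
  have hS := tsum_weight_pos y
  have hS' : ((∑' m, weight y m : ℝ) : ℂ) ≠ 0 := by exact_mod_cast hS.ne'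
  have hdev := (hasSum_weight_deviation hy0).summable
  have hb : Summable (fun m : ℕ => ε / 2 * weight y m
      + C * (weight y m * ((m : ℝ) ^ 2 / y ^ 2 - 1) ^ 2)) :=
    ((summable_weight y).mul_left _).add (hdev.mul_left _)
  have hle : ∀ m : ℕ, ‖(weight y m : ℂ) * (φ y m - 1)‖ ≤ ε / 2 * weight y m
      + C * (weight y m * ((m : ℝ) ^ 2 / y ^ 2 - 1) ^ 2) := by
    intro m
    rw [norm_mul, Complex.norm_real, Real.norm_of_nonneg (weight_nonneg y m)]
    nlinarith [mul_le_mul_of_nonneg_left (hφ m) (weight_nonneg y m)]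
  have hs1 : Summable (fun m => (weight y m : ℂ) * (φ y m - 1)) := Summable.of_norm_bounded hb hle
  have hs2 : Summable (fun m => (weight y m : ℂ)) := Complex.summable_ofReal.2 (summable_weight y)
  have e : (∑' m, (weight y m : ℂ) * φ y m) =
      (∑' m, (weight y m : ℂ) * (φ y m - 1)) + ((∑' m, weight y m : ℝ) : ℂ) := by
    rw [Complex.ofReal_tsum, ← hs1.tsum_add hs2]
    refine tsum_congr fun m => ?_
    ring
  -- A Chebyshev estimate: the squared deviation averages to at most `3/y`, so its part is
  -- negligible for large `y` whatever `C` is.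
  have hn : ‖∑' m, (weight y m : ℂ) * (φ y m - 1)‖ ≤
      (ε / 2 + C * (3 / y)) * ∑' m, weight y m := by
    refine (tsum_of_norm_bounded hb.hasSum hle).trans ?_
    rw [((summable_weight y).mul_left _).tsum_add (hdev.mul_left _), tsum_mul_left, tsum_mul_left]
    nlinarith [mul_le_mul_of_nonneg_left (tsum_weight_deviation_le hy1) hC]
  rw [dist_eq_norm, e, add_div, div_self hS', add_sub_cancel_right, norm_div, Complex.norm_real,
    Real.norm_of_nonneg hS.le, div_lt_iff₀ hS]
  refine hn.trans_lt ?_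
  have : ε / 2 + C * (3 / y) < ε := by linarith
  nlinarith

/-! ### The quotients of Gamma values -/

/-- The quotient `m! / Γ(m + 1 + iκ)`. -/
noncomputable def gammaQuot (κ : ℝ) (m : ℕ) : ℂ :=
  (m.factorial : ℂ) / Complex.Gamma ((m : ℂ) + κ * Complex.I + 1)

/-- Identifies the denominator in Euler's product sequence for `Γ` as a quotient of Gamma values. -/
lemma prod_add_eq_Gamma {s : ℂ} (hs : ∀ m : ℕ, s ≠ -m) (n : ℕ) :
    (∏ j ∈ Finset.range (n + 1), (s + j)) * Complex.Gamma s = Complex.Gamma (n + s + 1) := by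
  induction n with
  | zero =>
    have h0 : s ≠ 0 := by simpa using hs 0
    simp [Complex.Gamma_add_one s h0]
  | succ n ih =>
    have h1 : (n : ℂ) + s + 1 ≠ 0 := by
      intro h
      apply hs (n + 1)
      push_cast
      linear_combination h
    rw [Finset.prod_range_succ]
    push_cast
    rw [show (n : ℂ) + 1 + s + 1 = (n + s + 1) + 1 by ring, Complex.Gamma_add_one _ h1, ← ih]
    ring

/-- Euler's limit formula at `s = iκ`, divided by `Γ(s)`; positivity of `κ` keeps `s` away from the
poles. -/
lemma tendsto_gammaQuot {κ : ℝ} (hκ : 0 < κ) :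
    Tendsto (fun m : ℕ => (m : ℂ) ^ ((κ : ℂ) * Complex.I) * gammaQuot κ m) atTop (𝓝 1) := by
  have hs : ∀ m : ℕ, (κ : ℂ) * Complex.I ≠ -m := by
    intro m h
    have := congrArg Complex.im h
    simp at this
    exact hκ.ne' this
  have hG : Complex.Gamma ((κ : ℂ) * Complex.I) ≠ 0 := Complex.Gamma_ne_zero hs
  have h := (Complex.GammaSeq_tendsto_Gamma ((κ : ℂ) * Complex.I)).div_const
    (Complex.Gamma ((κ : ℂ) * Complex.I))
  rw [div_self hG] at h
  refine h.congr fun m => ?_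
  rw [Complex.GammaSeq, gammaQuot, ← prod_add_eq_Gamma hs, div_div, mul_div_assoc]

lemma norm_natCast_cpow_mul_I (κ : ℝ) {m : ℕ} (hm : m ≠ 0) :
    ‖(m : ℂ) ^ ((κ : ℂ) * Complex.I)‖ = 1 := by
  rw [Complex.norm_natCast_cpow_of_pos (Nat.pos_of_ne_zero hm)]
  simp

lemma exists_norm_gammaQuot_le {κ : ℝ} (hκ : 0 < κ) : ∃ M : ℝ, ∀ m, ‖gammaQuot κ m‖ ≤ M := by
  obtain ⟨M, hM⟩ := (tendsto_gammaQuot hκ).norm.bddAbove_range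
  refine ⟨max M ‖gammaQuot κ 0‖, fun m => ?_⟩
  rcases eq_or_ne m 0 with rfl | hm
  · exact le_max_right _ _
  · refine le_trans ?_ (le_max_left _ _)
    have := hM (mem_range_self m)
    simpa only [norm_mul, norm_natCast_cpow_mul_I κ hm, one_mul] using this

/-- If `m²/y²` is close to one, then `m` is large and `(y/m)^{iκ}` is close to one, so Euler's limit
applies. Otherwise the deviation is bounded below, and boundedness of the quotients is enough once
`C` is large. -/
lemma exists_average_bound {κ : ℝ} (hκ : 0 < κ) {ε : ℝ} (hε : 0 < ε) :
    ∃ C ≥ 0, ∀ᶠ y : ℝ in atTop, ∀ m : ℕ,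
      ‖gammaQuot κ m * (y : ℂ) ^ ((κ : ℂ) * Complex.I) - 1‖ ≤
        ε + C * ((m : ℝ) ^ 2 / y ^ 2 - 1) ^ 2 := by
  obtain ⟨M, hM⟩ := exists_norm_gammaQuot_le hκ
  have hM0 : 0 ≤ M := (norm_nonneg _).trans (hM 0)
  obtain ⟨N, hN⟩ := eventually_atTop.1
    ((Metric.tendsto_nhds.1 (tendsto_gammaQuot hκ)) (ε / 2) (by positivity))
  -- At `u = m²/y²` this is `(y/m)^{iκ}`; the variable is the one in which the deviation is
  -- measured.
  let F : ℝ → ℂ := fun u => Complex.exp ((-(κ / 2) * Real.log u : ℝ) * Complex.I)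
  have hF1 : F 1 = 1 := by simp [F]
  have hFc : ContinuousAt F 1 := by
    have : ContinuousAt (fun u => -(κ / 2) * Real.log u) 1 :=
      continuousAt_const.mul (Real.continuousAt_log one_ne_zero)
    exact ((Complex.continuous_ofReal.continuousAt.comp this).mul continuousAt_const).cexp
  obtain ⟨η', hη', hη⟩ := Metric.continuousAt_iff.1 hFc (ε / 2) (by positivity)
  -- The cap `1/2` forces `m² > y²/2`, so `y ≥ 2N + 1` puts `m` beyond `N`.
  set η : ℝ := min η' (1 / 2) with hηdef
  have hη0 : 0 < η := by positivity
  refine ⟨(M + 1) / η ^ 2, by positivity, ?_⟩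
  filter_upwards [eventually_ge_atTop (2 * (N : ℝ) + 1)] with y hy m
  have hy0 : 0 < y := by
    have : (0 : ℝ) ≤ N := N.cast_nonneg
    linarith
  set X : ℝ := (m : ℝ) ^ 2 / y ^ 2 - 1 with hX
  have hny : ‖(y : ℂ) ^ ((κ : ℂ) * Complex.I)‖ = 1 := by
    rw [Complex.norm_cpow_eq_rpow_re_of_pos hy0]
    simp
  by_cases hc : |X| < η
  · have hX1 : |X| < 1 / 2 := hc.trans_le (min_le_right _ _)
    have hm2 : y ^ 2 / 2 < (m : ℝ) ^ 2 := by
      have h1 := (abs_lt.1 hX1).1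
      have h2 : 1 / 2 < (m : ℝ) ^ 2 / y ^ 2 := by linarith
      rw [lt_div_iff₀ (by positivity)] at h2
      linarith
    have hNm : N ≤ m := by
      by_contra hlt
      have h1 : (m : ℝ) ≤ N := by exact_mod_cast (not_le.1 hlt).le
      have h2 : (m : ℝ) ^ 2 ≤ (N : ℝ) ^ 2 := by gcongr
      nlinarith [(N.cast_nonneg : (0 : ℝ) ≤ N)]
    have hm0 : m ≠ 0 := by
      rintro rfl
      have : 0 < y ^ 2 / 2 := by positivity
      simp at hm2
      linarith
    have hm0' : (0 : ℝ) < m := by exact_mod_cast Nat.pos_of_ne_zero hm0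
    have hfac : (y : ℂ) ^ ((κ : ℂ) * Complex.I) =
        (m : ℂ) ^ ((κ : ℂ) * Complex.I) * F ((m : ℝ) ^ 2 / y ^ 2) := by
      rw [Complex.cpow_def_of_ne_zero (by exact_mod_cast hy0.ne'),
        Complex.cpow_def_of_ne_zero (by exact_mod_cast hm0), ← Complex.exp_add,
        ← Complex.ofReal_log hy0.le, ← Complex.natCast_log,
        Real.log_div (by positivity) (by positivity), Real.log_pow, Real.log_pow]
      congr 1
      push_cast
      ring
    have hFn : ‖F ((m : ℝ) ^ 2 / y ^ 2)‖ = 1 := Complex.norm_exp_ofReal_mul_I _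
    have h1 := hN m hNm
    have h2 := @hη ((m : ℝ) ^ 2 / y ^ 2) (by
      rw [Real.dist_eq]
      exact hc.trans_le (min_le_left _ _))
    rw [hF1, dist_eq_norm] at h2
    rw [dist_eq_norm] at h1
    have e : gammaQuot κ m * (y : ℂ) ^ ((κ : ℂ) * Complex.I) - 1 =
        ((m : ℂ) ^ ((κ : ℂ) * Complex.I) * gammaQuot κ m - 1) * F ((m : ℝ) ^ 2 / y ^ 2) +
          (F ((m : ℝ) ^ 2 / y ^ 2) - 1) := by
      rw [hfac]
      ring
    rw [e]
    refine (norm_add_le _ _).trans ?_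
    rw [norm_mul, hFn, mul_one]
    have : 0 ≤ (M + 1) / η ^ 2 * X ^ 2 := by positivity
    linarith
  · have h1 : ‖gammaQuot κ m * (y : ℂ) ^ ((κ : ℂ) * Complex.I) - 1‖ ≤ M + 1 := by
      refine (norm_sub_le _ _).trans ?_
      rw [norm_mul, hny, mul_one, norm_one]
      linarith [hM m]
    have h2 : η ^ 2 ≤ X ^ 2 := by
      rw [← sq_abs X]
      have := not_lt.1 hc
      gcongr
    have h3 : M + 1 ≤ (M + 1) / η ^ 2 * X ^ 2 := by
      rw [div_mul_eq_mul_div, le_div_iff₀ (by positivity)]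
      gcongr
    linarith

lemma exists_average_bound_mul {κ : ℝ} (hκ : 0 < κ) {ε : ℝ} (hε : 0 < ε) :
    ∃ C ≥ 0, ∀ᶠ y : ℝ in atTop, ∀ m : ℕ,
      ‖((m : ℝ) / y : ℝ) * (gammaQuot κ m * (y : ℂ) ^ ((κ : ℂ) * Complex.I)) - 1‖ ≤
        ε + C * ((m : ℝ) ^ 2 / y ^ 2 - 1) ^ 2 := by
  obtain ⟨M, hM⟩ := exists_norm_gammaQuot_le hκ
  have hM0 : 0 ≤ M := (norm_nonneg _).trans (hM 0)
  obtain ⟨C, hC, hy⟩ := exists_average_bound hκ (half_pos hε)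
  -- The extra factor `m/y` deviates from one by at most `|X| ≤ d + X²/(4d)`; this `d` makes `d M ≤
  -- ε/2`.
  set d : ℝ := ε / (2 * (M + 1)) with hd
  have hd0 : 0 < d := by positivity
  refine ⟨C + M / (4 * d), by positivity, ?_⟩
  filter_upwards [hy, eventually_gt_atTop 0] with y hφ hy0 m
  have hny : ‖(y : ℂ) ^ ((κ : ℂ) * Complex.I)‖ = 1 := by
    rw [Complex.norm_cpow_eq_rpow_re_of_pos hy0]
    simp
  specialize hφ m
  set X : ℝ := (m : ℝ) ^ 2 / y ^ 2 - 1 with hX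
  set φ := gammaQuot κ m * (y : ℂ) ^ ((κ : ℂ) * Complex.I) with hφd
  have hφM : ‖φ‖ ≤ M := by
    rw [hφd, norm_mul, hny, mul_one]
    exact hM m
  have ht0 : 0 ≤ (m : ℝ) / y := by positivity
  have h1 : |(m : ℝ) / y - 1| ≤ |X| := by
    have : X = ((m : ℝ) / y - 1) * ((m : ℝ) / y + 1) := by
      rw [hX]
      field_simp
      ring
    rw [this, abs_mul, abs_of_pos (by linarith : (0 : ℝ) < m / y + 1)]
    nlinarith [abs_nonneg ((m : ℝ) / y - 1)]
  have h2 : |X| ≤ d + X ^ 2 / (4 * d) := by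
    have : d + X ^ 2 / (4 * d) - |X| = (|X| - 2 * d) ^ 2 / (4 * d) := by
      rw [← sq_abs X]
      field_simp
      ring
    have : 0 ≤ (|X| - 2 * d) ^ 2 / (4 * d) := by positivity
    linarith
  have e : (((m : ℝ) / y : ℝ) : ℂ) * φ - 1 = (φ - 1) + (((m : ℝ) / y - 1 : ℝ) : ℂ) * φ := by
    push_cast
    ring
  rw [e]
  refine (norm_add_le _ _).trans ?_
  rw [norm_mul, Complex.norm_real, Real.norm_eq_abs]
  have h3 : |(m : ℝ) / y - 1| * ‖φ‖ ≤ (d + X ^ 2 / (4 * d)) * M := by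
    have := h1.trans h2
    gcongr
  have h4 : d * M ≤ ε / 2 := by
    rw [hd, div_mul_eq_mul_div, div_le_div_iff₀ (by positivity) (by positivity)]
    nlinarith
  have h5 : (C + M / (4 * d)) * X ^ 2 = C * X ^ 2 + X ^ 2 / (4 * d) * M := by ring
  rw [h5]
  linarith

/-! ### Behaviour at infinity -/

lemma weight_mul_gammaQuot (κ y : ℝ) (m : ℕ) :
    (weight y m : ℂ) * gammaQuot κ m =
      ((y ^ 2 : ℝ) : ℂ) ^ m * entireCoeff (κ * Complex.I) m := by
  have : (m.factorial : ℂ) ≠ 0 := by exact_mod_cast m.factorial_ne_zero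
  rw [weight, gammaQuot, entireCoeff]
  push_cast
  rw [mul_inv, ← pow_mul]
  field_simp
  ring

lemma imI_eq_tsum_weight (κ : ℝ) {y : ℝ} (hy : 0 < y) :
    imI κ (2 * y) =
      ∑' m, (weight y m : ℂ) * (gammaQuot κ m * (y : ℂ) ^ ((κ : ℂ) * Complex.I)) := by
  rw [imI, besselI_eq _ (by positivity), entireI, ← tsum_mul_left]
  refine tsum_congr fun m => ?_
  conv_rhs => rw [← mul_assoc, weight_mul_gammaQuot]
  rw [show (2 * y) ^ 2 / 4 = y ^ 2 by ring, show 2 * y / 2 = y by ring]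
  ring

/-- Shifting the index by one turns the series of order `iκ + 1` into the previous average with an
extra factor `m/y`, which also makes the new term `m = 0` vanish. -/
lemma besselI_add_one_eq_tsum_weight (κ : ℝ) {y : ℝ} (hy : 0 < y) :
    besselI (κ * Complex.I + 1) (2 * y) = ∑' m : ℕ, (weight y m : ℂ) *
      (((m : ℝ) / y : ℝ) * (gammaQuot κ m * (y : ℂ) ^ ((κ : ℂ) * Complex.I))) := by
  have hy' : (y : ℂ) ≠ 0 := by exact_mod_cast hy.ne'
  have hterm : ∀ m : ℕ, (weight y (m + 1) : ℂ) * ((((m + 1 : ℕ) : ℝ) / y : ℝ) *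
      (gammaQuot κ (m + 1) * (y : ℂ) ^ ((κ : ℂ) * Complex.I))) =
      (y : ℂ) ^ ((κ : ℂ) * Complex.I) * y *
        (((y ^ 2 : ℝ) : ℂ) ^ m * entireCoeff (κ * Complex.I + 1) m) := by
    intro m
    have h := weight_mul_gammaQuot κ y (m + 1)
    rw [entireCoeff_add_one]
    calc _ = ((weight y (m + 1) : ℂ) * gammaQuot κ (m + 1)) * ((((m + 1 : ℕ) : ℝ) / y : ℝ) *
          (y : ℂ) ^ ((κ : ℂ) * Complex.I)) := by ring
      _ = _ := by
        rw [h]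
        push_cast
        field_simp
        ring
  have hs : Summable (fun m : ℕ => (weight y m : ℂ) *
      (((m : ℝ) / y : ℝ) * (gammaQuot κ m * (y : ℂ) ^ ((κ : ℂ) * Complex.I)))) := by
    rw [← summable_nat_add_iff 1]
    simp only [hterm]
    exact (summable_entireI (by simp) _).mul_left _
  rw [hs.tsum_eq_zero_add]
  simp only [hterm]
  rw [besselI_eq _ (by positivity), cpow_half_add_one _ (by positivity), entireI,
    tsum_mul_left, show (2 * y) ^ 2 / 4 = y ^ 2 by ring, show 2 * y / 2 = y by ring]
  push_cast
  simp

lemma tendsto_half_atTop : Tendsto (fun x : ℝ => x / 2) atTop atTop :=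
  tendsto_id.atTop_div_const two_pos

lemma besselZero_pos (x : ℝ) : 0 < besselZero x := tsum_weight_pos _

lemma tendsto_imI_div_besselZero {κ : ℝ} (hκ : 0 < κ) :
    Tendsto (fun x => imI κ x / (besselZero x : ℂ)) atTop (𝓝 1) := by
  refine ((tendsto_weighted_average fun ε hε => exists_average_bound hκ hε).comp
    tendsto_half_atTop).congr' ?_
  filter_upwards [eventually_gt_atTop 0] with x hx
  rw [Function.comp, ← imI_eq_tsum_weight κ (half_pos hx), besselZero,
    show 2 * (x / 2) = x by ring]

lemma tendsto_imIDeriv_div_besselZero {κ : ℝ} (hκ : 0 < κ) :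
    Tendsto (fun x => imIDeriv κ x / (besselZero x : ℂ)) atTop (𝓝 1) := by
  have h1 : Tendsto (fun x => besselI (κ * Complex.I + 1) x / (besselZero x : ℂ)) atTop (𝓝 1) := by
    refine ((tendsto_weighted_average fun ε hε => exists_average_bound_mul hκ hε).comp
      tendsto_half_atTop).congr' ?_
    filter_upwards [eventually_gt_atTop 0] with x hx
    rw [Function.comp, ← besselI_add_one_eq_tsum_weight κ (half_pos hx), besselZero,
      show 2 * (x / 2) = x by ring]
  have h2 : Tendsto (fun x : ℝ => (κ * Complex.I / x : ℂ)) atTop (𝓝 0) := by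
    have : Tendsto (fun x : ℝ => ((x⁻¹ : ℝ) : ℂ)) atTop (𝓝 ((0 : ℝ) : ℂ)) :=
      (Complex.continuous_ofReal.tendsto 0).comp tendsto_inv_atTop_zero
    simpa [div_eq_mul_inv] using this.const_mul (κ * Complex.I)
  have h3 := (h2.mul (tendsto_imI_div_besselZero hκ)).add h1
  simp only [zero_mul, zero_add] at h3
  refine h3.congr fun x => ?_
  rw [imIDeriv]
  ring

/-- Used to compare `cosh` with `I_0`: the ratio of their coefficients is `4^m` over the central
binomial coefficient. -/
lemma four_pow_le_centralBinom_mul_sqrt (m : ℕ) :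
    (4 : ℝ) ^ m ≤ m.centralBinom * Real.sqrt (4 * m + 1) := by
  have key : ((4 : ℝ) ^ m) ^ 2 ≤ (m.centralBinom : ℝ) ^ 2 * (4 * m + 1) := by
    induction m with
    | zero => simp
    | succ n ih =>
      have h : ((n : ℝ) + 1) * (n + 1).centralBinom = 2 * (2 * n + 1) * n.centralBinom := by
        exact_mod_cast Nat.succ_mul_centralBinom_succ n
      have h2 : (((n + 1).centralBinom : ℝ)) = 2 * (2 * n + 1) * n.centralBinom / (n + 1) := by
        rw [eq_div_iff (by positivity)]
        linarith
      rw [h2]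
      push_cast
      rw [div_pow, div_mul_eq_mul_div, le_div_iff₀ (by positivity)]
      have hn : (0 : ℝ) ≤ n := n.cast_nonneg
      have h3 : (16 * ((n : ℝ) + 1) ^ 2) * (4 * n + 1) ≤ 4 * (2 * n + 1) ^ 2 * (4 * n + 5) := by
        nlinarith
      have h4 : 0 ≤ (n.centralBinom : ℝ) ^ 2 := by positivity
      have h5 : ((4 : ℝ) ^ (n + 1)) ^ 2 = 16 * ((4 : ℝ) ^ n) ^ 2 := by ring
      rw [h5]
      nlinarith [mul_le_mul_of_nonneg_left ih (by positivity : 0 ≤ 16 * ((n : ℝ) + 1) ^ 2),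
        mul_le_mul_of_nonneg_right h3 h4]
  rw [← Real.sqrt_sq (by positivity : (0 : ℝ) ≤ m.centralBinom), ← Real.sqrt_mul (by positivity)]
  exact Real.le_sqrt_of_sq_le key

/-- A lower bound for `I_0`. -/
lemma cosh_le_sqrt_mul_besselZero {x : ℝ} (hx : 0 < x) :
    Real.cosh x ≤ Real.sqrt (2 * x + 1) * besselZero x := by
  set s := Real.sqrt (2 * x + 1) with hs
  have hs0 : 0 < s := Real.sqrt_pos.2 (by positivity)
  have hs2 : s ^ 2 = 2 * x + 1 := Real.sq_sqrt (by positivity)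
  have hy : 0 < x / 2 := half_pos hx
  have hterm : ∀ m : ℕ, x ^ (2 * m) / ((2 * m).factorial : ℝ) ≤
      s / 2 * weight (x / 2) m + 1 / (2 * s) * (4 * (weight (x / 2) m * m) + weight (x / 2) m) := by
    intro m
    have hb : 0 < (m.centralBinom : ℝ) := by exact_mod_cast m.centralBinom_pos
    have hfac : ((2 * m).factorial : ℝ) = m.centralBinom * (m.factorial : ℝ) ^ 2 := by
      rw [Nat.centralBinom_eq_two_mul_choose, sq, ← mul_assoc]
      have := Nat.choose_mul_factorial_mul_factorial (Nat.le_mul_of_pos_left m two_pos)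
      rw [show 2 * m - m = m by omega] at this
      exact_mod_cast this.symm
    have hw : x ^ (2 * m) / ((2 * m).factorial : ℝ) =
        weight (x / 2) m * ((4 : ℝ) ^ m / m.centralBinom) := by
      have : (m.factorial : ℝ) ≠ 0 := by exact_mod_cast m.factorial_ne_zero
      have h4 : (4 : ℝ) ^ m = (2 ^ m) ^ 2 := by
        rw [← pow_mul, mul_comm, pow_mul]
        norm_num
      rw [hfac, weight, h4, div_pow x 2 m, pow_mul']
      field_simp
    have h1 : (4 : ℝ) ^ m / m.centralBinom ≤ Real.sqrt (4 * m + 1) := by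
      rw [div_le_iff₀ hb, mul_comm]
      exact four_pow_le_centralBinom_mul_sqrt m
    -- The root is replaced by its tangent at `s² = 2x + 1`, the value of `4m + 1` at the
    -- concentration index `m = x/2`; only the zeroth and first moments are then needed.
    have h2 : Real.sqrt (4 * m + 1) ≤ s / 2 + 1 / (2 * s) * (4 * m + 1) := by
      set t := Real.sqrt (4 * (m : ℝ) + 1) with ht
      have ht2 : t ^ 2 = 4 * m + 1 := Real.sq_sqrt (by positivity)
      rw [← ht2]
      have : s / 2 + 1 / (2 * s) * t ^ 2 - t = (t - s) ^ 2 / (2 * s) := by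
        field_simp
        ring
      have : 0 ≤ (t - s) ^ 2 / (2 * s) := by positivity
      linarith
    rw [hw]
    refine (mul_le_mul_of_nonneg_left (h1.trans h2) (weight_nonneg _ m)).trans_eq ?_
    ring
  have hsum := ((hasSum_weight (x / 2)).mul_left (s / 2)).add
    ((((summable_weight_mul (x / 2)).hasSum.mul_left 4).add
      (hasSum_weight (x / 2))).mul_left (1 / (2 * s)))
  refine (hasSum_le hterm (Real.hasSum_cosh x) hsum).trans ?_
  have hM := tsum_weight_mul_le hy
  have hS := tsum_weight_pos (x / 2)
  rw [besselZero]
  set S := ∑' m, weight (x / 2) m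
  set M := ∑' m : ℕ, weight (x / 2) m * (m : ℝ)
  have h1 : 4 * M + S ≤ s ^ 2 * S := by
    rw [hs2]
    linarith
  have h2 : 1 / (2 * s) * (4 * M + S) ≤ 1 / (2 * s) * (s ^ 2 * S) := by gcongr
  have h3 : 1 / (2 * s) * (s ^ 2 * S) = s / 2 * S := by field_simp
  linarith

/-! ### Weak derivatives -/

lemma HasWeakDerivOn.eq_add_integral {δ : ℝ} {f g : ℝ → ℂ} (h : HasWeakDerivOn δ f g) {r : ℝ}
    (hr : r ∈ Ioc 0 δ) : f r = f δ + ∫ t in δ..r, g t := by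
  rw [(h r hr).2, intervalIntegral.integral_symm r δ, sub_eq_add_neg]

lemma HasWeakDerivOn.continuousOn {δ : ℝ} {f g : ℝ → ℂ} (h : HasWeakDerivOn δ f g) :
    ContinuousOn f (Ioc 0 δ) := by
  intro x hx
  have ha : x / 2 ∈ Ioc 0 δ := ⟨half_pos hx.1, by linarith [hx.1, hx.2]⟩
  have hle : x / 2 ≤ δ := ha.2
  have h1 : ContinuousOn (fun r => f δ - ∫ t in r..δ, g t) (uIcc (x / 2) δ) := by
    refine continuousOn_const.sub (intervalIntegral.continuousOn_primitive_interval_left ?_)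
    rw [uIcc_of_le hle]
    exact (intervalIntegrable_iff_integrableOn_Icc_of_le hle).1 (h _ ha).1
  rw [uIcc_of_le hle] at h1
  have h2 : ContinuousOn f (Icc (x / 2) δ) :=
    h1.congr fun r hr => (h r ⟨ha.1.trans_le hr.1, hr.2⟩).2
  have h3 : Icc (x / 2) δ ∈ 𝓝[Ioc 0 δ] x := by
    have : Ioi (x / 2) ∩ Ioc 0 δ ⊆ Icc (x / 2) δ := fun r hr => ⟨(mem_Ioi.1 hr.1).le, hr.2.2⟩
    exact mem_of_superset (inter_mem (mem_nhdsWithin_of_mem_nhds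
      (Ioi_mem_nhds (by linarith [hx.1]))) self_mem_nhdsWithin) this
  exact (h2 x ⟨by linarith [hx.1], hx.2⟩).mono_of_mem_nhdsWithin h3

lemma HasWeakDerivOn.hasDerivAt_of_integral {δ : ℝ} {f g : ℝ → ℂ} (h : HasWeakDerivOn δ f g)
    {r : ℝ} (hr : r ∈ Ioo 0 δ) {c : ℂ} (hc : HasDerivAt (fun x => ∫ t in δ..x, g t) c r) :
    HasDerivAt f c r := by
  refine (hc.const_add (f δ)).congr_of_eventuallyEq ?_
  filter_upwards [Ioo_mem_nhds hr.1 hr.2] with x hx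
  exact h.eq_add_integral ⟨hx.1, hx.2.le⟩

/-- Integrability holds only away from zero, so Lebesgue differentiation is applied on the countably
many intervals `[δ/(n+1), δ]`. -/
lemma HasWeakDerivOn.ae_hasDerivAt {δ : ℝ} {f g : ℝ → ℂ} (h : HasWeakDerivOn δ f g) :
    ∀ᵐ r ∂(volume.restrict (Ioo 0 δ)), HasDerivAt f (g r) r := by
  rcases le_or_gt δ 0 with hδ | hδ
  · simp [Ioo_eq_empty_of_le hδ]
  have key : ∀ n : ℕ, ∀ᵐ r : ℝ, r ∈ uIcc (δ / (n + 1)) δ → ∀ c ∈ uIcc (δ / (n + 1)) δ,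
      HasDerivAt (fun x => ∫ t in c..x, g t) (g r) r := fun n =>
    (h _ ⟨by positivity, div_le_self hδ.le (by
      have : (0 : ℝ) ≤ n := n.cast_nonneg
      linarith)⟩).1.ae_hasDerivAt_integral
  rw [ae_restrict_iff' measurableSet_Ioo]
  filter_upwards [ae_all_iff.2 key] with r hr hmem
  obtain ⟨n, hn⟩ := exists_nat_gt (δ / r)
  have hn1 : δ / (n + 1) ≤ r := by
    rw [div_le_iff₀ (by positivity)]
    rw [div_lt_iff₀ hmem.1] at hn
    nlinarith [hmem.1]
  have hn2 : δ / ((n : ℝ) + 1) ≤ δ := hn1.trans hmem.2.le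
  refine h.hasDerivAt_of_integral hmem (hr n ?_ δ right_mem_uIcc)
  rw [uIcc_of_le hn2]
  exact ⟨hn1, hmem.2.le⟩

lemma HasWeakDerivOn.hasDerivAt {δ : ℝ} {f g : ℝ → ℂ} (h : HasWeakDerivOn δ f g)
    (hg : ContinuousOn g (Ioo 0 δ)) {r : ℝ} (hr : r ∈ Ioo 0 δ) : HasDerivAt f (g r) r := by
  have hnhds : Ioo 0 δ ∈ 𝓝 r := Ioo_mem_nhds hr.1 hr.2
  refine h.hasDerivAt_of_integral hr (intervalIntegral.integral_hasDerivAt_right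
    (h r ⟨hr.1, hr.2.le⟩).1.symm ?_ (hg.continuousAt hnhds))
  exact hg.stronglyMeasurableAtFilter isOpen_Ioo r hr

lemma HasWeakDerivOn.congr {δ : ℝ} {f g f' g' : ℝ → ℂ} (h : HasWeakDerivOn δ f g)
    (hf : ∀ r ∈ Ioc 0 δ, f' r = f r) (hg : ∀ᵐ r ∂(volume.restrict (Ioo 0 δ)), g' r = g r) :
    HasWeakDerivOn δ f' g' := by
  intro a ha
  have hδ : 0 < δ := ha.1.trans_le ha.2
  have hae : g =ᵐ[volume.restrict (uIoc a δ)] g' := by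
    rw [uIoc_of_le ha.2, ← restrict_Ioo_eq_restrict_Ioc]
    have := ae_restrict_of_ae_restrict_of_subset (Ioo_subset_Ioo_left ha.1.le) hg
    filter_upwards [this] with r hr
    exact hr.symm
  refine ⟨(h a ha).1.congr_ae hae, ?_⟩
  rw [hf a ha, hf δ ⟨hδ, le_rfl⟩, (h a ha).2]
  congr 1
  exact intervalIntegral.integral_congr_ae_restrict hae

lemma HasWeakDerivOn.add {δ : ℝ} {f g f' g' : ℝ → ℂ} (h : HasWeakDerivOn δ f g)
    (h' : HasWeakDerivOn δ f' g') :
    HasWeakDerivOn δ (fun r => f r + f' r) (fun r => g r + g' r) := by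
  intro a ha
  refine ⟨(h a ha).1.add (h' a ha).1, ?_⟩
  simp only [intervalIntegral.integral_add (h a ha).1 (h' a ha).1]
  rw [(h a ha).2, (h' a ha).2]
  ring

lemma hasWeakDerivOn_of_hasDerivAt {δ : ℝ} {f g : ℝ → ℂ}
    (h : ∀ r > 0, HasDerivAt f (g r) r) (hg : ContinuousOn g (Ioi 0)) :
    HasWeakDerivOn δ f g := by
  intro a ha
  have hsub : uIcc a δ ⊆ Ioi 0 := by
    rw [uIcc_of_le ha.2]
    exact fun r hr => ha.1.trans_le hr.1
  have hi : IntervalIntegrable g volume a δ := (hg.mono hsub).intervalIntegrable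
  refine ⟨hi, ?_⟩
  rw [intervalIntegral.integral_eq_sub_of_hasDerivAt (fun r hr => h r (hsub hr)) hi]
  ring

/-! ### The weighted Sobolev space -/

lemma not_integrableOn_inv_Ioo {d : ℝ} (hd : 0 < d) :
    ¬ IntegrableOn (fun r : ℝ => r⁻¹) (Ioo 0 d) := by
  intro h
  have h2 : IntervalIntegrable (fun r : ℝ => r⁻¹) volume 0 d :=
    (intervalIntegrable_iff_integrableOn_Ioo_of_le hd.le).2 h
  rw [intervalIntegrable_inv_iff] at h2
  rcases h2 with h2 | h2
  · exact hd.ne h2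
  · exact h2 left_mem_uIcc

/-- Otherwise the integrand of the norm would be at least `ε/r` near zero, which is not integrable.
-/
lemma MemV2.exists_small {δ : ℝ} {v v₁ v₂ : ℝ → ℂ} (h : MemV2 δ v v₁ v₂) {ε d : ℝ}
    (hε : 0 < ε) (hd : 0 < d) (hdδ : d ≤ δ) :
    ∃ r ∈ Ioo 0 d, ‖v r‖ ^ 2 + ‖(r : ℂ) * v₁ r‖ ^ 2 < ε := by
  by_contra! hcon
  -- Staying below one allows `r⁻³ ≥ r⁻¹`.
  have hm : 0 < min d 1 := by positivity
  refine not_integrableOn_inv_Ioo hm ?_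
  have hint := (h.finite_norm.mono_set (Ioo_subset_Ioo_right ((min_le_left d 1).trans hdδ))).mul_const
    ε⁻¹
  refine Integrable.mono' hint measurable_inv.aestronglyMeasurable ?_
  rw [ae_restrict_iff' measurableSet_Ioo]
  refine Eventually.of_forall fun r hr => ?_
  have hr0 : 0 < r := hr.1
  have hr1 : r < 1 := hr.2.trans_le (min_le_right _ _)
  have h1 := hcon r ⟨hr0, hr.2.trans_le (min_le_left _ _)⟩
  rw [norm_mul, Complex.norm_real, Real.norm_of_nonneg hr0.le, mul_pow] at h1
  rw [Real.norm_of_nonneg (inv_nonneg.2 hr0.le), ← div_eq_mul_inv, le_div_iff₀ hε]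
  have e : (‖v₂ r‖ ^ 2 + ‖v₁ r‖ ^ 2 / r ^ 2 + ‖v r‖ ^ 2 / r ^ 4) * r =
      ‖v₂ r‖ ^ 2 * r + (‖v r‖ ^ 2 + r ^ 2 * ‖v₁ r‖ ^ 2) / r ^ 3 := by
    field_simp
    ring
  rw [e]
  have h2 : r⁻¹ * ε ≤ (‖v r‖ ^ 2 + r ^ 2 * ‖v₁ r‖ ^ 2) / r ^ 3 := by
    rw [le_div_iff₀ (by positivity)]
    have e2 : r⁻¹ * ε * r ^ 3 = ε * r ^ 2 := by field_simp
    rw [e2]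
    have : ε * r ^ 2 ≤ ε * 1 := by
      gcongr
      nlinarith
    linarith
  have h3 : 0 ≤ ‖v₂ r‖ ^ 2 * r := by positivity
  linarith

/-- A limit along one sequence is all that is needed of the behaviour at zero, because the brackets
it is inserted into are constant or monotone. -/
lemma MemV2.exists_seq {δ : ℝ} (hδ : 0 < δ) {v v₁ v₂ : ℝ → ℂ} (h : MemV2 δ v v₁ v₂) :
    ∃ ρ : ℕ → ℝ, (∀ n, ρ n ∈ Ioo 0 δ) ∧ Tendsto ρ atTop (𝓝[>] 0) ∧
      Tendsto (fun n => v (ρ n)) atTop (𝓝 0) ∧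
      Tendsto (fun n => (ρ n : ℂ) * v₁ (ρ n)) atTop (𝓝 0) := by
  have hex : ∀ n : ℕ, ∃ r ∈ Ioo 0 (min δ (1 / ((n : ℝ) + 1))),
      ‖v r‖ ^ 2 + ‖(r : ℂ) * v₁ r‖ ^ 2 < 1 / ((n : ℝ) + 1) := fun n =>
    h.exists_small (by positivity) (by positivity) (min_le_left _ _)
  choose ρ hρ hv using hex
  have hlim : Tendsto (fun n : ℕ => 1 / ((n : ℝ) + 1)) atTop (𝓝 0) :=
    tendsto_one_div_add_atTop_nhds_zero_nat
  have hsq : ∀ f : ℕ → ℂ, (∀ n, ‖f n‖ ^ 2 ≤ 1 / ((n : ℝ) + 1)) → Tendsto f atTop (𝓝 0) := by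
    intro f hf
    have h1 : Tendsto (fun n => ‖f n‖ ^ 2) atTop (𝓝 0) :=
      squeeze_zero (fun n => by positivity) hf hlim
    have h2 := (Real.continuous_sqrt.tendsto 0).comp h1
    rw [Real.sqrt_zero] at h2
    rw [tendsto_zero_iff_norm_tendsto_zero]
    refine h2.congr fun n => ?_
    simp [Real.sqrt_sq]
  refine ⟨ρ, fun n => ⟨(hρ n).1, (hρ n).2.trans_le (min_le_left _ _)⟩, ?_, ?_, ?_⟩
  · rw [tendsto_nhdsWithin_iff]
    refine ⟨squeeze_zero (fun n => (hρ n).1.le)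
      (fun n => ((hρ n).2.trans_le (min_le_right _ _)).le) hlim,
      Eventually.of_forall fun n => (hρ n).1⟩
  · exact hsq _ fun n => by nlinarith [hv n, sq_nonneg ‖(ρ n : ℂ) * v₁ (ρ n)‖]
  · exact hsq _ fun n => by nlinarith [hv n, sq_nonneg ‖v (ρ n)‖]

/-- The three orders make the integrand of the norm bounded near zero; on the rest of the interval
it is continuous. -/
lemma memV2_of_isBigO {δ : ℝ} {v v₁ v₂ : ℝ → ℂ}
    (h1 : ∀ r > 0, HasDerivAt v (v₁ r) r) (h2 : ∀ r > 0, HasDerivAt v₁ (v₂ r) r)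
    (hc : ContinuousOn v₂ (Ioi 0)) (hv : v =O[𝓝[>] 0] (fun r : ℝ => r ^ 2))
    (hv1 : v₁ =O[𝓝[>] 0] (fun r : ℝ => r)) (hv2 : v₂ =O[𝓝[>] 0] (fun _ : ℝ => (1 : ℝ))) :
    MemV2 δ v v₁ v₂ := by
  have hc0 : ContinuousOn v (Ioi 0) := fun r hr => (h1 r hr).continuousAt.continuousWithinAt
  have hc1 : ContinuousOn v₁ (Ioi 0) := fun r hr => (h2 r hr).continuousAt.continuousWithinAt
  refine ⟨hasWeakDerivOn_of_hasDerivAt h1 hc1, hasWeakDerivOn_of_hasDerivAt h2 hc, ?_⟩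
  have hcont : ContinuousOn
      (fun r : ℝ => (‖v₂ r‖ ^ 2 + ‖v₁ r‖ ^ 2 / r ^ 2 + ‖v r‖ ^ 2 / r ^ 4) * r) (Ioi 0) := by
    refine ((((hc.norm).pow 2).add (((hc1.norm).pow 2).div (continuousOn_id.pow 2)
      fun r hr => ?_)).add (((hc0.norm).pow 2).div (continuousOn_id.pow 4) fun r hr => ?_)).mul
      continuousOn_id
    · exact pow_ne_zero _ (ne_of_gt hr)
    · exact pow_ne_zero _ (ne_of_gt hr)
  obtain ⟨C, hC⟩ := hv.bound
  obtain ⟨C1, hC1⟩ := hv1.bound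
  obtain ⟨C2, hC2⟩ := hv2.bound
  obtain ⟨r0, hr0, hb⟩ := mem_nhdsGT_iff_exists_Ioo_subset.1 (hC.and (hC1.and hC2))
  have hr0 : 0 < r0 := hr0
  have hA : IntegrableOn
      (fun r : ℝ => (‖v₂ r‖ ^ 2 + ‖v₁ r‖ ^ 2 / r ^ 2 + ‖v r‖ ^ 2 / r ^ 4) * r) (Ioo 0 r0) := by
    refine Integrable.mono' (g := fun _ => (C2 ^ 2 + C1 ^ 2 + C ^ 2) * r0)
      (integrableOn_const (by simp)) ((hcont.mono fun r hr => hr.1).aestronglyMeasurable measurableSet_Ioo) ?_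
    rw [ae_restrict_iff' measurableSet_Ioo]
    refine Eventually.of_forall fun r hr => ?_
    have hr' : 0 < r := hr.1
    obtain ⟨b, b1, b2⟩ := hb hr
    rw [Real.norm_of_nonneg (by positivity)] at b b1 b2 ⊢
    have c2 : ‖v₂ r‖ ^ 2 ≤ C2 ^ 2 := by
      rw [mul_one] at b2
      gcongr
    have c1 : ‖v₁ r‖ ^ 2 / r ^ 2 ≤ C1 ^ 2 := by
      rw [div_le_iff₀ (by positivity), ← mul_pow]
      gcongr
    have c0 : ‖v r‖ ^ 2 / r ^ 4 ≤ C ^ 2 := by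
      rw [div_le_iff₀ (by positivity), show r ^ 4 = (r ^ 2) ^ 2 by ring, ← mul_pow]
      gcongr
    have := hr.2.le
    gcongr
  have hB : IntegrableOn
      (fun r : ℝ => (‖v₂ r‖ ^ 2 + ‖v₁ r‖ ^ 2 / r ^ 2 + ‖v r‖ ^ 2 / r ^ 4) * r) (Icc r0 δ) :=
    (hcont.mono fun r hr => hr0.trans_le hr.1).integrableOn_compact isCompact_Icc
  refine (hA.union hB).mono_set fun r hr => ?_
  rcases lt_or_ge r r0 with hlt | hge
  · exact Or.inl ⟨hr.1, hlt⟩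
  · exact Or.inr ⟨hge, hr.2.le⟩

/-! ### Real solutions of the equation -/

/-- The real solution `Im (w * I_{iκ}(τ r))` of the Bessel equation. -/
noncomputable def osc (κ τ : ℝ) (w : ℂ) (r : ℝ) : ℝ := (w * imI κ (τ * r)).im

/-- The derivative of `osc`. -/
noncomputable def oscDeriv (κ τ : ℝ) (w : ℂ) (r : ℝ) : ℝ := τ * (w * imIDeriv κ (τ * r)).im

lemma hasDerivAt_im_comp_mul {f : ℝ → ℂ} {f' w : ℂ} {τ r : ℝ} (h : HasDerivAt f f' (τ * r)) :
    HasDerivAt (fun r => (w * f (τ * r)).im) (τ * (w * f').im) r := by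
  have h1 : HasDerivAt (fun r : ℝ => τ * r) τ r := by simpa using (hasDerivAt_id r).const_mul τ
  have h2 := (h.scomp r h1).const_mul w
  have h3 := Complex.imCLM.hasFDerivAt.comp_hasDerivAt r h2
  refine h3.congr_deriv ?_
  rw [Complex.imCLM_apply, mul_smul_comm, Complex.smul_im, smul_eq_mul]

lemma hasDerivAt_osc {κ τ r : ℝ} (w : ℂ) (hτ : 0 < τ) (hr : 0 < r) :
    HasDerivAt (osc κ τ w) (oscDeriv κ τ w r) r :=
  hasDerivAt_im_comp_mul (hasDerivAt_imI κ (mul_pos hτ hr))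

lemma hasDerivAt_oscDeriv {κ τ r : ℝ} (w : ℂ) (hτ : 0 < τ) (hr : 0 < r) :
    HasDerivAt (oscDeriv κ τ w)
      ((τ ^ 2 - κ ^ 2 / r ^ 2) * osc κ τ w r - oscDeriv κ τ w r / r) r := by
  have h := (hasDerivAt_im_comp_mul (w := w) (hasDerivAt_imIDeriv κ (mul_pos hτ hr))).const_mul τ
  refine h.congr_deriv ?_
  have e : w * ((1 - (κ : ℂ) ^ 2 / ((τ * r : ℝ) : ℂ) ^ 2) * imI κ (τ * r)
        - imIDeriv κ (τ * r) / ((τ * r : ℝ) : ℂ))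
      = ((1 - κ ^ 2 / (τ * r) ^ 2 : ℝ) : ℂ) * (w * imI κ (τ * r))
        - (((τ * r)⁻¹ : ℝ) : ℂ) * (w * imIDeriv κ (τ * r)) := by
    push_cast
    ring
  rw [e, Complex.sub_im, Complex.im_ofReal_mul, Complex.im_ofReal_mul, osc, oscDeriv]
  field_simp

lemma continuousOn_osc {κ τ : ℝ} (w : ℂ) (hτ : 0 < τ) : ContinuousOn (osc κ τ w) (Ioi 0) :=
  fun _ hr => (hasDerivAt_osc w hτ hr).continuousAt.continuousWithinAt

lemma continuousOn_oscDeriv {κ τ : ℝ} (w : ℂ) (hτ : 0 < τ) :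
    ContinuousOn (oscDeriv κ τ w) (Ioi 0) :=
  fun _ hr => (hasDerivAt_oscDeriv w hτ hr).continuousAt.continuousWithinAt

/-- Multiplying `w` by `i` exchanges imaginary and real part, so `w` and `i w` give a fundamental
system. -/
lemma wronskian_osc {κ τ r : ℝ} (w : ℂ) (hτ : 0 < τ) (hr : 0 < r) :
    r * (osc κ τ w r * oscDeriv κ τ (Complex.I * w) r
      - oscDeriv κ τ w r * osc κ τ (Complex.I * w) r) =
      -‖w‖ ^ 2 * (κ / ‖Complex.Gamma (1 + κ * Complex.I)‖ ^ 2) := by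
  rw [← wronskian_imI κ (mul_pos hτ hr), ← Complex.normSq_eq_norm_sq, Complex.normSq_apply]
  simp only [osc, oscDeriv, Complex.mul_im, Complex.mul_re, Complex.I_re, Complex.I_im,
    Complex.conj_re, Complex.conj_im]
  ring

/-! ### Functions of the domain -/

/-- The phase of the leading term at zero. -/
noncomputable def phase (κ γ r : ℝ) : ℝ := κ * Real.log (r / 2) + γ

/-- The cut-off leading term at zero. -/
noncomputable def cutSin (κ γ : ℝ) (ζ : ℝ → ℝ) (τ r : ℝ) : ℝ :=
  ζ (τ * r) * Real.sin (phase κ γ r)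

lemma hasDerivAt_phase (κ γ : ℝ) {r : ℝ} (hr : 0 < r) : HasDerivAt (phase κ γ) (κ / r) r := by
  have h := ((((hasDerivAt_id r).div_const 2).log (by simpa using hr.ne')).const_mul κ).add_const γ
  refine h.congr_deriv ?_
  simp only [id]
  field_simp

lemma contDiffAt_cutSin {κ γ τ r : ℝ} {ζ : ℝ → ℝ} (hζ : ContDiff ℝ ∞ ζ) (hr : 0 < r) :
    ContDiffAt ℝ ∞ (cutSin κ γ ζ τ) r := by
  have h1 : ContDiffAt ℝ ∞ (phase κ γ) r :=
    (contDiffAt_const.mul ((contDiffAt_id.div_const 2).log (by simpa using hr.ne'))).add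
      contDiffAt_const
  exact (hζ.contDiffAt.comp r (contDiffAt_const.mul contDiffAt_id)).mul
    (Real.contDiff_sin.contDiffAt.comp r h1)

lemma hasDerivAt_cutSin {κ γ τ r : ℝ} {ζ : ℝ → ℝ} (hζ : ContDiff ℝ ∞ ζ) (hr : 0 < r) :
    HasDerivAt (cutSin κ γ ζ τ) (deriv (cutSin κ γ ζ τ) r) r :=
  ((contDiffAt_cutSin hζ hr).differentiableAt (by simp)).hasDerivAt

lemma contDiffAt_deriv_cutSin {κ γ τ r : ℝ} {ζ : ℝ → ℝ} (hζ : ContDiff ℝ ∞ ζ) (hr : 0 < r) :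
    ContDiffAt ℝ ∞ (deriv (cutSin κ γ ζ τ)) r :=
  (contDiffAt_cutSin hζ hr).derivWithin (by simp)

lemma cutSin_eventuallyEq {κ γ τ r : ℝ} {ζ : ℝ → ℝ} (hζ1 : ∀ r < 1 / 3, ζ r = 1)
    (h : τ * r < 1 / 3) : cutSin κ γ ζ τ =ᶠ[𝓝 r] fun r => Real.sin (phase κ γ r) := by
  have : ∀ᶠ s in 𝓝 r, τ * s < 1 / 3 :=
    (Continuous.tendsto (by fun_prop : Continuous fun s : ℝ => τ * s) r).eventually_lt_const h
  filter_upwards [this] with s hs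
  rw [cutSin, hζ1 _ hs, one_mul]

lemma cutSin_eventuallyEq_zero {κ γ τ r : ℝ} {ζ : ℝ → ℝ} (hζ0 : ∀ r > 2 / 3, ζ r = 0)
    (h : 2 / 3 < τ * r) : cutSin κ γ ζ τ =ᶠ[𝓝 r] fun _ => 0 := by
  have : ∀ᶠ s in 𝓝 r, 2 / 3 < τ * s :=
    (Continuous.tendsto (by fun_prop : Continuous fun s : ℝ => τ * s) r).eventually_const_lt h
  filter_upwards [this] with s hs
  rw [cutSin, hζ0 _ hs, zero_mul]

lemma deriv_cutSin {κ γ τ r : ℝ} {ζ : ℝ → ℝ} (hζ1 : ∀ r < 1 / 3, ζ r = 1) (hr : 0 < r)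
    (h : τ * r < 1 / 3) : deriv (cutSin κ γ ζ τ) r = Real.cos (phase κ γ r) * (κ / r) := by
  rw [(cutSin_eventuallyEq hζ1 h).deriv_eq]
  exact (hasDerivAt_phase κ γ hr).sin.deriv

lemma eventually_mul_lt_third (τ : ℝ) : ∀ᶠ r in 𝓝[>] (0 : ℝ), τ * r < 1 / 3 := by
  have : Tendsto (fun r : ℝ => τ * r) (𝓝 0) (𝓝 (τ * 0)) :=
    Continuous.tendsto (by fun_prop : Continuous fun s : ℝ => τ * s) 0
  exact (this.mono_left nhdsWithin_le_nhds).eventually_lt_const (by norm_num)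

/-- Functions of the domain have two weak derivatives, satisfy the Robin condition, and behave like
a multiple of the leading term along a sequence tending to zero. -/
lemma MemDomainInhom.exists_derivs {κ γ δ τ : ℝ} {α ζ : ℝ → ℝ} {b : ℂ} {h : ℝ → ℂ}
    (hζ : ContDiff ℝ ∞ ζ) (hζ1 : ∀ r < 1 / 3, ζ r = 1) (hζ0 : ∀ r > 2 / 3, ζ r = 0)
    (hδ : 0 < δ) (hτδ : 2 / 3 < τ * δ)
    (hh : MemDomainInhom κ γ δ α ζ τ b h) :
    ∃ h₁ h₂ : ℝ → ℂ, HasWeakDerivOn δ h h₁ ∧ HasWeakDerivOn δ h₁ h₂ ∧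
      h₁ δ + ((τ - α τ⁻¹ : ℝ) : ℂ) * h δ = b ∧
      ∃ (C : ℂ) (ρ : ℕ → ℝ), (∀ n, ρ n ∈ Ioo 0 δ) ∧ Tendsto ρ atTop (𝓝[>] 0) ∧
        Tendsto (fun n => h (ρ n) - C * (Real.sin (phase κ γ (ρ n)) : ℂ)) atTop (𝓝 0) ∧
        Tendsto (fun n => (ρ n : ℂ) * h₁ (ρ n) - C * (κ * Real.cos (phase κ γ (ρ n)) : ℝ))
          atTop (𝓝 0) := by
  obtain ⟨C, v, v₁, v₂, hv, hb, hr⟩ := hh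
  obtain ⟨ρ, hρ, hρ0, hv0, hv1⟩ := hv.exists_seq hδ
  set Z := cutSin κ γ ζ τ with hZ
  have hr' : ∀ r ∈ Ioc 0 δ, h r = C * (Z r : ℂ) + v r := hr
  have c0 : ∀ r > 0, HasDerivAt (fun r => C * (Z r : ℂ)) (C * ((deriv Z r : ℝ) : ℂ)) r := fun r hr =>
    ((hasDerivAt_cutSin hζ hr).ofReal_comp).const_mul C
  have c1 : ∀ r > 0, HasDerivAt (fun r => C * ((deriv Z r : ℝ) : ℂ)) (C * ((deriv (deriv Z) r : ℝ) : ℂ)) r :=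
    fun r hr => ((((contDiffAt_deriv_cutSin hζ hr).differentiableAt
      (by simp)).hasDerivAt).ofReal_comp).const_mul C
  have c2 : ContinuousOn (fun r => C * ((deriv (deriv Z) r : ℝ) : ℂ)) (Ioi 0) := by
    intro r hr
    have : ContDiffAt ℝ ∞ (deriv (deriv Z)) r :=
      (contDiffAt_deriv_cutSin hζ hr).derivWithin (by simp)
    exact (continuousAt_const.mul
      (Complex.continuous_ofReal.continuousAt.comp this.continuousAt)).continuousWithinAt
  have w1 := (hasWeakDerivOn_of_hasDerivAt (δ := δ) c0
    fun r hr => (c1 r hr).continuousAt.continuousWithinAt).add hv.deriv_one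
  have w2 := (hasWeakDerivOn_of_hasDerivAt (δ := δ) c1 c2).add hv.deriv_two
  have hsmall : ∀ᶠ n in atTop, τ * ρ n < 1 / 3 := hρ0.eventually (eventually_mul_lt_third τ)
  refine ⟨_, _, w1.congr hr' (Eventually.of_forall fun _ => rfl), w2, ?_, C, ρ, hρ, hρ0, ?_, ?_⟩
  · have e := cutSin_eventuallyEq_zero (κ := κ) (γ := γ) hζ0 hτδ
    have e1 : Z δ = 0 := e.eq_of_nhds
    have e2 : deriv Z δ = 0 := by rw [e.deriv_eq, deriv_const]
    rw [hr' δ ⟨hδ, le_rfl⟩, e1, e2]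
    simpa using hb
  · refine hv0.congr' ?_
    filter_upwards [hsmall] with n hn
    rw [hr' _ ⟨(hρ n).1, (hρ n).2.le⟩, hZ, (cutSin_eventuallyEq hζ1 hn).eq_of_nhds]
    ring
  · refine hv1.congr' ?_
    filter_upwards [hsmall] with n hn
    have h0 : (ρ n : ℂ) ≠ 0 := by exact_mod_cast (hρ n).1.ne'
    rw [deriv_cutSin hζ1 (hρ n).1 hn]
    push_cast
    field_simp
    ring

/-- A function that satisfies the equation almost everywhere satisfies it everywhere. -/
lemma hasDerivAt_of_besselOp {κ τ δ : ℝ} {h h₁ h₂ F : ℝ → ℂ} (hw1 : HasWeakDerivOn δ h h₁)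
    (hw2 : HasWeakDerivOn δ h₁ h₂) (hF : ContinuousOn F (Ioc 0 δ))
    (hode : ∀ᵐ r ∂(volume.restrict (Ioo 0 δ)), besselOp κ h r + (τ : ℂ) ^ 2 * h r + F r = 0) :
    (∀ r ∈ Ioo 0 δ, HasDerivAt h (h₁ r) r) ∧ ∀ r ∈ Ioo 0 δ, HasDerivAt h₁
      (((τ : ℂ) ^ 2 - (κ : ℂ) ^ 2 / (r : ℂ) ^ 2) * h r - h₁ r / r + F r) r := by
  have hc1 : ContinuousOn h₁ (Ioo 0 δ) := hw2.continuousOn.mono Ioo_subset_Ioc_self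
  have hc0 : ContinuousOn h (Ioo 0 δ) := hw1.continuousOn.mono Ioo_subset_Ioc_self
  have hd : ∀ r ∈ Ioo 0 δ, HasDerivAt h (h₁ r) r := fun r hr => hw1.hasDerivAt hc1 hr
  refine ⟨hd, ?_⟩
  -- The value that the equation forces on the second derivative. It is continuous and agrees almost
  -- everywhere with `h₂`, so it can replace `h₂` as the weak derivative of `h₁`, which is then a
  -- classical one.
  set G : ℝ → ℂ := fun r =>
    ((τ : ℂ) ^ 2 - (κ : ℂ) ^ 2 / (r : ℂ) ^ 2) * h r - h₁ r / r + F r with hG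
  have hne : ∀ r ∈ Ioo 0 δ, (r : ℂ) ≠ 0 := fun r hr => by exact_mod_cast hr.1.ne'
  have hcr : ContinuousOn (fun r : ℝ => (r : ℂ)) (Ioo 0 δ) := Complex.continuous_ofReal.continuousOn
  have hGc : ContinuousOn G (Ioo 0 δ) :=
    (((continuousOn_const.sub (continuousOn_const.div (hcr.pow 2)
      fun r hr => pow_ne_zero _ (hne r hr))).mul hc0).sub (hc1.div hcr hne)).add
      (hF.mono Ioo_subset_Ioc_self)
  have hae : ∀ᵐ r ∂(volume.restrict (Ioo 0 δ)), G r = h₂ r := by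
    filter_upwards [hode, hw2.ae_hasDerivAt, ae_restrict_mem measurableSet_Ioo] with r h1 h2 hr
    have he : (fun s : ℝ => (s : ℂ) * deriv h s) =ᶠ[𝓝 r] fun s : ℝ => (s : ℂ) * h₁ s := by
      filter_upwards [Ioo_mem_nhds hr.1 hr.2] with s hs
      rw [(hd s hs).deriv]
    have h3 : HasDerivAt (fun s : ℝ => (s : ℂ) * h₁ s) (1 * h₁ r + r * h₂ r) r :=
      ((hasDerivAt_id r).ofReal_comp).mul h2
    rw [besselOp, he.deriv_eq, h3.deriv] at h1
    have h0 := hne r hr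
    simp only [hG]
    have e : h₂ r = G r - (-((r : ℂ)⁻¹ * (1 * h₁ r + r * h₂ r)) -
        (κ : ℂ) ^ 2 / (r : ℂ) ^ 2 * h r + (τ : ℂ) ^ 2 * h r + F r) := by
      simp only [hG]
      field_simp
      ring
    rw [h1, sub_zero] at e
    exact e.symm
  intro r hr
  exact (hw2.congr (fun _ _ => rfl) hae).hasDerivAt hGc hr

/-- `r (h' y - h y')` for the real solution `y = osc κ τ w`. -/
noncomputable def bracket (κ τ : ℝ) (w : ℂ) (h h₁ : ℝ → ℂ) (r : ℝ) : ℂ :=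
  (r : ℂ) * (h₁ r * (osc κ τ w r : ℂ) - h r * (oscDeriv κ τ w r : ℂ))

/-- Lagrange's identity: `h` and `osc` obey the same equation up to `F`, so only the inhomogeneity
survives. -/
lemma hasDerivAt_bracket {κ τ r : ℝ} {w F : ℂ} {h h₁ : ℝ → ℂ} (hτ : 0 < τ) (hr : 0 < r)
    (hh : HasDerivAt h (h₁ r) r) (hh1 : HasDerivAt h₁
      (((τ : ℂ) ^ 2 - (κ : ℂ) ^ 2 / (r : ℂ) ^ 2) * h r - h₁ r / r + F) r) :
    HasDerivAt (bracket κ τ w h h₁) (r * F * (osc κ τ w r : ℂ)) r := by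
  have h0 : (r : ℂ) ≠ 0 := by exact_mod_cast hr.ne'
  have a := ((hasDerivAt_id r).ofReal_comp).mul
    ((hh1.mul (hasDerivAt_osc (κ := κ) w hτ hr).ofReal_comp).sub
      (hh.mul (hasDerivAt_oscDeriv (κ := κ) w hτ hr).ofReal_comp))
  refine a.congr_deriv ?_
  simp only [id, Pi.mul_apply, Pi.sub_apply]
  push_cast
  field_simp
  ring

lemma continuousOn_bracket {κ τ δ : ℝ} {w : ℂ} {h h₁ : ℝ → ℂ} (hτ : 0 < τ)
    (hh : ContinuousOn h (Ioc 0 δ)) (hh1 : ContinuousOn h₁ (Ioc 0 δ)) :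
    ContinuousOn (bracket κ τ w h h₁) (Ioc 0 δ) := by
  have hsub : Ioc 0 δ ⊆ Ioi (0 : ℝ) := fun r hr => hr.1
  exact Complex.continuous_ofReal.continuousOn.mul
    ((hh1.mul (Complex.continuous_ofReal.comp_continuousOn ((continuousOn_osc w hτ).mono hsub))).sub
      (hh.mul (Complex.continuous_ofReal.comp_continuousOn
        ((continuousOn_oscDeriv w hτ).mono hsub))))

lemma bracket_const {κ τ δ : ℝ} {w : ℂ} {h h₁ : ℝ → ℂ} (hτ : 0 < τ)
    (hc : ContinuousOn h (Ioc 0 δ)) (hc1 : ContinuousOn h₁ (Ioc 0 δ))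
    (hh : ∀ r ∈ Ioo 0 δ, HasDerivAt h (h₁ r) r) (hh1 : ∀ r ∈ Ioo 0 δ, HasDerivAt h₁
      (((τ : ℂ) ^ 2 - (κ : ℂ) ^ 2 / (r : ℂ) ^ 2) * h r - h₁ r / r + 0) r)
    {r : ℝ} (hr : r ∈ Ioc 0 δ) : bracket κ τ w h h₁ r = bracket κ τ w h h₁ δ := by
  refine (constant_of_has_deriv_right_zero ((continuousOn_bracket hτ hc hc1).mono
    fun s hs => ⟨hr.1.trans_le hs.1, hs.2⟩) (fun s hs => ?_) δ ⟨hr.2, le_rfl⟩).symm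
  have hs' : s ∈ Ioo 0 δ := ⟨hr.1.trans_le hs.1, hs.2⟩
  have := hasDerivAt_bracket (w := w) hτ hs'.1 (hh s hs') (hh1 s hs')
  rw [mul_zero, zero_mul] at this
  exact this.hasDerivWithinAt

/-! ### The solution with the prescribed behaviour at zero -/

/-- The shift `κ log τ - γ_κ - γ` between the phases of `I_{iκ}(τ r)` and of the leading term. -/
noncomputable def phaseShift (κ γ γκ τ : ℝ) : ℝ := κ * Real.log τ - γκ - γ

/-- The factor for which `Im (w * I_{iκ}(τ r))` has the prescribed behaviour at zero. -/
noncomputable def shiftFactor (κ γ γκ τ : ℝ) : ℂ :=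
  Complex.exp ((-phaseShift κ γ γκ τ : ℝ) * Complex.I)

/-- `γ_κ` is an argument of `Γ(1 + iκ)`, with the modulus made explicit. -/
def IsGammaPhase (κ γκ : ℝ) : Prop :=
  Complex.Gamma (1 + κ * Complex.I) =
    (Real.sqrt (Real.pi * κ / Real.sinh (Real.pi * κ)) : ℂ) * Complex.exp (γκ * Complex.I)

/-- The modulus of `1 / Γ(1 + iκ)`. -/
noncomputable def amplitude (κ : ℝ) : ℝ :=
  (Real.sqrt (Real.pi * κ / Real.sinh (Real.pi * κ)))⁻¹

lemma sinh_pi_mul_pos {κ : ℝ} (hκ : 0 < κ) : 0 < Real.sinh (Real.pi * κ) :=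
  Real.sinh_pos_iff.2 (mul_pos Real.pi_pos hκ)

/-- The phases `κ log τ` from the scaling and `-γ_κ` from `1/Γ(1+iκ)` are cancelled by the factor,
leaving `γ`. -/
lemma shiftFactor_mul_leading {κ γ γκ τ r : ℝ}
    (hγκ : IsGammaPhase κ γκ) (hτ : 0 < τ) (hr : 0 < r) :
    shiftFactor κ γ γκ τ * ((Complex.Gamma (1 + κ * Complex.I))⁻¹ *
      Complex.exp ((κ * Real.log (τ * r / 2) : ℝ) * Complex.I)) =
      (amplitude κ : ℂ) * Complex.exp ((phase κ γ r : ℝ) * Complex.I) := by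
  rw [IsGammaPhase] at hγκ
  rw [hγκ, mul_inv, ← Complex.exp_neg, amplitude, shiftFactor, Complex.ofReal_inv]
  calc _ = ((Real.sqrt (Real.pi * κ / Real.sinh (Real.pi * κ)) : ℝ) : ℂ)⁻¹ *
        (Complex.exp ((-phaseShift κ γ γκ τ : ℝ) * Complex.I) * Complex.exp (-(γκ * Complex.I)) *
          Complex.exp ((κ * Real.log (τ * r / 2) : ℝ) * Complex.I)) := by ring
    _ = _ := by
      rw [← Complex.exp_add, ← Complex.exp_add]
      congr 2
      rw [mul_div_assoc, Real.log_mul hτ.ne' (by positivity), phaseShift, phase]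
      push_cast
      ring

/-- The difference of the solution and its leading term at zero. -/
noncomputable def oscRem (κ τ : ℝ) (w : ℂ) (r : ℝ) : ℝ := (w * imIRem κ (τ * r)).im

/-- The derivative of `oscRem`. -/
noncomputable def oscRemDeriv (κ τ : ℝ) (w : ℂ) (r : ℝ) : ℝ := τ * (w * imIRemDeriv κ (τ * r)).im

/-- The second derivative of `oscRem`. -/
noncomputable def oscRemDeriv2 (κ τ : ℝ) (w : ℂ) (r : ℝ) : ℝ :=
  τ * (τ * (w * imIRemDeriv2 κ (τ * r)).im)

lemma hasDerivAt_oscRem {κ τ r : ℝ} (w : ℂ) (hτ : 0 < τ) (hr : 0 < r) :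
    HasDerivAt (oscRem κ τ w) (oscRemDeriv κ τ w r) r :=
  hasDerivAt_im_comp_mul (hasDerivAt_imIRem κ (mul_pos hτ hr))

lemma hasDerivAt_oscRemDeriv {κ τ r : ℝ} (w : ℂ) (hτ : 0 < τ) (hr : 0 < r) :
    HasDerivAt (oscRemDeriv κ τ w) (oscRemDeriv2 κ τ w r) r :=
  (hasDerivAt_im_comp_mul (hasDerivAt_imIRemDeriv κ (mul_pos hτ hr))).const_mul τ

lemma isBigO_im_comp_mul {f : ℝ → ℂ} {τ : ℝ} {n : ℕ} (w : ℂ) (hτ : 0 < τ)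
    (hf : f =O[𝓝[>] 0] (fun x : ℝ => x ^ n)) :
    (fun r : ℝ => (w * f (τ * r)).im) =O[𝓝[>] 0] (fun r : ℝ => r ^ n) := by
  have ht : Tendsto (fun r : ℝ => τ * r) (𝓝[>] 0) (𝓝[>] 0) := by
    rw [tendsto_nhdsWithin_iff]
    constructor
    · have : Tendsto (fun r : ℝ => τ * r) (𝓝 0) (𝓝 (τ * 0)) :=
        Continuous.tendsto (by fun_prop : Continuous fun s : ℝ => τ * s) 0
      rw [mul_zero] at this
      exact this.mono_left nhdsWithin_le_nhds
    · filter_upwards [self_mem_nhdsWithin] with r hr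
      exact mul_pos hτ hr
  have h1 : (fun r : ℝ => (w * f (τ * r)).im) =O[𝓝[>] 0] (fun r : ℝ => f (τ * r)) := by
    refine Asymptotics.IsBigO.of_bound ‖w‖ (Eventually.of_forall fun r => ?_)
    rw [← norm_mul]
    exact Complex.abs_im_le_norm _
  refine (h1.trans (hf.comp_tendsto ht)).trans ?_
  refine Asymptotics.IsBigO.of_bound (τ ^ n) (Eventually.of_forall fun r => ?_)
  simp [Function.comp, mul_pow, abs_of_pos hτ]

lemma oscRem_isBigO {τ : ℝ} (κ : ℝ) (w : ℂ) (hτ : 0 < τ) :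
    oscRem κ τ w =O[𝓝[>] 0] (fun r : ℝ => r ^ 2) :=
  isBigO_im_comp_mul w hτ (imIRem_isBigO κ)

lemma oscRemDeriv_isBigO {τ : ℝ} (κ : ℝ) (w : ℂ) (hτ : 0 < τ) :
    oscRemDeriv κ τ w =O[𝓝[>] 0] (fun r : ℝ => r) := by
  have := isBigO_im_comp_mul (n := 1) w hτ (by simpa using imIRemDeriv_isBigO κ)
  simp only [pow_one] at this
  exact this.const_mul_left τ

lemma oscRemDeriv2_isBigO {τ : ℝ} (κ : ℝ) (w : ℂ) (hτ : 0 < τ) :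
    oscRemDeriv2 κ τ w =O[𝓝[>] 0] (fun _ : ℝ => (1 : ℝ)) := by
  have := isBigO_im_comp_mul (n := 0) w hτ (by simpa using imIRemDeriv2_isBigO κ)
  simp only [pow_zero] at this
  exact (this.const_mul_left τ).const_mul_left τ

lemma osc_eq_leading_add {κ γ γκ τ r : ℝ} (hγκ : IsGammaPhase κ γκ) (hτ : 0 < τ) (hr : 0 < r) :
    osc κ τ (shiftFactor κ γ γκ τ) r = amplitude κ * Real.sin (phase κ γ r) +
      oscRem κ τ (shiftFactor κ γ γκ τ) r := by
  have h : shiftFactor κ γ γκ τ * imI κ (τ * r) =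
      (amplitude κ : ℂ) * Complex.exp ((phase κ γ r : ℝ) * Complex.I) +
        shiftFactor κ γ γκ τ * imIRem κ (τ * r) := by
    rw [← shiftFactor_mul_leading hγκ hτ hr, imIRem]
    ring
  rw [osc, h, Complex.add_im, Complex.im_ofReal_mul, Complex.exp_ofReal_mul_I_im, oscRem]

lemma oscDeriv_eq_leading_add {κ γ γκ τ r : ℝ} (hγκ : IsGammaPhase κ γκ) (hτ : 0 < τ)
    (hr : 0 < r) :
    oscDeriv κ τ (shiftFactor κ γ γκ τ) r =
      amplitude κ * (Real.cos (phase κ γ r) * (κ / r)) +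
        oscRemDeriv κ τ (shiftFactor κ γ γκ τ) r := by
  refine (hasDerivAt_osc _ hτ hr).unique ?_
  refine ((((hasDerivAt_phase κ γ hr).sin).const_mul (amplitude κ)).add
    (hasDerivAt_oscRem (shiftFactor κ γ γκ τ) hτ hr)).congr_of_eventuallyEq ?_
  filter_upwards [lt_mem_nhds hr] with s hs
  exact osc_eq_leading_add hγκ hτ hs

lemma tendsto_zero_bdd_mul {f g : ℕ → ℂ} {M : ℝ} (hf : ∀ n, ‖f n‖ ≤ M)
    (hg : Tendsto g atTop (𝓝 0)) : Tendsto (fun n => f n * g n) atTop (𝓝 0) := by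
  have h := hg.norm.const_mul M
  rw [norm_zero, mul_zero] at h
  refine squeeze_zero_norm (fun n => ?_) h
  rw [norm_mul]
  gcongr
  exact hf n

/-- Both functions have multiples of the same sine as leading term, and the leading parts cancel in
the bracket. What is left are products of bounded and vanishing factors. -/
lemma tendsto_bracket_shiftFactor {κ γ γκ τ : ℝ} (hγκ : IsGammaPhase κ γκ) (hτ : 0 < τ)
    {h h₁ : ℝ → ℂ} {C : ℂ} {ρ : ℕ → ℝ} (hρ : ∀ n, 0 < ρ n) (hρ0 : Tendsto ρ atTop (𝓝[>] 0))
    (ha : Tendsto (fun n => h (ρ n) - C * (Real.sin (phase κ γ (ρ n)) : ℂ)) atTop (𝓝 0))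
    (hb : Tendsto (fun n => (ρ n : ℂ) * h₁ (ρ n) - C * (κ * Real.cos (phase κ γ (ρ n)) : ℝ))
      atTop (𝓝 0)) :
    Tendsto (fun n => bracket κ τ (shiftFactor κ γ γκ τ) h h₁ (ρ n)) atTop (𝓝 0) := by
  set w := shiftFactor κ γ γκ τ with hw
  have hρ1 : Tendsto ρ atTop (𝓝 0) := hρ0.mono_right nhdsWithin_le_nhds
  have hu : Tendsto (fun n => oscRem κ τ w (ρ n)) atTop (𝓝 0) := by
    refine ((oscRem_isBigO κ w hτ).comp_tendsto hρ0).trans_tendsto ?_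
    simpa [Function.comp_def] using hρ1.pow 2
  have hu1 : Tendsto (fun n => ρ n * oscRemDeriv κ τ w (ρ n)) atTop (𝓝 0) := by
    have h1 : Tendsto (fun n => oscRemDeriv κ τ w (ρ n)) atTop (𝓝 0) :=
      ((oscRemDeriv_isBigO κ w hτ).comp_tendsto hρ0).trans_tendsto hρ1
    simpa using hρ1.mul h1
  have hu' : Tendsto (fun n => ((oscRem κ τ w (ρ n) : ℝ) : ℂ)) atTop (𝓝 0) :=
    (Complex.continuous_ofReal.tendsto' 0 0 (by simp)).comp hu
  have hu1' : Tendsto (fun n => ((ρ n * oscRemDeriv κ τ w (ρ n) : ℝ) : ℂ)) atTop (𝓝 0) :=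
    (Complex.continuous_ofReal.tendsto' 0 0 (by simp)).comp hu1
  have bs : ∀ (z : ℂ) (n : ℕ), ‖z * (Real.sin (phase κ γ (ρ n)) : ℂ)‖ ≤ ‖z‖ := fun z n => by
    rw [norm_mul, Complex.norm_real, Real.norm_eq_abs]
    exact mul_le_of_le_one_right (norm_nonneg z) (Real.abs_sin_le_one _)
  have bc : ∀ (z : ℂ) (n : ℕ), ‖z * (Real.cos (phase κ γ (ρ n)) : ℂ)‖ ≤ ‖z‖ := fun z n => by
    rw [norm_mul, Complex.norm_real, Real.norm_eq_abs]
    exact mul_le_of_le_one_right (norm_nonneg z) (Real.abs_cos_le_one _)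
  have t1 := tendsto_zero_bdd_mul (bc (C * κ)) hu'
  have t2 := (tendsto_zero_bdd_mul (bs (amplitude κ)) hb).add (hb.mul hu')
  have t3 := tendsto_zero_bdd_mul (bs C) hu1'
  have t4 := (tendsto_zero_bdd_mul (bc (amplitude κ * κ)) ha).add (ha.mul hu1')
  have t := (t1.add t2).sub (t3.add t4)
  simp only [mul_zero, add_zero, sub_zero] at t
  refine t.congr fun n => ?_
  have h0 : (ρ n : ℂ) ≠ 0 := by exact_mod_cast (hρ n).ne'
  rw [bracket, osc_eq_leading_add hγκ hτ (hρ n), oscDeriv_eq_leading_add hγκ hτ (hρ n)]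
  push_cast
  field_simp
  ring

/-! ### Eigenfunctions -/

lemma Gamma_ne_zero_imag (κ : ℝ) : Complex.Gamma (1 + κ * Complex.I) ≠ 0 :=
  Complex.Gamma_ne_zero_of_re_pos (by simp)

lemma wronskian_osc_ne_zero {κ τ r : ℝ} {w : ℂ} (hκ : 0 < κ) (hw : w ≠ 0) (hτ : 0 < τ)
    (hr : 0 < r) :
    r * (osc κ τ w r * oscDeriv κ τ (Complex.I * w) r
      - oscDeriv κ τ w r * osc κ τ (Complex.I * w) r) ≠ 0 := by
  rw [wronskian_osc w hτ hr]
  have h1 := norm_pos_iff.2 hw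
  have h2 := norm_pos_iff.2 (Gamma_ne_zero_imag κ)
  have : 0 < ‖w‖ ^ 2 * (κ / ‖Complex.Gamma (1 + κ * Complex.I)‖ ^ 2) := by positivity
  linarith

lemma exists_osc_ne_zero {κ τ δ : ℝ} {w : ℂ} (hκ : 0 < κ) (hw : w ≠ 0) (hτ : 0 < τ)
    (hδ : 0 < δ) : ∃ r ∈ Ioo 0 δ, osc κ τ w r ≠ 0 := by
  by_contra! hcon
  have hm : δ / 2 ∈ Ioo 0 δ := ⟨half_pos hδ, half_lt_self hδ⟩
  have h1 : osc κ τ w =ᶠ[𝓝 (δ / 2)] fun _ => 0 := by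
    filter_upwards [Ioo_mem_nhds hm.1 hm.2] with r hr
    exact hcon r hr
  have h2 : oscDeriv κ τ w (δ / 2) = 0 := by
    rw [← (hasDerivAt_osc w hτ hm.1).deriv, h1.deriv_eq, deriv_const]
  apply wronskian_osc_ne_zero hκ hw hτ hm.1
  rw [hcon _ hm, h2]
  ring

lemma shiftFactor_ne_zero (κ γ γκ τ : ℝ) : shiftFactor κ γ γκ τ ≠ 0 := Complex.exp_ne_zero _

/-- The Robin expression of `osc`. -/
noncomputable def oscRobin (κ δ : ℝ) (α : ℝ → ℝ) (τ : ℝ) (w : ℂ) : ℝ :=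
  oscDeriv κ τ w δ + (τ - α τ⁻¹) * osc κ τ w δ

section Eigen

variable {κ γ γκ δ τ : ℝ} {α ζ : ℝ → ℝ}

/-- The bracket of `h` with the selected solution vanishes and the bracket with the second one is
constant; the nonzero Wronskian allows solving for `h` and `h₁`. -/
lemma IsEigenfunction.eq_mul_osc (hκ : 0 < κ) (hγκ : IsGammaPhase κ γκ) (hζ : ContDiff ℝ ∞ ζ)
    (hζ1 : ∀ r < 1 / 3, ζ r = 1) (hζ0 : ∀ r > 2 / 3, ζ r = 0)
    (hδ : 0 < δ) (hτ : 0 < τ) (hτδ : 2 / 3 < τ * δ)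
    {h : ℝ → ℂ} (hh : IsEigenfunction κ γ δ α ζ τ h) :
    ∃ c : ℂ, c ≠ 0 ∧ (∀ r ∈ Ioc 0 δ, h r = c * (osc κ τ (shiftFactor κ γ γκ τ) r : ℂ)) ∧
      oscRobin κ δ α τ (shiftFactor κ γ γκ τ) = 0 := by
  set w := shiftFactor κ γ γκ τ with hw
  have hw0 : w ≠ 0 := shiftFactor_ne_zero _ _ _ _
  obtain ⟨hdom, ⟨r0, hr0, hne⟩, hode⟩ := hh
  obtain ⟨h₁, h₂, hw1, hw2, hb, C, ρ, hρ, hρ0, ha, hb'⟩ :=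
    MemDomainInhom.exists_derivs hζ hζ1 hζ0 hδ hτδ hdom
  obtain ⟨hd, hd1⟩ := hasDerivAt_of_besselOp (τ := τ) (F := fun _ => 0) hw1 hw2 continuousOn_const
    (by filter_upwards [hode] with r hr; rw [hr]; ring)
  have hc := hw1.continuousOn
  have hc1 := hw2.continuousOn
  have hlim := tendsto_bracket_shiftFactor (γ := γ) hγκ hτ (fun n => (hρ n).1) hρ0 ha hb'
  have hconst : ∀ (w' : ℂ), ∀ r ∈ Ioc 0 δ, bracket κ τ w' h h₁ r = bracket κ τ w' h h₁ δ :=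
    fun w' r hr => bracket_const hτ hc hc1 hd hd1 hr
  have hzero : bracket κ τ w h h₁ δ = 0 := by
    refine tendsto_nhds_unique (tendsto_const_nhds.congr fun n => ?_) hlim
    exact (hconst w _ ⟨(hρ n).1, (hρ n).2.le⟩).symm
  set W : ℝ := -‖w‖ ^ 2 * (κ / ‖Complex.Gamma (1 + κ * Complex.I)‖ ^ 2) with hW
  have hW0 : (W : ℂ) ≠ 0 := by
    have := wronskian_osc_ne_zero hκ hw0 hτ hδ
    rw [wronskian_osc w hτ hδ] at this
    exact_mod_cast this
  set B : ℂ := bracket κ τ (Complex.I * w) h h₁ δ with hB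
  -- Cramer's rule for the two bracket equations at `r`.
  have key : ∀ r ∈ Ioc 0 δ, h r = -(B / W) * (osc κ τ w r : ℂ) ∧
      h₁ r = -(B / W) * (oscDeriv κ τ w r : ℂ) := by
    intro r hr
    have e1 := hconst (Complex.I * w) r hr
    have e2 := (hconst w r hr).trans hzero
    have e3 : (r : ℂ) * ((osc κ τ w r : ℂ) * (oscDeriv κ τ (Complex.I * w) r : ℂ)
      - (oscDeriv κ τ w r : ℂ) * (osc κ τ (Complex.I * w) r : ℂ)) = W := by
      exact_mod_cast wronskian_osc w hτ hr.1
    rw [← hB] at e1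
    rw [bracket] at e1 e2
    constructor
    · rw [eq_comm, ← sub_eq_zero]
      have : (-(B / W) * (osc κ τ w r : ℂ) - h r) * W = 0 := by
        rw [sub_mul, show -(B / W) * (osc κ τ w r : ℂ) * W = -B * (osc κ τ w r : ℂ) by
          field_simp]
        linear_combination (osc κ τ w r : ℂ) * e1 - (osc κ τ (Complex.I * w) r : ℂ) * e2
          - h r * (- e3)
      exact (mul_eq_zero.1 this).resolve_right hW0
    · rw [eq_comm, ← sub_eq_zero]
      have : (-(B / W) * (oscDeriv κ τ w r : ℂ) - h₁ r) * W = 0 := by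
        rw [sub_mul, show -(B / W) * (oscDeriv κ τ w r : ℂ) * W = -B * (oscDeriv κ τ w r : ℂ) by
          field_simp]
        linear_combination (oscDeriv κ τ w r : ℂ) * e1
          - (oscDeriv κ τ (Complex.I * w) r : ℂ) * e2 - h₁ r * (- e3)
      exact (mul_eq_zero.1 this).resolve_right hW0
  have hc0 : -(B / W) ≠ 0 := by
    intro h0
    apply hne
    rw [(key r0 ⟨hr0.1, hr0.2.le⟩).1, h0, zero_mul]
  refine ⟨-(B / W), hc0, fun r hr => (key r hr).1, ?_⟩
  rw [(key δ ⟨hδ, le_rfl⟩).1, (key δ ⟨hδ, le_rfl⟩).2] at hb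
  have : -(B / W) * (oscRobin κ δ α τ w : ℂ) = 0 := by
    rw [← hb, oscRobin]
    push_cast
    ring
  exact_mod_cast (mul_eq_zero.1 this).resolve_left hc0

lemma besselOp_osc {w A : ℂ} (hτ : 0 < τ) {h : ℝ → ℂ} (hh : ∀ r > 0, h r = A * (osc κ τ w r : ℂ))
    {r : ℝ} (hr : 0 < r) : besselOp κ h r = -(τ : ℂ) ^ 2 * h r := by
  have h0 : (r : ℂ) ≠ 0 := by exact_mod_cast hr.ne'
  have d0 : ∀ s > 0, HasDerivAt h (A * (oscDeriv κ τ w s : ℂ)) s := by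
    intro s hs
    refine ((hasDerivAt_osc w hτ hs).ofReal_comp.const_mul A).congr_of_eventuallyEq ?_
    filter_upwards [lt_mem_nhds hs] with t ht
    exact hh t ht
  have he : (fun s : ℝ => (s : ℂ) * deriv h s) =ᶠ[𝓝 r]
      fun s : ℝ => (s : ℂ) * (A * (oscDeriv κ τ w s : ℂ)) := by
    filter_upwards [lt_mem_nhds hr] with s hs
    rw [(d0 s hs).deriv]
  have d1 := ((hasDerivAt_id r).ofReal_comp).mul
    ((hasDerivAt_oscDeriv (κ := κ) w hτ hr).ofReal_comp.const_mul A)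
  have d2 : deriv (fun s : ℝ => (s : ℂ) * (A * (oscDeriv κ τ w s : ℂ))) r = _ := d1.deriv
  rw [besselOp, he.deriv_eq, d2, hh r hr]
  simp only [id]
  push_cast
  field_simp
  ring

lemma isEigenfunction_of_oscRobin_eq_zero (hκ : 0 < κ) (hγκ : IsGammaPhase κ γκ)
    (hζ : ContDiff ℝ ∞ ζ) (hζ1 : ∀ r < 1 / 3, ζ r = 1) (hζ0 : ∀ r > 2 / 3, ζ r = 0)
    (hδ : 0 < δ) (hτ : 0 < τ) (hτδ : 2 / 3 < τ * δ)
    (hR : oscRobin κ δ α τ (shiftFactor κ γ γκ τ) = 0) {A : ℂ} (hA : A ≠ 0) {h : ℝ → ℂ}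
    (hh : ∀ r > 0, h r = A * (osc κ τ (shiftFactor κ γ γκ τ) r : ℂ)) :
    IsEigenfunction κ γ δ α ζ τ h := by
  set w := shiftFactor κ γ γκ τ with hw
  set Z := cutSin κ γ ζ τ with hZ
  set a := amplitude κ with ha
  -- Where `τ r < 1/3` the cut-off is one, so `y` and its derivatives are `oscRem` and its
  -- derivatives, with the orders that membership in the weighted space requires.
  let y : ℝ → ℝ := fun r => osc κ τ w r - a * Z r
  let y1 : ℝ → ℝ := fun r => oscDeriv κ τ w r - a * deriv Z r
  let y2 : ℝ → ℝ := fun r => ((τ ^ 2 - κ ^ 2 / r ^ 2) * osc κ τ w r - oscDeriv κ τ w r / r)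
    - a * deriv (deriv Z) r
  have d0 : ∀ r > 0, HasDerivAt y (y1 r) r := fun r hr =>
    (hasDerivAt_osc w hτ hr).sub ((hasDerivAt_cutSin hζ hr).const_mul a)
  have d1 : ∀ r > 0, HasDerivAt y1 (y2 r) r := fun r hr =>
    (hasDerivAt_oscDeriv w hτ hr).sub ((((contDiffAt_deriv_cutSin hζ hr).differentiableAt
      (by simp)).hasDerivAt).const_mul a)
  have c2 : ContinuousOn y2 (Ioi 0) := by
    refine ContinuousOn.sub (((continuousOn_const.sub (continuousOn_const.div (continuousOn_id.pow 2)
      fun r hr => pow_ne_zero _ (ne_of_gt hr))).mul (continuousOn_osc w hτ)).sub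
      ((continuousOn_oscDeriv w hτ).div continuousOn_id fun r hr => ne_of_gt hr)) ?_
    intro r hr
    have : ContDiffAt ℝ ∞ (deriv (deriv Z)) r :=
      (contDiffAt_deriv_cutSin hζ hr).derivWithin (by simp)
    exact (continuousAt_const.mul this.continuousAt).continuousWithinAt
  have n0 : ∀ r > 0, τ * r < 1 / 3 → y r = oscRem κ τ w r := by
    intro r hr hlt
    simp only [y]
    rw [hZ, (cutSin_eventuallyEq hζ1 hlt).eq_of_nhds, osc_eq_leading_add hγκ hτ hr]
    ring
  have hnear : ∀ r > 0, τ * r < 1 / 3 → ∀ᶠ s in 𝓝 r, 0 < s ∧ τ * s < 1 / 3 := by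
    intro r hr hlt
    exact (lt_mem_nhds hr).and ((Continuous.tendsto (by fun_prop : Continuous fun s : ℝ => τ * s)
      r).eventually_lt_const hlt)
  have n1 : ∀ r > 0, τ * r < 1 / 3 → y1 r = oscRemDeriv κ τ w r := by
    intro r hr hlt
    refine (d0 r hr).unique ((hasDerivAt_oscRem w hτ hr).congr_of_eventuallyEq ?_)
    filter_upwards [hnear r hr hlt] with s hs
    exact n0 s hs.1 hs.2
  have n2 : ∀ r > 0, τ * r < 1 / 3 → y2 r = oscRemDeriv2 κ τ w r := by
    intro r hr hlt
    refine (d1 r hr).unique ((hasDerivAt_oscRemDeriv w hτ hr).congr_of_eventuallyEq ?_)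
    filter_upwards [hnear r hr hlt] with s hs
    exact n1 s hs.1 hs.2
  have hO : ∀ {f g e : ℝ → ℝ}, (∀ r > 0, τ * r < 1 / 3 → f r = g r) → g =O[𝓝[>] 0] e →
      (fun r => A * (f r : ℂ)) =O[𝓝[>] 0] e := by
    intro f g e hfg hg
    have h1 : f =O[𝓝[>] 0] e := by
      refine hg.congr' ?_ EventuallyEq.rfl
      filter_upwards [self_mem_nhdsWithin, eventually_mul_lt_third τ] with r hr hlt
      exact (hfg r hr hlt).symm
    refine Asymptotics.IsBigO.const_mul_left (Asymptotics.IsBigO.trans ?_ h1) A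
    exact Asymptotics.IsBigO.of_bound 1 (Eventually.of_forall fun r => by simp)
  have hV : MemV2 δ (fun r => A * (y r : ℂ)) (fun r => A * (y1 r : ℂ)) (fun r => A * (y2 r : ℂ)) :=
    memV2_of_isBigO (fun r hr => (d0 r hr).ofReal_comp.const_mul A)
      (fun r hr => (d1 r hr).ofReal_comp.const_mul A)
      (continuousOn_const.mul (Complex.continuous_ofReal.comp_continuousOn c2))
      (hO n0 (oscRem_isBigO κ w hτ)) (hO n1 (oscRemDeriv_isBigO κ w hτ))
      (hO n2 (oscRemDeriv2_isBigO κ w hτ))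
  refine ⟨⟨A * a, _, _, _, hV, ?_, ?_⟩, ?_, ?_⟩
  · have e := cutSin_eventuallyEq_zero (κ := κ) (γ := γ) hζ0 hτδ
    have e1 : Z δ = 0 := e.eq_of_nhds
    have e2 : deriv Z δ = 0 := by rw [hZ, e.deriv_eq, deriv_const]
    have e3 : (oscRobin κ δ α τ w : ℂ) = 0 := by exact_mod_cast hR
    simp only [y, y1, e1, e2]
    rw [oscRobin] at e3
    push_cast at e3 ⊢
    linear_combination A * e3
  · intro r hr
    have e : ((ζ (τ * r) * Real.sin (κ * Real.log (r / 2) + γ) : ℝ) : ℂ) = (Z r : ℂ) := rfl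
    rw [e, hh r hr.1]
    simp only [y]
    push_cast
    ring
  · obtain ⟨r, hr, hne⟩ := exists_osc_ne_zero hκ (shiftFactor_ne_zero κ γ γκ τ) hτ hδ
    refine ⟨r, hr, ?_⟩
    rw [hh r hr.1]
    exact mul_ne_zero hA (by exact_mod_cast hne)
  · rw [ae_restrict_iff' measurableSet_Ioo]
    exact Eventually.of_forall fun r hr => besselOp_osc hτ hh hr.1

/-- A sign argument; its one analytic input is that the boundary coefficient is nondecreasing at
`τ`, which makes the boundary term of the bracket have the wrong sign. -/
lemma not_isAssociated (hκ : 0 < κ) (hγκ : IsGammaPhase κ γκ)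
    (hζ : ContDiff ℝ ∞ ζ) (hζ1 : ∀ r < 1 / 3, ζ r = 1) (hζ0 : ∀ r > 2 / 3, ζ r = 0)
    (hδ : 0 < δ) (hτ : 0 < τ) (hτδ : 2 / 3 < τ * δ)
    (hm : 0 ≤ deriv (fun t : ℝ => t - α t⁻¹) τ)
    {h g : ℝ → ℂ} (hh : IsEigenfunction κ γ δ α ζ τ h) :
    ¬ IsAssociated κ γ δ α ζ τ h g := by
  rintro ⟨hdom, hode⟩
  obtain ⟨c, hc0, heq, hR⟩ := hh.eq_mul_osc (γκ := γκ) hκ hγκ hζ hζ1 hζ0 hδ hτ hτδ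
  set w := shiftFactor κ γ γκ τ with hw
  obtain ⟨g₁, g₂, hw1, hw2, hb, C, ρ, hρ, hρ0, ha, hb'⟩ :=
    MemDomainInhom.exists_derivs hζ hζ1 hζ0 hδ hτδ hdom
  have hsub : Ioc 0 δ ⊆ Ioi (0 : ℝ) := fun r hr => hr.1
  have hhc : ContinuousOn h (Ioc 0 δ) := by
    refine ContinuousOn.congr ?_ heq
    exact continuousOn_const.mul
      (Complex.continuous_ofReal.comp_continuousOn ((continuousOn_osc w hτ).mono hsub))
  obtain ⟨hd, hd1⟩ := hasDerivAt_of_besselOp (τ := τ) (F := fun r => 2 * (τ : ℂ) * h r) hw1 hw2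
    (continuousOn_const.mul hhc) hode
  have hlim := tendsto_bracket_shiftFactor (γ := γ) hγκ hτ (fun n => (hρ n).1) hρ0 ha hb'
  -- Dividing by `c` makes the derivative the real nonnegative function `2 τ r y²`; taking real
  -- parts discards a possible constant imaginary part before its limit is known.
  set V : ℝ → ℝ := fun r => (bracket κ τ w g g₁ r / c).re with hV
  have hVc : ContinuousOn V (Ioc 0 δ) := Complex.continuous_re.comp_continuousOn
    ((continuousOn_bracket hτ hw1.continuousOn hw2.continuousOn).div_const c)
  have hVd : ∀ r ∈ Ioo 0 δ, HasDerivAt V (2 * τ * r * osc κ τ w r ^ 2) r := by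
    intro r hr
    have h1 := (hasDerivAt_bracket (w := w) hτ hr.1 (hd r hr) (hd1 r hr)).div_const c
    have h2 := Complex.reCLM.hasFDerivAt.comp_hasDerivAt r h1
    refine h2.congr_deriv ?_
    rw [heq r ⟨hr.1, hr.2.le⟩, Complex.reCLM_apply]
    have : (r : ℂ) * (2 * τ * (c * (osc κ τ w r : ℂ))) * (osc κ τ w r : ℂ) / c =
        ((2 * τ * r * osc κ τ w r ^ 2 : ℝ) : ℂ) := by
      push_cast
      field_simp
    rw [this, Complex.ofReal_re]
  have hmono : MonotoneOn V (Ioc 0 δ) := by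
    refine monotoneOn_of_deriv_nonneg (convex_Ioc 0 δ) hVc ?_ ?_
    · rw [interior_Ioc]
      exact fun r hr => (hVd r hr).differentiableAt.differentiableWithinAt
    · rw [interior_Ioc]
      intro r hr
      rw [(hVd r hr).deriv]
      have := hr.1
      positivity
  have hVlim : Tendsto (fun n => V (ρ n)) atTop (𝓝 0) := by
    have h1 := hlim.div_const c
    rw [zero_div] at h1
    have h2 := (Complex.continuous_re.tendsto 0).comp h1
    rw [Complex.zero_re] at h2
    exact h2
  have hVnonneg : ∀ r ∈ Ioc 0 δ, 0 ≤ V r := by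
    intro r hr
    refine le_of_tendsto hVlim ?_
    have : ∀ᶠ n in atTop, ρ n < r :=
      (hρ0.mono_right nhdsWithin_le_nhds).eventually_lt_const hr.1
    filter_upwards [this] with n hn
    exact hmono ⟨(hρ n).1, (hρ n).2.le⟩ hr hn.le
  -- The Robin condition of the eigenfunction reduces the bracket at `δ` to the Robin expression of
  -- `g`, which is `-m' h(δ)`.
  have hVδ : V δ ≤ 0 := by
    set m' := deriv (fun t : ℝ => t - α t⁻¹) τ with hm'
    have e3 : (oscDeriv κ τ w δ : ℂ) = -((τ - α τ⁻¹ : ℝ) : ℂ) * (osc κ τ w δ : ℂ) := by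
      have : (oscRobin κ δ α τ w : ℂ) = 0 := by exact_mod_cast hR
      rw [oscRobin] at this
      push_cast at this ⊢
      linear_combination this
    have e4 : bracket κ τ w g g₁ δ / c = ((-(δ * m' * osc κ τ w δ ^ 2) : ℝ) : ℂ) := by
      have : bracket κ τ w g g₁ δ = (δ : ℂ) * (osc κ τ w δ : ℂ) *
          (g₁ δ + ((τ - α τ⁻¹ : ℝ) : ℂ) * g δ) := by
        rw [bracket, e3]
        ring
      rw [this, hb, heq δ ⟨hδ, le_rfl⟩]
      push_cast
      field_simp
    simp only [hV]
    rw [e4, Complex.ofReal_re]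
    have : 0 ≤ δ * m' * osc κ τ w δ ^ 2 := by positivity
    linarith
  have hVzero : ∀ r ∈ Ioc 0 δ, V r = 0 := fun r hr =>
    le_antisymm ((hmono hr ⟨hδ, le_rfl⟩ hr.2).trans hVδ) (hVnonneg r hr)
  obtain ⟨r, hr, hne⟩ := exists_osc_ne_zero hκ (shiftFactor_ne_zero κ γ γκ τ) hτ hδ
  have e5 : V =ᶠ[𝓝 r] fun _ => 0 := by
    filter_upwards [Ioo_mem_nhds hr.1 hr.2] with s hs
    exact hVzero s ⟨hs.1, hs.2.le⟩
  have e6 := (hVd r hr).deriv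
  rw [e5.deriv_eq, deriv_const] at e6
  have : 0 < 2 * τ * r * osc κ τ w r ^ 2 := by
    have := hr.1
    have : 0 < osc κ τ w r ^ 2 := by positivity
    positivity
  linarith

end Eigen

/-! ### The characteristic function -/

/-- The Robin expression of `r ↦ I_{iκ}(t r)`. -/
noncomputable def robinI (κ δ : ℝ) (α : ℝ → ℝ) (t : ℝ) : ℂ :=
  t * imIDeriv κ (t * δ) + ((t - α t⁻¹ : ℝ) : ℂ) * imI κ (t * δ)

/-- The quotient of the imaginary and the real part of `robinI`. -/
noncomputable def robinQuot (κ δ : ℝ) (α : ℝ → ℝ) (t : ℝ) : ℝ :=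
  (robinI κ δ α t).im / (robinI κ δ α t).re

lemma oscRobin_eq (κ δ : ℝ) (α : ℝ → ℝ) (t : ℝ) (w : ℂ) :
    oscRobin κ δ α t w = (w * robinI κ δ α t).im := by
  have : w * robinI κ δ α t = (t : ℂ) * (w * imIDeriv κ (t * δ)) +
      ((t - α t⁻¹ : ℝ) : ℂ) * (w * imI κ (t * δ)) := by
    rw [robinI]
    ring
  rw [this, Complex.add_im, Complex.im_ofReal_mul, Complex.im_ofReal_mul, oscRobin, osc, oscDeriv]

lemma robin_eq_oscRobin {κ δ t A : ℝ} {w : ℂ} (α : ℝ → ℝ) (hδ : 0 < δ) (ht : 0 < t) {h : ℝ → ℂ}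
    (hh : ∀ r > 0, h r = ((A * osc κ t w r : ℝ) : ℂ)) :
    robin δ α t h = ((A * oscRobin κ δ α t w : ℝ) : ℂ) := by
  have hd : HasDerivAt h ((A * oscDeriv κ t w δ : ℝ) : ℂ) δ := by
    refine (((hasDerivAt_osc w ht hδ).const_mul A).ofReal_comp).congr_of_eventuallyEq ?_
    filter_upwards [lt_mem_nhds hδ] with r hr
    exact hh r hr
  rw [robin, hd.deriv, hh δ hδ, oscRobin]
  push_cast
  ring

lemma Iim_eq_osc {κ t r : ℝ} (ht : 0 < t) (hr : 0 < r) :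
    Iim κ (t * r) = ((1 * osc κ t Complex.I r : ℝ) : ℂ) := by
  rw [Iim_eq κ (mul_pos ht hr), osc, one_mul, Complex.I_mul_im]

lemma Kim_eq_osc {κ t r : ℝ} (ht : 0 < t) (hr : 0 < r) :
    Kim κ (t * r) = ((-(Real.pi / Real.sinh (Real.pi * κ)) * osc κ t 1 r : ℝ) : ℂ) := by
  rw [Kim_eq κ (mul_pos ht hr), osc, one_mul]

lemma robin_Iim {κ δ t : ℝ} (α : ℝ → ℝ) (hδ : 0 < δ) (ht : 0 < t) :
    robin δ α t (fun r => Iim κ (t * r)) = ((robinI κ δ α t).re : ℂ) := by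
  rw [robin_eq_oscRobin α hδ ht (fun r hr => Iim_eq_osc ht hr), oscRobin_eq, one_mul,
    Complex.I_mul_im]

/-- Reduces the bound on `Q` to one on `robinQuot`. -/
lemma Q_eq {κ δ t : ℝ} (α : ℝ → ℝ) (hδ : 0 < δ) (ht : 0 < t) :
    Q κ δ α t = ((Real.pi / Real.sinh (Real.pi * κ) * robinQuot κ δ α t : ℝ) : ℂ) := by
  rw [Q, robin_Iim α hδ ht, robin_eq_oscRobin α hδ ht (fun r hr => Kim_eq_osc ht hr),
    oscRobin_eq, one_mul, robinQuot]
  push_cast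
  ring

lemma hasDerivAt_comp_mul_right {f : ℝ → ℂ} {f' : ℂ} {t δ : ℝ} (h : HasDerivAt f f' (t * δ)) :
    HasDerivAt (fun t => f (t * δ)) (δ * f') t := by
  have h1 : HasDerivAt (fun t : ℝ => t * δ) δ t := by simpa using (hasDerivAt_id t).mul_const δ
  refine (h.scomp t h1).congr_deriv ?_
  simp

lemma hasDerivAt_robinI {κ δ t m' : ℝ} {α : ℝ → ℝ} (hδ : 0 < δ) (ht : 0 < t)
    (hm : HasDerivAt (fun t : ℝ => t - α t⁻¹) m' t) :
    HasDerivAt (robinI κ δ α) ((((t - α t⁻¹) * δ : ℝ) : ℂ) * imIDeriv κ (t * δ) +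
      ((m' + t * δ - κ ^ 2 / (t * δ) : ℝ) : ℂ) * imI κ (t * δ)) t := by
  have hx := mul_pos ht hδ
  have h1 := ((hasDerivAt_id t).ofReal_comp).mul
    (hasDerivAt_comp_mul_right (hasDerivAt_imIDeriv κ hx))
  have h2 := hm.ofReal_comp.mul (hasDerivAt_comp_mul_right (hasDerivAt_imI κ hx))
  have ht' : (t : ℂ) ≠ 0 := by exact_mod_cast ht.ne'
  have hδ' : (δ : ℂ) ≠ 0 := by exact_mod_cast hδ.ne'
  refine (h1.add h2).congr_deriv ?_
  simp only [id]
  push_cast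
  field_simp
  ring

/-- The derivative of `robinQuot`. -/
lemma hasDerivAt_robinQuot {κ δ t m' : ℝ} {α : ℝ → ℝ} (hδ : 0 < δ) (ht : 0 < t)
    (hm : HasDerivAt (fun t : ℝ => t - α t⁻¹) m' t) (hre : (robinI κ δ α t).re ≠ 0) :
    HasDerivAt (robinQuot κ δ α)
      (κ / ‖Complex.Gamma (1 + κ * Complex.I)‖ ^ 2 / (t * δ) *
        ((t - α t⁻¹) ^ 2 * δ - t * (m' + t * δ - κ ^ 2 / (t * δ))) /
          (robinI κ δ α t).re ^ 2) t := by
  have hx := mul_pos ht hδ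
  have h := hasDerivAt_robinI (κ := κ) hδ ht hm
  have hi := Complex.imCLM.hasFDerivAt.comp_hasDerivAt t h
  have hr := Complex.reCLM.hasFDerivAt.comp_hasDerivAt t h
  refine (hi.div hr hre).congr_deriv ?_
  simp only [Function.comp, Complex.imCLM_apply, Complex.reCLM_apply]
  congr 1
  -- Both `R` and `R'` are real combinations of `I` and `I'`, so the numerator of the quotient rule
  -- is the Wronskian times the determinant of the coefficients.
  rw [← wronskian_imI κ hx, mul_div_cancel_left₀ _ hx.ne', robinI]
  generalize m' + t * δ - κ ^ 2 / (t * δ) = b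
  generalize t - α t⁻¹ = m
  simp only [Complex.add_re, Complex.add_im, Complex.mul_re, Complex.mul_im,
    Complex.ofReal_re, Complex.ofReal_im, Complex.conj_re, Complex.conj_im]
  ring

/-! ### The Robin expression for large parameter -/

lemma eventually_boundary_coeff {α : ℝ → ℝ} (hα : ∃ U ∈ 𝓝 (0 : ℝ), ContDiffOn ℝ ∞ α U) :
    ∃ A : ℝ, ∀ᶠ t : ℝ in atTop, |α t⁻¹| ≤ A ∧
      HasDerivAt (fun t : ℝ => t - α t⁻¹) (deriv (fun t : ℝ => t - α t⁻¹) t) t ∧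
      0 ≤ deriv (fun t : ℝ => t - α t⁻¹) t ∧ deriv (fun t : ℝ => t - α t⁻¹) t ≤ 2 := by
  obtain ⟨U, hU, hα⟩ := hα
  have hc : ContDiffAt ℝ ∞ α 0 := hα.contDiffAt hU
  have hinv : Tendsto (fun t : ℝ => t⁻¹) atTop (𝓝 0) := tendsto_inv_atTop_zero
  have h1 : Tendsto (fun t : ℝ => |α t⁻¹|) atTop (𝓝 |α 0|) :=
    (hc.continuousAt.tendsto.comp hinv).abs
  have hd : ∀ᶠ x in 𝓝 (0 : ℝ), DifferentiableAt ℝ α x := by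
    have : ContDiffAt ℝ 1 α 0 := hc.of_le (by exact_mod_cast le_top)
    filter_upwards [this.eventually (by simp)] with x hx
    exact hx.differentiableAt (by simp)
  have hc1 : ContDiffAt ℝ ∞ (deriv α) 0 := hc.derivWithin (by simp)
  have h2 : Tendsto (fun t : ℝ => deriv α t⁻¹ * (t⁻¹) ^ 2) atTop (𝓝 0) := by
    simpa using (hc1.continuousAt.tendsto.comp hinv).mul (hinv.pow 2)
  refine ⟨|α 0| + 1, ?_⟩
  filter_upwards [h1.eventually_lt_const (lt_add_one _), hinv.eventually hd,
    h2.eventually_lt_const zero_lt_one, h2.eventually_const_lt (neg_lt_zero.2 zero_lt_one),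
    eventually_gt_atTop 0] with t a1 a2 a3 a4 a5
  have hD : HasDerivAt (fun t : ℝ => t - α t⁻¹) (1 + deriv α t⁻¹ * (t⁻¹) ^ 2) t := by
    have := (hasDerivAt_id t).sub (a2.hasDerivAt.comp t (hasDerivAt_inv a5.ne'))
    refine this.congr_deriv ?_
    field_simp
    ring
  rw [hD.deriv]
  exact ⟨a1.le, hD, by linarith, by linarith⟩

/-- After division by `t I_0(tδ)` the terms with `I'` and with `I` each tend to one. That the limit
is real and positive makes `robinQuot` vanish at infinity and keeps its denominator away from zero.
-/
lemma tendsto_robinI {κ δ : ℝ} {α : ℝ → ℝ} (hκ : 0 < κ) (hδ : 0 < δ)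
    (hα : ∃ U ∈ 𝓝 (0 : ℝ), ContDiffOn ℝ ∞ α U) :
    Tendsto (fun t : ℝ => robinI κ δ α t / ((t * besselZero (t * δ) : ℝ) : ℂ)) atTop (𝓝 2) := by
  have hx : Tendsto (fun t : ℝ => t * δ) atTop atTop := tendsto_id.atTop_mul_const hδ
  have h1 := (tendsto_imI_div_besselZero hκ).comp hx
  have h2 := (tendsto_imIDeriv_div_besselZero hκ).comp hx
  obtain ⟨U, hU, hα⟩ := hα
  have hc : ContinuousAt α 0 := (hα.contDiffAt hU).continuousAt
  have hinv : Tendsto (fun t : ℝ => t⁻¹) atTop (𝓝 0) := tendsto_inv_atTop_zero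
  have h3 : Tendsto (fun t : ℝ => 1 - α t⁻¹ * t⁻¹) atTop (𝓝 1) := by
    simpa using (hc.tendsto.comp hinv).mul hinv |>.const_sub 1
  have h4 : Tendsto (fun t : ℝ => ((1 - α t⁻¹ * t⁻¹ : ℝ) : ℂ)) atTop (𝓝 1) :=
    (Complex.continuous_ofReal.tendsto' 1 1 (by simp)).comp h3
  have h5 := h2.add (h4.mul h1)
  rw [show (1 : ℂ) + 1 * 1 = 2 by norm_num] at h5
  refine h5.congr' ?_
  filter_upwards [eventually_gt_atTop 0] with t ht
  have ht' : (t : ℂ) ≠ 0 := by exact_mod_cast ht.ne'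
  have hb : (besselZero (t * δ) : ℂ) ≠ 0 := by exact_mod_cast (besselZero_pos _).ne'
  simp only [Function.comp, robinI]
  push_cast
  field_simp

lemma tendsto_robinQuot {κ δ : ℝ} {α : ℝ → ℝ} (hκ : 0 < κ) (hδ : 0 < δ)
    (hα : ∃ U ∈ 𝓝 (0 : ℝ), ContDiffOn ℝ ∞ α U) :
    Tendsto (robinQuot κ δ α) atTop (𝓝 0) := by
  have h := tendsto_robinI hκ hδ hα
  have hi := (Complex.continuous_im.tendsto 2).comp h
  have hr := (Complex.continuous_re.tendsto 2).comp h
  have h2 := hi.div hr (by simp)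
  simp only [Complex.im_ofNat, Complex.re_ofNat, zero_div] at h2
  refine h2.congr' ?_
  filter_upwards [eventually_gt_atTop 0] with t ht
  have hb : 0 < t * besselZero (t * δ) := mul_pos ht (besselZero_pos _)
  simp only [Pi.div_apply, Function.comp, Complex.div_ofReal_im, Complex.div_ofReal_re, robinQuot]
  rw [div_div_div_cancel_right₀ hb.ne']

lemma eventually_re_robinI {κ δ : ℝ} {α : ℝ → ℝ} (hκ : 0 < κ) (hδ : 0 < δ)
    (hα : ∃ U ∈ 𝓝 (0 : ℝ), ContDiffOn ℝ ∞ α U) :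
    ∀ᶠ t : ℝ in atTop, t * besselZero (t * δ) ≤ (robinI κ δ α t).re := by
  have h := (Complex.continuous_re.tendsto 2).comp (tendsto_robinI hκ hδ hα)
  have h1 : (1 : ℝ) < Complex.re 2 := by simp
  filter_upwards [h.eventually_const_lt h1, eventually_gt_atTop 0] with t h2 ht
  have hb : 0 < t * besselZero (t * δ) := mul_pos ht (besselZero_pos _)
  simp only [Function.comp, Complex.div_ofReal_re] at h2
  rw [lt_div_iff₀ hb, one_mul] at h2
  exact h2.le

/-- Squaring `e^x/2 ≤ cosh x ≤ √(2x+1) I_0(x)` and using `2x + 1 ≤ 3x`; hence `12 = 4 · 3`. -/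
lemma inv_sq_besselZero_le {x : ℝ} (hx : 1 ≤ x) :
    1 / besselZero x ^ 2 ≤ 12 * x * Real.exp (-2 * x) := by
  have hx0 : 0 < x := by linarith
  have h1 := cosh_le_sqrt_mul_besselZero hx0
  have h2 : Real.exp x / 2 ≤ Real.cosh x := by
    rw [Real.cosh_eq]
    have := Real.exp_pos (-x)
    linarith
  have h3 : (Real.exp x / 2) ^ 2 ≤ (Real.sqrt (2 * x + 1) * besselZero x) ^ 2 := by
    have := h2.trans h1
    gcongr
  rw [mul_pow, Real.sq_sqrt (by positivity)] at h3
  have hb := besselZero_pos x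
  rw [div_le_iff₀ (by positivity)]
  have e : Real.exp (-2 * x) * (Real.exp x / 2) ^ 2 = 1 / 4 := by
    rw [div_pow, ← Real.exp_nat_mul, ← mul_div_assoc, ← Real.exp_add]
    norm_num
  have h4 : (1 : ℝ) / 4 ≤ Real.exp (-2 * x) * ((2 * x + 1) * besselZero x ^ 2) := by
    rw [← e]
    gcongr
  have h5 : (2 * x + 1) * besselZero x ^ 2 ≤ 3 * x * besselZero x ^ 2 := by
    gcongr
    linarith
  have h6 : Real.exp (-2 * x) * ((2 * x + 1) * besselZero x ^ 2) ≤
      Real.exp (-2 * x) * (3 * x * besselZero x ^ 2) := by gcongr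
  linarith

/-- The derivative of `robinQuot` is exponentially small. -/
lemma exists_deriv_robinQuot_le {κ δ : ℝ} {α : ℝ → ℝ} (hκ : 0 < κ) (hδ : 0 < δ)
    (hα : ∃ U ∈ 𝓝 (0 : ℝ), ContDiffOn ℝ ∞ α U) :
    ∃ K : ℝ, 0 ≤ K ∧ ∀ᶠ t : ℝ in atTop,
      HasDerivAt (robinQuot κ δ α) (deriv (robinQuot κ δ α) t) t ∧
      |deriv (robinQuot κ δ α) t| ≤ K * (t⁻¹ * Real.exp (-2 * δ * t)) := by
  obtain ⟨A, hA⟩ := eventually_boundary_coeff hα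
  set σ := κ / ‖Complex.Gamma (1 + κ * Complex.I)‖ ^ 2 with hσ
  have hσ0 : 0 ≤ σ := by positivity
  set A' := |A| with hA'
  set M := δ * A' ^ 2 + 2 * δ * A' + 2 + κ ^ 2 / δ with hM
  have hM0 : 0 ≤ M := by positivity
  refine ⟨12 * σ * M, by positivity, ?_⟩
  have hx : Tendsto (fun t : ℝ => t * δ) atTop atTop := tendsto_id.atTop_mul_const hδ
  filter_upwards [hA, eventually_re_robinI hκ hδ hα, eventually_ge_atTop 1,
    hx.eventually_ge_atTop 1] with t ⟨a1, a2, a3, a4⟩ hre ht1 hx1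
  have ht : 0 < t := by linarith
  have hb := besselZero_pos (t * δ)
  have hpos : 0 < t * besselZero (t * δ) := mul_pos ht hb
  have hre0 : 0 < (robinI κ δ α t).re := hpos.trans_le hre
  have hd := hasDerivAt_robinQuot (κ := κ) hδ ht a2 hre0.ne'
  rw [hd.deriv]
  refine ⟨hd, ?_⟩
  set m' := deriv (fun t : ℝ => t - α t⁻¹) t with hm'
  -- The terms `t² δ` cancel, so the numerator is only `O(t)`. This produces the factor `t⁻¹` in the
  -- estimate, which later absorbs all constants depending on `δ`.
  have hnum : |(t - α t⁻¹) ^ 2 * δ - t * (m' + t * δ - κ ^ 2 / (t * δ))| ≤ M * t := by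
    have e : (t - α t⁻¹) ^ 2 * δ - t * (m' + t * δ - κ ^ 2 / (t * δ)) =
        δ * α t⁻¹ ^ 2 - 2 * δ * t * α t⁻¹ - t * m' + κ ^ 2 / δ := by
      field_simp
      ring
    rw [e]
    have b1 : |α t⁻¹| ≤ A' := a1.trans (le_abs_self A)
    have b2 : α t⁻¹ ^ 2 ≤ A' ^ 2 := by
      rw [← sq_abs]
      gcongr
    have b3 := abs_le.1 b1
    have c1 : δ * α t⁻¹ ^ 2 ≤ δ * A' ^ 2 * t := by
      have : δ * α t⁻¹ ^ 2 ≤ δ * A' ^ 2 := by gcongr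
      nlinarith [mul_nonneg hδ.le (sq_nonneg A')]
    have c2 : |2 * δ * t * α t⁻¹| ≤ 2 * δ * A' * t := by
      rw [abs_mul, abs_of_pos (by positivity : 0 < 2 * δ * t)]
      nlinarith [mul_le_mul_of_nonneg_left b1 (by positivity : 0 ≤ 2 * δ * t)]
    have c3 := abs_le.1 c2
    have c4 : t * m' ≤ 2 * t := by nlinarith
    have c5 : 0 ≤ t * m' := by positivity
    have c6 : κ ^ 2 / δ ≤ κ ^ 2 / δ * t := le_mul_of_one_le_right (by positivity) ht1
    have c7 : 0 ≤ κ ^ 2 / δ := by positivity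
    have c8 : 0 ≤ δ * α t⁻¹ ^ 2 := by positivity
    have c9 : 0 ≤ δ * A' ^ 2 * t := by positivity
    have eM : M * t = δ * A' ^ 2 * t + 2 * δ * A' * t + 2 * t + κ ^ 2 / δ * t := by
      rw [hM]
      ring
    rw [eM, abs_le]
    constructor <;> linarith [c3.1, c3.2]
  have hden : 1 / (robinI κ δ α t).re ^ 2 ≤ 12 * (t * δ) * Real.exp (-2 * (t * δ)) / t ^ 2 := by
    have h1 : 1 / (robinI κ δ α t).re ^ 2 ≤ 1 / (t * besselZero (t * δ)) ^ 2 := by gcongr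
    refine h1.trans ?_
    rw [mul_pow, mul_comm (t ^ 2), ← div_div]
    have := inv_sq_besselZero_le hx1
    gcongr
  rw [div_eq_mul_one_div, abs_mul, abs_mul, abs_of_nonneg (by positivity : 0 ≤ σ / (t * δ)),
    abs_of_nonneg (by positivity : 0 ≤ 1 / (robinI κ δ α t).re ^ 2)]
  calc σ / (t * δ) * |(t - α t⁻¹) ^ 2 * δ - t * (m' + t * δ - κ ^ 2 / (t * δ))| *
        (1 / (robinI κ δ α t).re ^ 2)
      ≤ σ / (t * δ) * (M * t) * (12 * (t * δ) * Real.exp (-2 * (t * δ)) / t ^ 2) := by gcongr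
    _ = 12 * σ * M * (t⁻¹ * Real.exp (-2 * δ * t)) := by
      rw [show -2 * (t * δ) = -2 * δ * t by ring]
      field_simp

/-- Integration from infinity without an integral: adding the barrier `e`, whose derivative is at
most `-|f'|`, gives a decreasing function with limit zero, hence a nonnegative one. Applied to `f`
and `-f` it bounds `|f|`. -/
lemma le_of_hasDerivAt_of_tendsto_zero {f f' : ℝ → ℝ} {δ K t₀ : ℝ} (hδ : 0 < δ) (hK : 0 ≤ K)
    (ht₀ : 0 < t₀) (hf : ∀ t ≥ t₀, HasDerivAt f (f' t) t)
    (hb : ∀ t ≥ t₀, |f' t| ≤ K * (t⁻¹ * Real.exp (-2 * δ * t))) (hlim : Tendsto f atTop (𝓝 0))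
    {t : ℝ} (ht : t₀ ≤ t) : -(K / (2 * δ) * (t⁻¹ * Real.exp (-2 * δ * t))) ≤ f t := by
  set e : ℝ → ℝ := fun t => K / (2 * δ) * (t⁻¹ * Real.exp (-2 * δ * t)) with he
  have hed : ∀ t > 0, HasDerivAt e (K / (2 * δ) * (-(t ^ 2)⁻¹ * Real.exp (-2 * δ * t) +
      t⁻¹ * (Real.exp (-2 * δ * t) * (-2 * δ)))) t := by
    intro t ht
    have h1 : HasDerivAt (fun t : ℝ => -2 * δ * t) (-2 * δ) t := by
      simpa using (hasDerivAt_id t).const_mul (-2 * δ)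
    exact ((hasDerivAt_inv ht.ne').mul h1.exp).const_mul _
  have hanti : AntitoneOn (fun t => f t + e t) (Ici t₀) := by
    refine antitoneOn_of_deriv_nonpos (convex_Ici t₀) ?_ ?_ ?_
    · exact fun t ht => ((hf t ht).add (hed t (ht₀.trans_le ht))).continuousAt.continuousWithinAt
    · rw [interior_Ici]
      exact fun t ht => ((hf t (le_of_lt ht)).add
        (hed t (ht₀.trans ht))).differentiableAt.differentiableWithinAt
    · rw [interior_Ici]
      intro t ht
      have ht0 : 0 < t := ht₀.trans ht
      have hD : deriv (fun t => f t + e t) t = _ :=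
        ((hf t (le_of_lt ht)).add (hed t ht0)).deriv
      rw [hD]
      have h1 := (abs_le.1 (hb t (le_of_lt ht))).2
      have h2 : K / (2 * δ) * (-(t ^ 2)⁻¹ * Real.exp (-2 * δ * t) +
          t⁻¹ * (Real.exp (-2 * δ * t) * (-2 * δ))) =
          -(K * (t⁻¹ * Real.exp (-2 * δ * t))) -
            K / (2 * δ) * ((t ^ 2)⁻¹ * Real.exp (-2 * δ * t)) := by
        field_simp
        ring
      have h3 : 0 ≤ K / (2 * δ) * ((t ^ 2)⁻¹ * Real.exp (-2 * δ * t)) := by positivity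
      rw [h2]
      linarith
  have helim : Tendsto e atTop (𝓝 0) := by
    have h1 : Tendsto (fun t : ℝ => K / (2 * δ) * t⁻¹) atTop (𝓝 0) := by
      simpa using tendsto_inv_atTop_zero.const_mul (K / (2 * δ))
    refine squeeze_zero' ?_ ?_ h1
    · filter_upwards [eventually_gt_atTop 0] with t ht
      positivity
    · filter_upwards [eventually_gt_atTop 0] with t ht
      have : Real.exp (-2 * δ * t) ≤ 1 := Real.exp_le_one_iff.2 (by nlinarith)
      have h2 : t⁻¹ * Real.exp (-2 * δ * t) ≤ t⁻¹ * 1 := by gcongr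
      have : 0 ≤ K / (2 * δ) := by positivity
      simp only [he]
      nlinarith
  have hsum := hlim.add helim
  rw [add_zero] at hsum
  have : 0 ≤ f t + e t := by
    refine le_of_tendsto hsum ?_
    filter_upwards [eventually_ge_atTop t] with s hs
    exact hanti ht (ht.trans hs) hs
  have h4 : e t = K / (2 * δ) * (t⁻¹ * Real.exp (-2 * δ * t)) := rfl
  linarith

/-! ### The phase equation for the eigenvalues -/

/-- The phase function whose values in `πℤ` determine the eigenvalues. -/
noncomputable def charPhase (κ γ γκ δ : ℝ) (α : ℝ → ℝ) (t : ℝ) : ℝ :=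
  phaseShift κ γ γκ t - Real.arctan (robinQuot κ δ α t)

lemma shiftFactor_mul_im (κ γ γκ t : ℝ) (z : ℂ) :
    (shiftFactor κ γ γκ t * z).im =
      Real.cos (phaseShift κ γ γκ t) * z.im - Real.sin (phaseShift κ γ γκ t) * z.re := by
  rw [shiftFactor, Complex.mul_im, Complex.exp_ofReal_mul_I_re, Complex.exp_ofReal_mul_I_im,
    Real.cos_neg, Real.sin_neg]
  ring

lemma sin_sub_arctan (s x : ℝ) :
    Real.sin (s - Real.arctan x) = Real.cos (Real.arctan x) * (Real.sin s - x * Real.cos s) := by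
  have h : Real.sin (Real.arctan x) = x * Real.cos (Real.arctan x) := by
    rw [Real.sin_arctan, Real.cos_arctan]
    ring
  rw [Real.sin_sub, h]
  ring

section CharPhase

variable {κ γ γκ δ t : ℝ} {α ζ : ℝ → ℝ}

lemma sin_phaseShift_eq {k : ℤ} (hk : charPhase κ γ γκ δ α t = k * Real.pi) :
    Real.sin (phaseShift κ γ γκ t) = robinQuot κ δ α t * Real.cos (phaseShift κ γ γκ t) := by
  have h := sin_sub_arctan (phaseShift κ γ γκ t) (robinQuot κ δ α t)
  rw [← charPhase.eq_def κ γ γκ δ α t, hk, Real.sin_int_mul_pi, eq_comm, mul_eq_zero] at h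
  have := h.resolve_left (Real.cos_arctan_pos _).ne'
  linarith

/-- The Robin expression is the sine of `charPhase` times nonzero factors, by `sin_sub_arctan`. -/
lemma oscRobin_eq_zero_iff (hre : (robinI κ δ α t).re ≠ 0) :
    oscRobin κ δ α t (shiftFactor κ γ γκ t) = 0 ↔
      ∃ k : ℤ, charPhase κ γ γκ δ α t = k * Real.pi := by
  have e : oscRobin κ δ α t (shiftFactor κ γ γκ t) = -((robinI κ δ α t).re *
      (Real.sin (phaseShift κ γ γκ t) - robinQuot κ δ α t * Real.cos (phaseShift κ γ γκ t))) := by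
    rw [oscRobin_eq, shiftFactor_mul_im, robinQuot]
    field_simp
    ring
  rw [e, neg_eq_zero]
  constructor
  · intro h
    have h0 := (mul_eq_zero.1 h).resolve_left hre
    have h1 : Real.sin (charPhase κ γ γκ δ α t) = 0 := by
      rw [charPhase, sin_sub_arctan, h0, mul_zero]
    obtain ⟨k, hk⟩ := Real.sin_eq_zero_iff.1 h1
    exact ⟨k, hk.symm⟩
  · rintro ⟨k, hk⟩
    rw [sin_phaseShift_eq hk, sub_self, mul_zero]

/-- At a root `sin s = q cos s` with `cos s ≠ 0`, so the combination of `K` and `Re I` with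
coefficient `Q` becomes a multiple of `cos s · Im I - sin s · Re I`. -/
lemma exists_Phi_eq (hκ : 0 < κ) (hδ : 0 < δ) (ht : 0 < t) {k : ℤ}
    (hk : charPhase κ γ γκ δ α t = k * Real.pi) :
    ∃ A : ℂ, A ≠ 0 ∧ ∀ r > 0, Phi κ δ α t r = A * (osc κ t (shiftFactor κ γ γκ t) r : ℂ) := by
  have hs := sin_phaseShift_eq hk
  set s := phaseShift κ γ γκ t with hsd
  have hc : Real.cos s ≠ 0 := by
    intro h0
    rw [h0, mul_zero] at hs
    have := Real.sin_sq_add_cos_sq s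
    rw [h0, hs] at this
    norm_num at this
  have hp : 0 < Real.pi / Real.sinh (Real.pi * κ) :=
    div_pos Real.pi_pos (sinh_pi_mul_pos hκ)
  set p := Real.pi / Real.sinh (Real.pi * κ) with hpd
  refine ⟨((-(p / Real.cos s) : ℝ) : ℂ), ?_, fun r hr => ?_⟩
  · have : -(p / Real.cos s) ≠ 0 := neg_ne_zero.2 (div_ne_zero hp.ne' hc)
    exact_mod_cast this
  · rw [Phi, Q_eq α hδ ht, Iim_eq κ (mul_pos ht hr), Kim_eq κ (mul_pos ht hr), osc,
      shiftFactor_mul_im, ← hsd, hs, ← hpd]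
    norm_cast
    field_simp
    ring

lemma isEigenvalue_iff (hκ : 0 < κ) (hγκ : IsGammaPhase κ γκ)
    (hζ : ContDiff ℝ ∞ ζ) (hζ1 : ∀ r < 1 / 3, ζ r = 1) (hζ0 : ∀ r > 2 / 3, ζ r = 0)
    (hδ : 0 < δ) (ht : 0 < t) (htδ : 2 / 3 < t * δ) (hre : (robinI κ δ α t).re ≠ 0) :
    IsEigenvalue κ γ δ α ζ t ↔ ∃ k : ℤ, charPhase κ γ γκ δ α t = k * Real.pi := by
  rw [← oscRobin_eq_zero_iff hre]
  constructor
  · rintro ⟨h, hh⟩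
    obtain ⟨c, -, -, hR⟩ := hh.eq_mul_osc (γκ := γκ) hκ hγκ hζ hζ1 hζ0 hδ ht htδ
    exact hR
  · intro hR
    exact ⟨_, isEigenfunction_of_oscRobin_eq_zero hκ hγκ hζ hζ1 hζ0 hδ ht htδ hR one_ne_zero
      (h := fun r => 1 * (osc κ t (shiftFactor κ γ γκ t) r : ℂ)) fun r _ => rfl⟩

lemma isEigenfunction_Phi (hκ : 0 < κ) (hγκ : IsGammaPhase κ γκ)
    (hζ : ContDiff ℝ ∞ ζ) (hζ1 : ∀ r < 1 / 3, ζ r = 1) (hζ0 : ∀ r > 2 / 3, ζ r = 0)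
    (hδ : 0 < δ) (ht : 0 < t) (htδ : 2 / 3 < t * δ) (hre : (robinI κ δ α t).re ≠ 0) {k : ℤ}
    (hk : charPhase κ γ γκ δ α t = k * Real.pi) :
    IsEigenfunction κ γ δ α ζ t (Phi κ δ α t) := by
  obtain ⟨A, hA, hPhi⟩ := exists_Phi_eq hκ hδ ht hk
  exact isEigenfunction_of_oscRobin_eq_zero hκ hγκ hζ hζ1 hζ0 hδ ht htδ
    ((oscRobin_eq_zero_iff hre).2 ⟨k, hk⟩) hA hPhi

lemma isSimpleEigenvalue_of_isEigenfunction (hκ : 0 < κ) (hγκ : IsGammaPhase κ γκ)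
    (hζ : ContDiff ℝ ∞ ζ) (hζ1 : ∀ r < 1 / 3, ζ r = 1) (hζ0 : ∀ r > 2 / 3, ζ r = 0)
    (hδ : 0 < δ) (ht : 0 < t) (htδ : 2 / 3 < t * δ)
    (hm : 0 ≤ deriv (fun t : ℝ => t - α t⁻¹) t) {φ : ℝ → ℂ}
    (hφ : IsEigenfunction κ γ δ α ζ t φ) : IsSimpleEigenvalue κ γ δ α ζ t := by
  refine ⟨⟨φ, hφ, fun h hh => ?_⟩, fun h hh => ?_⟩
  · obtain ⟨c, hc, hφc, -⟩ := hφ.eq_mul_osc (γκ := γκ) hκ hγκ hζ hζ1 hζ0 hδ ht htδ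
    obtain ⟨c', -, hhc, -⟩ := hh.eq_mul_osc (γκ := γκ) hκ hγκ hζ hζ1 hζ0 hδ ht htδ
    refine ⟨c' / c, fun r hr => ?_⟩
    rw [hφc r hr, hhc r hr]
    field_simp
  · rintro ⟨g, hg⟩
    exact not_isAssociated hκ hγκ hζ hζ1 hζ0 hδ ht htδ hm hh hg

end CharPhase

/-! ### Enumeration of the roots and error estimates -/

lemma exists_seq_eq_int_mul_pi {G : ℝ → ℝ} {t₀ : ℝ} (hmono : StrictMonoOn G (Ici t₀))
    (hc : ContinuousOn G (Ici t₀)) (hlim : Tendsto G atTop atTop) :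
    ∃ (k₀ : ℤ) (τ : ℤ → ℝ), StrictMonoOn τ (Ici k₀) ∧
      (∀ k ≥ k₀, t₀ ≤ τ k ∧ G (τ k) = k * Real.pi) ∧
      ∀ t ≥ τ k₀, (∃ k : ℤ, G t = k * Real.pi) → ∃ k ≥ k₀, τ k = t := by
  set k₀ : ℤ := ⌈G t₀ / Real.pi⌉ with hk₀
  -- For `k < k₀` the value of the sequence is irrelevant; zero is taken.
  have hex : ∀ k : ℤ, ∃ t, k₀ ≤ k → t₀ ≤ t ∧ G t = k * Real.pi := by
    intro k
    by_cases hk : k₀ ≤ k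
    · have h1 : G t₀ ≤ k * Real.pi := by
        rw [← div_le_iff₀ Real.pi_pos]
        exact (Int.le_ceil _).trans (by exact_mod_cast hk)
      obtain ⟨t₁, ht₁, h2⟩ := ((eventually_ge_atTop t₀).and
        (hlim.eventually_ge_atTop (k * Real.pi))).exists
      obtain ⟨t, ht, hG⟩ := intermediate_value_Icc ht₁ (hc.mono Icc_subset_Ici_self) ⟨h1, h2⟩
      exact ⟨t, fun _ => ⟨ht.1, hG⟩⟩
    · exact ⟨0, fun h => absurd h hk⟩
  choose τ hτ using hex
  have hpi := Real.pi_pos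
  refine ⟨k₀, τ, fun k hk l hl hkl => ?_, fun k hk => hτ k hk, fun t ht ⟨k, hk⟩ => ?_⟩
  · rw [← hmono.lt_iff_lt (hτ k hk).1 (hτ l hl).1, (hτ k hk).2, (hτ l hl).2]
    have : (k : ℝ) < l := by exact_mod_cast hkl
    gcongr
  · have ht₀ : t₀ ≤ t := (hτ k₀ le_rfl).1.trans ht
    have h1 := hmono.monotoneOn (hτ k₀ le_rfl).1 ht₀ ht
    rw [(hτ k₀ le_rfl).2, hk] at h1
    have h2 : k₀ ≤ k := by exact_mod_cast le_of_mul_le_mul_right h1 hpi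
    exact ⟨k, h2, hmono.injOn (hτ k h2).1 ht₀ ((hτ k h2).2.trans hk.symm)⟩

lemma abs_arctan_le (x : ℝ) : |Real.arctan x| ≤ |x| := by
  have h : ∀ y : ℝ, 0 ≤ y → Real.arctan y ≤ y := fun y hy => by
    have := Real.le_tan (Real.arctan_nonneg.2 hy) (Real.arctan_lt_pi_div_two y)
    rwa [Real.tan_arctan] at this
  rcases le_total 0 x with hx | hx
  · rw [abs_of_nonneg (Real.arctan_nonneg.2 hx), abs_of_nonneg hx]
    exact h x hx
  · have h1 := h (-x) (by linarith)
    rw [Real.arctan_neg] at h1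
    rw [abs_of_nonpos (Real.arctan_le_zero.2 hx), abs_of_nonpos hx]
    exact h1

/-- Exponential closeness of `t` to its leading term, measured on either side. -/
lemma abs_div_sub_one_le {κ δ L t l η : ℝ} (hκ : 0 < κ) (hδ : 0 < δ) (ht : 0 < t) (hL : 0 ≤ L)
    (hl : 0 < l) (htl : t = l * Real.exp η) (hη : |η| ≤ L / κ * (t⁻¹ * Real.exp (-2 * δ * t)))
    (h1 : L ≤ t) (h2 : L ≤ κ * t) (h3 : 4 * δ * L / κ * Real.exp (-2 * δ * t) ≤ 1) :
    |t / l - 1| ≤ 6 / κ * Real.exp (-2 * δ * t) ∧ |t / l - 1| ≤ 6 / κ * Real.exp (-2 * δ * l) := by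
  have hexp : Real.exp (-2 * δ * t) ≤ 1 := Real.exp_le_one_iff.2 (by nlinarith [mul_pos hδ ht])
  have hE := Real.exp_pos (-2 * δ * t)
  have hη1 : |η| ≤ 1 := by
    refine hη.trans ?_
    have : L / κ * t⁻¹ ≤ 1 := by
      rw [← div_eq_mul_inv, div_div, div_le_one (by positivity)]
      exact h2
    have h0 : 0 ≤ L / κ * t⁻¹ := by positivity
    nlinarith
  have hη2 : |η| ≤ 1 / κ * Real.exp (-2 * δ * t) := by
    refine hη.trans ?_
    have : L * t⁻¹ ≤ 1 := by
      rw [← div_eq_mul_inv, div_le_one ht]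
      exact h1
    calc L / κ * (t⁻¹ * Real.exp (-2 * δ * t)) = (L * t⁻¹) * (1 / κ * Real.exp (-2 * δ * t)) := by
          ring
      _ ≤ 1 * (1 / κ * Real.exp (-2 * δ * t)) := by gcongr
      _ = _ := one_mul _
  have hmain : |t / l - 1| ≤ 2 / κ * Real.exp (-2 * δ * t) := by
    have : t / l = Real.exp η := by
      rw [htl]
      field_simp
    rw [this]
    refine (Real.abs_exp_sub_one_le hη1).trans ?_
    calc 2 * |η| ≤ 2 * (1 / κ * Real.exp (-2 * δ * t)) := by gcongr
      _ = _ := by ring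
  -- Needed for the second estimate: replacing `t` by `l` in the exponential costs at most a factor
  -- `e < 3`, whence `6 = 2 · 3`.
  have hlt : 2 * δ * (l - t) ≤ 1 := by
    have e : l = t * Real.exp (-η) := by
      rw [htl, mul_assoc, ← Real.exp_add, add_neg_cancel, Real.exp_zero, mul_one]
    have h4 := Real.abs_exp_sub_one_le (x := -η) (by rwa [abs_neg])
    rw [abs_neg] at h4
    have h5 : Real.exp (-η) - 1 ≤ 2 * (L / κ * (t⁻¹ * Real.exp (-2 * δ * t))) :=
      (le_abs_self _).trans (h4.trans (by gcongr))
    have h6 : l - t ≤ t * (2 * (L / κ * (t⁻¹ * Real.exp (-2 * δ * t)))) := by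
      rw [e]
      nlinarith
    have h7 : t * (2 * (L / κ * (t⁻¹ * Real.exp (-2 * δ * t)))) =
        2 * L / κ * Real.exp (-2 * δ * t) := by
      field_simp
    rw [h7] at h6
    calc 2 * δ * (l - t) ≤ 2 * δ * (2 * L / κ * Real.exp (-2 * δ * t)) := by gcongr
      _ = 4 * δ * L / κ * Real.exp (-2 * δ * t) := by ring
      _ ≤ 1 := h3
  have h8 : Real.exp (-2 * δ * t) ≤ 3 * Real.exp (-2 * δ * l) := by
    have : -2 * δ * t = 2 * δ * (l - t) + -2 * δ * l := by ring
    rw [this, Real.exp_add]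
    have h9 : Real.exp (2 * δ * (l - t)) ≤ 3 :=
      (Real.exp_le_exp.2 hlt).trans (by linarith [Real.exp_one_lt_d9])
    gcongr
  refine ⟨hmain.trans ?_, hmain.trans ?_⟩
  · gcongr
    norm_num
  · calc 2 / κ * Real.exp (-2 * δ * t) ≤ 2 / κ * (3 * Real.exp (-2 * δ * l)) := by gcongr
      _ = _ := by ring

/-- Beyond some threshold all the estimates on `robinQuot` hold. -/
lemma exists_threshold {κ δ : ℝ} {α : ℝ → ℝ} (hκ : 0 < κ) (hδ : 0 < δ)
    (hα : ∃ U ∈ 𝓝 (0 : ℝ), ContDiffOn ℝ ∞ α U) :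
    ∃ K : ℝ, 0 ≤ K ∧ ∃ t₀ > 0, ∀ t ≥ t₀,
      2 / 3 < t * δ ∧ 0 < (robinI κ δ α t).re ∧ 0 ≤ deriv (fun t : ℝ => t - α t⁻¹) t ∧
      HasDerivAt (robinQuot κ δ α) (deriv (robinQuot κ δ α) t) t ∧
      |deriv (robinQuot κ δ α) t| < κ / t ∧
      |robinQuot κ δ α t| ≤ K * (t⁻¹ * Real.exp (-2 * δ * t)) ∧
      K ≤ t ∧ K ≤ κ * t ∧ 4 * δ * K / κ * Real.exp (-2 * δ * t) ≤ 1 := by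
  obtain ⟨A, hA⟩ := eventually_boundary_coeff hα
  obtain ⟨K, hK, hd⟩ := exists_deriv_robinQuot_le hκ hδ hα
  obtain ⟨t₁, ht₁⟩ := eventually_atTop.1 (hd.and (eventually_gt_atTop 0))
  have ht₁0 : 0 < t₁ := (ht₁ t₁ le_rfl).2
  have hlim := tendsto_robinQuot hκ hδ hα
  have hx : Tendsto (fun t : ℝ => t * δ) atTop atTop := tendsto_id.atTop_mul_const hδ
  have hx' : Tendsto (fun t : ℝ => κ * t) atTop atTop := tendsto_id.const_mul_atTop hκ
  have hexp : Tendsto (fun t : ℝ => Real.exp (-2 * δ * t)) atTop (𝓝 0) := by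
    refine Real.tendsto_exp_atBot.comp ?_
    exact tendsto_id.const_mul_atTop_of_neg (by linarith)
  -- The constant gained by integrating the derivative bound from infinity; it is the `K` of the
  -- conclusion.
  set L := K / (2 * δ) with hL
  have e1 := hexp.const_mul K
  have e2 := hexp.const_mul (4 * δ * L / κ)
  rw [mul_zero] at e1 e2
  have hev : ∀ᶠ t : ℝ in atTop, 2 / 3 < t * δ ∧ 0 < (robinI κ δ α t).re ∧
      0 ≤ deriv (fun t : ℝ => t - α t⁻¹) t ∧
      HasDerivAt (robinQuot κ δ α) (deriv (robinQuot κ δ α) t) t ∧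
      |deriv (robinQuot κ δ α) t| < κ / t ∧
      |robinQuot κ δ α t| ≤ L * (t⁻¹ * Real.exp (-2 * δ * t)) ∧
      L ≤ t ∧ L ≤ κ * t ∧ 4 * δ * L / κ * Real.exp (-2 * δ * t) ≤ 1 := by
    filter_upwards [hA, eventually_re_robinI hκ hδ hα, hx.eventually_gt_atTop (2 / 3), hd,
      eventually_ge_atTop t₁, e1.eventually_lt_const hκ, e2.eventually_lt_const zero_lt_one,
      eventually_ge_atTop L, hx'.eventually_ge_atTop L] with t a1 a2 a3 a4 a5 a6 a7 a8 a9
    have ht : 0 < t := ht₁0.trans_le a5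
    refine ⟨a3, (mul_pos ht (besselZero_pos _)).trans_le a2, a1.2.2.1, a4.1, ?_, ?_, a8, a9, a7.le⟩
    · refine a4.2.trans_lt ?_
      rw [lt_div_iff₀ ht]
      calc K * (t⁻¹ * Real.exp (-2 * δ * t)) * t = K * Real.exp (-2 * δ * t) := by field_simp
        _ < κ := a6
    · have h1 := le_of_hasDerivAt_of_tendsto_zero hδ hK ht₁0 (fun s hs => (ht₁ s hs).1.1)
        (fun s hs => (ht₁ s hs).1.2) hlim a5
      have hneg : Tendsto (fun t => -robinQuot κ δ α t) atTop (𝓝 0) := by simpa using hlim.neg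
      have h2 := le_of_hasDerivAt_of_tendsto_zero hδ hK ht₁0 (fun s hs => (ht₁ s hs).1.1.neg)
        (fun s hs => by rw [abs_neg]; exact (ht₁ s hs).1.2) hneg a5
      rw [Pi.neg_apply] at h2
      rw [abs_le]
      exact ⟨h1, by linarith⟩
  obtain ⟨t₀, ht₀⟩ := eventually_atTop.1 (hev.and (eventually_gt_atTop 0))
  exact ⟨L, by positivity, t₀, (ht₀ t₀ le_rfl).2, fun t ht => (ht₀ t ht).1⟩

/-- The logarithm contributes slope `κ/t`, and `arctan` is a contraction, so the assumed bound on
the derivative of `robinQuot` cannot offset it. -/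
lemma strictMonoOn_charPhase {κ γ γκ δ t₀ : ℝ} {α : ℝ → ℝ} (ht₀ : 0 < t₀)
    (hd : ∀ t ≥ t₀, HasDerivAt (robinQuot κ δ α) (deriv (robinQuot κ δ α) t) t)
    (hb : ∀ t ≥ t₀, |deriv (robinQuot κ δ α) t| < κ / t) :
    ContinuousOn (charPhase κ γ γκ δ α) (Ici t₀) ∧
      StrictMonoOn (charPhase κ γ γκ δ α) (Ici t₀) := by
  have hD : ∀ t ≥ t₀, HasDerivAt (charPhase κ γ γκ δ α)
      (κ * t⁻¹ - 1 / (1 + robinQuot κ δ α t ^ 2) * deriv (robinQuot κ δ α) t) t := by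
    intro t ht
    have h1 := (((Real.hasDerivAt_log (ht₀.trans_le ht).ne').const_mul κ).sub_const γκ).sub_const γ
    exact h1.sub (hd t ht).arctan
  have hc : ContinuousOn (charPhase κ γ γκ δ α) (Ici t₀) :=
    fun t ht => (hD t ht).continuousAt.continuousWithinAt
  refine ⟨hc, strictMonoOn_of_deriv_pos (convex_Ici t₀) hc fun t ht => ?_⟩
  rw [interior_Ici] at ht
  have ht' : t₀ ≤ t := le_of_lt ht
  rw [(hD t ht').deriv]
  have h1 : 1 / (1 + robinQuot κ δ α t ^ 2) ≤ 1 := by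
    rw [div_le_one (by positivity)]
    nlinarith [sq_nonneg (robinQuot κ δ α t)]
  have h0 : 0 ≤ 1 / (1 + robinQuot κ δ α t ^ 2) := by positivity
  have h2 : 1 / (1 + robinQuot κ δ α t ^ 2) * deriv (robinQuot κ δ α) t ≤
      |deriv (robinQuot κ δ α) t| := by
    have h3 := le_abs_self (deriv (robinQuot κ δ α) t)
    nlinarith [abs_nonneg (deriv (robinQuot κ δ α) t)]
  have h4 := hb t ht'
  rw [div_eq_mul_inv] at h4
  linarith

lemma tendsto_charPhase {κ : ℝ} (γ γκ δ : ℝ) (α : ℝ → ℝ) (hκ : 0 < κ) :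
    Tendsto (charPhase κ γ γκ δ α) atTop atTop := by
  have h1 : Tendsto (fun t => κ * Real.log t + (-γκ - γ - Real.pi / 2)) atTop atTop :=
    tendsto_atTop_add_const_right _ _ (Real.tendsto_log_atTop.const_mul_atTop hκ)
  refine tendsto_atTop_mono (fun t => ?_) h1
  have := (Real.arctan_lt_pi_div_two (robinQuot κ δ α t)).le
  rw [charPhase, phaseShift]
  linarith

lemma eq_tauLead_mul_exp {κ γ γκ δ t : ℝ} {α : ℝ → ℝ} (hκ : 0 < κ) (ht : 0 < t) {k : ℤ}
    (hk : charPhase κ γ γκ δ α t = k * Real.pi) :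
    t = tauLead κ γ γκ k * Real.exp (Real.arctan (robinQuot κ δ α t) / κ) := by
  rw [tauLead, ← Real.exp_add, ← add_div]
  rw [charPhase, phaseShift] at hk
  have : γκ + γ + k * Real.pi + Real.arctan (robinQuot κ δ α t) = κ * Real.log t := by linarith
  rw [this, mul_div_cancel_left₀ _ hκ.ne', Real.exp_log ht]

end BesselRobin

theorem mainTheorem4 (κ : ℝ) (hκ : 0 < κ) (γ : ℝ) (hγ : γ ∈ Set.Ico 0 Real.pi)
    (γκ : ℝ)
    (hγκ : Complex.Gamma (1 + κ * Complex.I) =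
      (Real.sqrt (Real.pi * κ / Real.sinh (Real.pi * κ)) : ℂ) * Complex.exp (γκ * Complex.I))
    (α : ℝ → ℝ) (hα : ∃ U ∈ 𝓝 (0 : ℝ), ContDiffOn ℝ ∞ α U)
    (ζ : ℝ → ℝ) (hζ : ContDiff ℝ ∞ ζ) (hζ1 : ∀ r < 1 / 3, ζ r = 1) (hζ0 : ∀ r > 2 / 3, ζ r = 0) :
    ∃ c > 0, ∀ δ > 0, ∃ (kδ : ℤ) (τ : ℤ → ℝ),
      0 < τ kδ ∧ StrictMonoOn τ (Set.Ici kδ) ∧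
      -- the eigenvalues not less than the first one listed are exactly the listed ones
      {t : ℝ | τ kδ ≤ t ∧ BesselRobin.IsEigenvalue κ γ δ α ζ t} = τ '' Set.Ici kδ ∧
      (∀ k ≥ kδ,
        BesselRobin.IsSimpleEigenvalue κ γ δ α ζ (τ k) ∧
        |τ k / BesselRobin.tauLead κ γ γκ k - 1| ≤ c * Real.exp (-2 * δ * τ k) ∧
        |τ k / BesselRobin.tauLead κ γ γκ k - 1| ≤
          c * Real.exp (-2 * δ * BesselRobin.tauLead κ γ γκ k) ∧
        BesselRobin.IsEigenfunction κ γ δ α ζ (τ k) (BesselRobin.Phi κ δ α (τ k))) ∧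
      ∃ C : ℝ, ∀ t ≥ τ kδ,
        BesselRobin.robin δ α t (fun r => BesselRobin.Iim κ (t * r)) ≠ 0 ∧
        ‖BesselRobin.Q κ δ α t‖ ≤ C * t⁻¹ * Real.exp (-2 * δ * t) := by
  -- The constant is fixed before `δ`; every constant depending on `δ` goes into the threshold `t₀`,
  -- hence into the first index.
  refine ⟨6 / κ, by positivity, fun δ hδ => ?_⟩
  obtain ⟨K, hK, t₀, ht₀, hth⟩ := BesselRobin.exists_threshold (α := α) hκ hδ hα
  obtain ⟨hcont, hmono⟩ := BesselRobin.strictMonoOn_charPhase (γ := γ) (γκ := γκ) ht₀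
    (fun t ht => (hth t ht).2.2.2.1) (fun t ht => (hth t ht).2.2.2.2.1)
  obtain ⟨kδ, τ, hτmono, hτ, hτall⟩ := BesselRobin.exists_seq_eq_int_mul_pi hmono hcont
    (BesselRobin.tendsto_charPhase γ γκ δ α hκ)
  have hpos : ∀ t ≥ t₀, 0 < t := fun t ht => ht₀.trans_le ht
  have hτk : t₀ ≤ τ kδ := (hτ kδ le_rfl).1
  have hev : ∀ t ≥ t₀, BesselRobin.IsEigenvalue κ γ δ α ζ t ↔
      ∃ k : ℤ, BesselRobin.charPhase κ γ γκ δ α t = k * Real.pi := fun t ht =>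
    BesselRobin.isEigenvalue_iff hκ hγκ hζ hζ1 hζ0 hδ (hpos t ht) (hth t ht).1
      (hth t ht).2.1.ne'
  refine ⟨kδ, τ, hpos _ hτk, hτmono, ?_, fun k hk => ?_,
    Real.pi / Real.sinh (Real.pi * κ) * K, fun t ht => ?_⟩
  · ext t
    constructor
    · rintro ⟨ht, hE⟩
      exact hτall t ht ((hev t (hτk.trans ht)).1 hE)
    · rintro ⟨k, hk, rfl⟩
      exact ⟨hτmono.monotoneOn self_mem_Ici hk hk, (hev _ (hτ k hk).1).2 ⟨k, (hτ k hk).2⟩⟩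
  · obtain ⟨hk₀, hkG⟩ := hτ k hk
    obtain ⟨a1, a2, a3, -, -, a6, a7, a8, a9⟩ := hth _ hk₀
    have hk0 := hpos _ hk₀
    have hPhi := BesselRobin.isEigenfunction_Phi hκ hγκ hζ hζ1 hζ0 hδ hk0 a1 a2.ne' hkG
    -- The logarithm of the ratio of eigenvalue to leading term is exactly this quantity, by
    -- `eq_tauLead_mul_exp`.
    have hη : |Real.arctan (BesselRobin.robinQuot κ δ α (τ k)) / κ| ≤
        K / κ * ((τ k)⁻¹ * Real.exp (-2 * δ * τ k)) := by
      rw [abs_div, abs_of_pos hκ, div_mul_eq_mul_div]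
      exact div_le_div_of_nonneg_right ((BesselRobin.abs_arctan_le _).trans a6) hκ.le
    have hest := BesselRobin.abs_div_sub_one_le hκ hδ hk0 hK (Real.exp_pos _)
      (BesselRobin.eq_tauLead_mul_exp hκ hk0 hkG) hη a7 a8 a9
    exact ⟨BesselRobin.isSimpleEigenvalue_of_isEigenfunction hκ hγκ hζ hζ1 hζ0 hδ hk0 a1 a3 hPhi,
      hest.1, hest.2, hPhi⟩
  · have ht' := hτk.trans ht
    obtain ⟨-, a2, -, -, -, a6, -⟩ := hth t ht'
    have hp : 0 < Real.pi / Real.sinh (Real.pi * κ) :=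
      div_pos Real.pi_pos (BesselRobin.sinh_pi_mul_pos hκ)
    constructor
    · rw [BesselRobin.robin_Iim α hδ (hpos t ht')]
      exact_mod_cast a2.ne'
    · rw [BesselRobin.Q_eq α hδ (hpos t ht'), Complex.norm_real, Real.norm_eq_abs, abs_mul,
        abs_of_pos hp]
      calc _ ≤ Real.pi / Real.sinh (Real.pi * κ) * (K * (t⁻¹ * Real.exp (-2 * δ * t))) := by gcongr
        _ = _ := by ring
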